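/- **Conventions.** Let $L$ be a dense chain with more than one element and at most one endpoint. The circle based on $L$ is $C=(L,\mathrm{Cr})$, where $\mathrm{Cr}(x,y,z)$ means $x<y<z$, $y<z<x$ or $z<x<y$; $C^*$ is $C$ with the reversed orientation. The equal orientation structure is $EO(C)=(L,\mathrm{Eo})$, where $\mathrm{Eo}(\vec x;\vec y)$ means that $\mathrm{Cr}(x_1,x_2,x_3)\wedge\mathrm{Cr}(y_1,y_2,y_3)$ or $\mathrm{Cr}(x_3,x_2,x_1)\wedge\mathrm{Cr}(y_3,y_2,y_1)$. The completion $\bar C$ is the circle based on the Dedekind completion of $L$ (which keeps an endpoint of $L$), with one endpoint adjoined if there is none. A bounded interval of a circle is a set $(x,y)=\{z:\mathrm{Cr}(x,z,y)\}$ with $x\ne y$; the intervals are the bounded intervals, the whole circle, and the circle less a point. The intervals of $\bar C$ generate its topology. A monocircular permutation group $\langle EO(C),G\rangle$ consists of $EO(C)$ and a subgroup $G\le\mathrm{Aut}(EO(C))$; each $g\in G$ is identified with its unique extension to an automorphism of $EO(\bar C)$. An element is bounded if its support $\{x\in\bar C: g(x)\neq x\}$ lies in a bounded interval of $\bar C$.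 $\mathrm{Crs}(I_1,\dots,I_4)$ means that all $I_i$ are nonempty and $\mathrm{Cr}(x_i,x_j,x_k)$ whenever $i<j<k$ and the $x_l\in I_l$. The group is 4-interval-transitive if for all intervals of $C$ with $\mathrm{Crs}(I_1,\dots,I_4)$ and $\mathrm{Crs}(J_1,\dots,J_4)$ some $g\in G$ satisfies $g(I_i)\cap J_i\ne\emptyset$ for all $i$. Let $K$ be the class of all 4-interval-transitive monocircular permutation groups $\langle EO(C),G\rangle$ having a nonidentity bounded element. $\mathrm{Opp}(G)$ is the subgroup of orientation-preserving elements, $\mathrm{Bdd}(G)$ the subgroup generated by the bounded elements, and $\mathrm{Bdd}'(G)$ its derived group. Put $\mathrm{var}(g)=\mathrm{int}\,\mathrm{cl}\,\mathrm{supp}(g)$, and let $\mathrm{Ep}(G)\subseteq\bar C$ be the set of boundary points of connected components of $\mathrm{int}(\bar C\setminus \mathrm{var}(g))$, for $g\in G$; $EP(G)=(\mathrm{Ep}(G),\mathrm{Eo})$. For $S\subseteq\bar C$ and $H \le G$, $\mathrm{ACT}(S,H)$ is the structure with universe $S\sqcup H$, the relation $\mathrm{Eo}$ on $S$, the composition of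 $H$, the application $(g,x)\mapsto g(x)$, and predicates for $S$ and $H$; its language is called $\mathcal L^{MCPG}$, and $\mathcal L^{GR}$ is the language of groups. A bijection of circles is monocircular if it preserves or reverses orientation. $\tau$ induces $\alpha$ if $\alpha(g)=\tau g\tau^{-1}$ for all $g$. An orbit means a $G$-orbit in $\bar C$, with the orientation of $\bar C$. A first order strong interpretation of structures $M^*$ in structures $M$ with $|M|\subseteq|M^*|$ consists of first order formulas defining a set $U$ of $n$-tuples of $M$, an equivalence relation on it, a relation for each relation of $M^*$ (functions being regarded as relations), and a relation between $n$-tuples and elements of $M$, such that for each pair $(M,M^*)$ there is a surjection $\mu:U\to|M^*|$ whose kernel is that equivalence relation, which carries the defined relations to those of $M^*$, and for which the last relation is exactly $\{(\vec a,\mu(\vec a)):\mu(\vec a)\in|M|\}$. In a second order strong interpretation the formulas may be second order, and the tuples may contain relations on $M$ as well as elements. **Theorem (Monocircular Reconstruction Package).** (A) *Two groups.* Let $\langle EO(C_1),G_1\rangle,\langle EO(C_2),G_2\rangle\in K$. 1. If $G_1\equiv G_2$, then $\mathrm{ACT}(EP(G_1),G_1)\equiv \mathrm{ACT}(EP(G_2),G_2)$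 and $\mathrm{ACT}(EP(G_1),\mathrm{Opp}(G_1))\equiv \mathrm{ACT}(EP(G_2),\mathrm{Opp}(G_2))$. 2. For each isomorphism $\alpha:G_1\cong G_2$ there is a unique monocircular bijection $\tau:\bar C_1\to\bar C_2$ inducing $\alpha$; equivalently, there is a unique isomorphism $\tau:EO(\bar C_1)\cong EO(\bar C_2)$ such that $\tau\cup\alpha$ is an isomorphism $\mathrm{ACT}(\bar C_1,G_1)\cong \mathrm{ACT}(\bar C_2,G_2)$. Moreover $\tau|_{\mathrm{Ep}(G_1)}\cup\alpha$ is an isomorphism $\mathrm{ACT}(EP(G_1),G_1)\cong\mathrm{ACT}(EP(G_2),G_2)$. 3. This $\tau$ induces a bijection $M\mapsto\tau(M)$ between the sets of orbits. Either $\tau$ preserves orientation, and for each orbit $M$ the map $\tau|_M\cup\alpha$ is an isomorphism $\langle M,G_1\rangle\cong\langle\tau(M),G_2\rangle$, or $\tau$ reverses orientation, and for each $M$ it is an isomorphism $\langle M,G_1\rangle\cong\langle\tau(M)^*,G_2\rangle$. 4. A bijection $\bar C_1\to\bar C_2$ is an isomorphism $EO(\bar C_1)\cong EO(\bar C_2)$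 iff it is a homeomorphism. (B) *One group.* Let $\langle EO(C),G\rangle\in K$. 1. Every automorphism $\alpha$ of $G$ is conjugation by a unique $\tau\in\mathrm{Aut}(EO(\bar C))$, and conjugation gives $\mathrm{Aut}(G)=\mathrm{Norm}_{\mathrm{Aut}(EO(\bar C))}(G)=\mathrm{Norm}_{\mathrm{Homeo}(\bar C)}(G)$. Moreover $\tau|_{\mathrm{Ep}(G)}\cup\alpha$ is an automorphism of $\mathrm{ACT}(EP(G),G)$, and (A3) holds for $\tau$ and $\alpha$ with $G_1=G_2=G$. 2. $\mathrm{Bdd}(G)$, $\mathrm{Bdd}'(G)$ and $\mathrm{Opp}(G)$ are characteristic subgroups of $G$. 3. $\mathrm{Aut}(G)\le\mathrm{Aut}(\mathrm{Bdd}(G))\le\mathrm{Aut}(\mathrm{Bdd}'(G))\le\mathrm{Aut}(EO(\bar C))$, where the automorphism group of each of these three groups is identified through conjugation with its normalizer in $\mathrm{Aut}(EO(\bar C))$; each automorphism of $G$ is determined by its restriction to $\mathrm{Bdd}'(G)$. 4. If $G$ is transitive on $C$, then $\mathrm{Aut}(G)=\mathrm{Norm}_{\mathrm{Aut}(EO(C))}(G)$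 iff there is no orbit $M\ne C$ with $\langle C,G\rangle\cong\langle M,G\rangle$ or $\langle C,G\rangle\cong\langle M^*,G\rangle$ (as permutation groups on circles). 5. $G\not\equiv\mathrm{Opp}(G)$ unless $G=\mathrm{Opp}(G)$. (C) *Interpretations, uniformly over $K$.* 1. $\{\mathrm{ACT}(EP(G),G)\}$ is first order strongly interpretable in $\{G\}$, and $\{\mathrm{ACT}(\bar C,G)\}$ is second order strongly interpretable in $\{G\}$, in the language $\mathcal L^{GR}$. 2. For each first order formula $\varphi(x_1,\dots,x_n)$ of $\mathcal L^{MCPG}$ whose free variables are group variables there is a first order formula $\psi$ of $\mathcal L^{GR}$ such that, for all $\langle EO(C),G\rangle\in K$ and $\vec g\in G^n$, $\mathrm{ACT}(EP(G),G)\models\varphi[\vec g]$ iff $G\models\psi[\vec g]$. In particular each of the following is expressible by a first order formula of $\mathcal L^{GR}$: (i) $g$ is signed, that is, $g^2\ne\mathrm{Id}$ and $\mathrm{Eo}(g^2(x_1),g(x_1),x_1;g^2(x_2),g(x_2),x_2)$ for all $x_1,x_2\in C\cap\mathrm{supp}(g^2)$; (ii) $g_1,g_2$ are signed and have the same sign,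 that is, $\mathrm{Eo}(g_1^2(x_1),g_1(x_1),x_1;g_2^2(x_2),g_2(x_2),x_2)$ for all $x_i\in C\cap\mathrm{supp}(g_i^2)$; (iii) $g$ is bounded; (iv) $g$ preserves orientation; (v) $G$ is transitive on $\mathrm{Ep}(G)$; (vi) $G$ has precisely $k$ orbits in $\mathrm{Ep}(G)$, for a given natural number $k$. 3. For each first order $\varphi$ as in 2 there is a second order formula $\psi$ of $\mathcal L^{GR}$ such that $\mathrm{ACT}(\bar C,G)\models\varphi[\vec g]$ iff $G\models\psi[\vec g]$, throughout $K$; and there is a second order sentence of $\mathcal L^{GR}$ which, for all $\langle EO(C),G\rangle \in K$ with $G$ transitive on $C$, holds in $G$ iff $C$ is Dedekind complete ($C=\bar C$). -/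

import Mathlib

universe u

/-! ## Circles, orientation, and the four-place notions built from them -/

/-- A chain on which a circle may be based: dense, with more than one element, and with at most
one endpoint. -/
class CircleBase (L : Type u) [LinearOrder L] : Prop where
  dense : DenselyOrdered L
  nontrivial : Nontrivial L
  atMostOneEndpoint : NoMinOrder L ∨ NoMaxOrder L

/-- The circular order relation of the circle based on a chain. -/
def Cr {X : Type*} [LinearOrder X] (x y z : X) : Prop :=
  (x < y ∧ y < z) ∨ (y < z ∧ z < x) ∨ (z < x ∧ x < y)

/-- The equal orientation relation. -/
def Eo {X : Type*} [LinearOrder X] (x₁ x₂ x₃ y₁ y₂ y₃ : X) : Prop :=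
  (Cr x₁ x₂ x₃ ∧ Cr y₁ y₂ y₃) ∨ (Cr x₃ x₂ x₁ ∧ Cr y₃ y₂ y₁)

section Maps
variable {X Y : Type*} [LinearOrder X] [LinearOrder Y]

def PreservesCr (f : X → Y) : Prop := ∀ x y z, Cr x y z ↔ Cr (f x) (f y) (f z)

def ReversesCr (f : X → Y) : Prop := ∀ x y z, Cr x y z ↔ Cr (f z) (f y) (f x)

/-- A monocircular map: it preserves or reverses orientation. -/
def Monocircular (f : X → Y) : Prop := PreservesCr f ∨ ReversesCr f

def PreservesEo (f : X → Y) : Prop :=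
  ∀ x₁ x₂ x₃ y₁ y₂ y₃, Eo x₁ x₂ x₃ y₁ y₂ y₃ ↔
    Eo (f x₁) (f x₂) (f x₃) (f y₁) (f y₂) (f y₃)

end Maps

/-- The automorphism group of the equal orientation structure `EO(X)`. -/
def autEO (X : Type*) [LinearOrder X] : Subgroup (Equiv.Perm X) where
  carrier := {g | PreservesEo g}
  mul_mem' := by
    intro a b ha hb x₁ x₂ x₃ y₁ y₂ y₃
    exact (hb x₁ x₂ x₃ y₁ y₂ y₃).trans (ha _ _ _ _ _ _)
  one_mem' := by
    intro x₁ x₂ x₃ y₁ y₂ y₃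
    exact Iff.rfl
  inv_mem' := by
    intro a ha x₁ x₂ x₃ y₁ y₂ y₃
    have h := ha (a⁻¹ x₁) (a⁻¹ x₂) (a⁻¹ x₃) (a⁻¹ y₁) (a⁻¹ y₂) (a⁻¹ y₃)
    simp only [Equiv.Perm.inv_def, Equiv.apply_symm_apply] at h
    exact h.symm

/-- The automorphism group of the circle `CR(X)`. -/
def autCR (X : Type*) [LinearOrder X] : Subgroup (Equiv.Perm X) where
  carrier := {g | PreservesCr g}
  mul_mem' := by
    intro a b ha hb x y z
    exact (hb x y z).trans (ha _ _ _)
  one_mem' := by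
    intro x y z
    exact Iff.rfl
  inv_mem' := by
    intro a ha x y z
    have h := ha (a⁻¹ x) (a⁻¹ y) (a⁻¹ z)
    simp only [Equiv.Perm.inv_def, Equiv.apply_symm_apply] at h
    exact h.symm

section Intervals
variable {X : Type*} [LinearOrder X]

/-- Bounded intervals of the circle: the sets `(x, y)` with `x ≠ y`. -/
def IsBddCInterval (I : Set X) : Prop := ∃ x y : X, x ≠ y ∧ I = {z | Cr x z y}

/-- Intervals of the circle: the bounded ones, the whole circle, and the circle less a point. -/
def IsCInterval (I : Set X) : Prop :=
  IsBddCInterval I ∨ I = Set.univ ∨ ∃ x : X, I = {z | z ≠ x}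

/-- `Cr (x₁, …, xₙ)`, for `n ≥ 3`. -/
def CrTuple {n : ℕ} (x : Fin n → X) : Prop :=
  ∀ i j k : Fin n, i < j → j < k → Cr (x i) (x j) (x k)

/-- `Crs (I₁, …, Iₙ)`, for `n ≥ 3`. -/
def Crs {n : ℕ} (I : Fin n → Set X) : Prop :=
  (∀ i, (I i).Nonempty) ∧ ∀ x : Fin n → X, (∀ i, x i ∈ I i) → CrTuple x

/-- `n`-interval-transitivity of a group of permutations of a circle, for `n ≥ 3`. -/
def IntervalTransitive (n : ℕ) (G : Subgroup (Equiv.Perm X)) : Prop :=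
  ∀ I J : Fin n → Set X, (∀ i, IsCInterval (I i)) → (∀ i, IsCInterval (J i)) →
    Crs I → Crs J → ∃ g ∈ G, ∀ i, ((g '' I i) ∩ J i).Nonempty

end Intervals

/-! ## The Dedekind completion of a circle -/

open Classical in
/-- The end of the two-ended Dedekind completion of `L` that is discarded. -/
noncomputable def discardedEnd (L : Type u) [LinearOrder L] : DedekindCut L :=
  if NoMaxOrder L then ⊤ else ⊥

/-- The chain on which the completion of the circle based on `L` is based. `DedekindCut L` has both
a bottom and a top element; one end that does not come from `L` is removed. So, if `L` has exactly
one endpoint, this is the Dedekind completion of `L`, with the same endpoint; if `L` has none, one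
endpoint has been adjoined to the Dedekind completion without endpoints. -/
def CBar (L : Type u) [LinearOrder L] : Type u := {x : DedekindCut L // x ≠ discardedEnd L}

noncomputable instance (L : Type u) [LinearOrder L] : LinearOrder (CBar L) :=
  inferInstanceAs (LinearOrder {x : DedekindCut L // x ≠ discardedEnd L})

theorem principal_ne_discardedEnd {L : Type u} [LinearOrder L] [CircleBase L] (a : L) :
    DedekindCut.principal a ≠ discardedEnd L := by
  unfold discardedEnd
  split_ifs with h
  · obtain ⟨b, hb⟩ := h.exists_gt a
    intro e
    have hle : DedekindCut.principal b ≤ DedekindCut.principal a := e ▸ le_top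
    exact absurd (DedekindCut.principal_le_principal.1 hle) (not_le.2 hb)
  · have h' : NoMinOrder L := (CircleBase.atMostOneEndpoint (L := L)).resolve_right h
    obtain ⟨b, hb⟩ := h'.exists_lt a
    intro e
    have hle : DedekindCut.principal a ≤ DedekindCut.principal b := e ▸ bot_le
    exact absurd (DedekindCut.principal_le_principal.1 hle) (not_le.2 hb)

/-- The inclusion of a circle in its completion. -/
noncomputable def emb {L : Type u} [LinearOrder L] [CircleBase L] (a : L) : CBar L :=
  ⟨DedekindCut.principal a, principal_ne_discardedEnd a⟩

/-- The order topology of the completed circle, generated by its intervals. -/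
instance (L : Type u) [LinearOrder L] : TopologicalSpace (CBar L) :=
  TopologicalSpace.generateFrom {I | IsCInterval I}

/-- The group of self-homeomorphisms of the completed circle. -/
def homeoGroup (L : Type u) [LinearOrder L] : Subgroup (Equiv.Perm (CBar L)) where
  carrier := {τ | Continuous τ ∧ Continuous τ.symm}
  mul_mem' := by
    intro a b ha hb
    exact ⟨ha.1.comp hb.1, hb.2.comp ha.2⟩
  one_mem' := ⟨continuous_id, continuous_id⟩
  inv_mem' := by
    intro a ha
    exact ⟨ha.2, ha.1⟩

section Groups
variable {L : Type u} [LinearOrder L] [CircleBase L]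

open Classical in
/-- The (unique) automorphism of the completed equal orientation structure that extends an
automorphism `g` of the equal orientation structure. -/
noncomputable def bar (g : Equiv.Perm L) : Equiv.Perm (CBar L) :=
  if h : ∃ τ ∈ autEO (CBar L), ∀ x : L, τ (emb x) = emb (g x) then h.choose else 1

/-- The support, a subset of the completion. -/
def cSupp (g : Equiv.Perm L) : Set (CBar L) := {x | bar g x ≠ x}

/-- A bounded element: its support lies in a bounded interval of the completion. -/
def BddElt (g : Equiv.Perm L) : Prop := ∃ I : Set (CBar L), IsBddCInterval I ∧ cSupp g ⊆ I

/-- `⟨EO(C), G⟩` is a monocircular permutation group, `C` the circle based on `L`, which is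
`n`-interval-transitive and has a nonidentity bounded element. -/
structure IsMC (n : ℕ) (G : Subgroup (Equiv.Perm L)) : Prop where
  le_autEO : G ≤ autEO L
  intervalTransitive : IntervalTransitive n G
  exists_bdd : ∃ g ∈ G, g ≠ 1 ∧ BddElt g

/-- `Opp(G)`, the subgroup of orientation-preserving elements. -/
def opp (G : Subgroup (Equiv.Perm L)) : Subgroup (Equiv.Perm L) := G ⊓ autCR L

/-- `Bdd(G)`, the subgroup generated by the bounded elements. -/
def bdd (G : Subgroup (Equiv.Perm L)) : Subgroup (Equiv.Perm L) :=
  Subgroup.closure {g | g ∈ G ∧ BddElt g}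

/-- The derived group of `Bdd(G)`. -/
def bddDer (G : Subgroup (Equiv.Perm L)) : Subgroup (Equiv.Perm L) := ⁅bdd G, bdd G⁆

/-- The normalizer of `H` in the automorphism group of the completed equal orientation
structure. -/
noncomputable def normAut (H : Subgroup (Equiv.Perm L)) : Subgroup (Equiv.Perm (CBar L)) :=
  autEO (CBar L) ⊓ Subgroup.normalizer (bar '' (H : Set (Equiv.Perm L)))

/-- The normalizer of `H` in the homeomorphism group of the completed circle. -/
noncomputable def normHomeo (H : Subgroup (Equiv.Perm L)) : Subgroup (Equiv.Perm (CBar L)) :=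
  homeoGroup L ⊓ Subgroup.normalizer (bar '' (H : Set (Equiv.Perm L)))

/-- The normalizer of `H` in the automorphism group of the (uncompleted) equal orientation
structure. -/
def normBase (H : Subgroup (Equiv.Perm L)) : Subgroup (Equiv.Perm L) :=
  autEO L ⊓ Subgroup.normalizer (H : Set (Equiv.Perm L))

/-- `Aut(H) = K` for a group `K` of permutations of the completion: `K` acts on `H` by conjugation,
and this is an isomorphism of `K` onto the automorphism group of `H`. -/
def AutEq (H : Subgroup (Equiv.Perm L)) (K : Subgroup (Equiv.Perm (CBar L))) : Prop :=
  ∃ Φ : K ≃* MulAut H, ∀ (τ : K) (h : H),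
    bar (Φ τ h : Equiv.Perm L) = (τ : Equiv.Perm (CBar L)) * bar h * (τ : Equiv.Perm (CBar L))⁻¹

/-- The same for a group of permutations of the base. -/
def AutEqBase (H K : Subgroup (Equiv.Perm L)) : Prop :=
  ∃ Φ : K ≃* MulAut H, ∀ (τ : K) (h : H),
    (Φ τ h : Equiv.Perm L) = (τ : Equiv.Perm L) * h * (τ : Equiv.Perm L)⁻¹

/-! ## Endpoints and orbits -/

/-- `var(g)`, a regular open set. -/
def gVar (g : Equiv.Perm L) : Set (CBar L) := interior (closure (cSupp g))

/-- `Ep(U)`: the boundary points of the connected components of `-U`, the complement of `U` in the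
Boolean algebra of regular open sets. -/
def endpts (U : Set (CBar L)) : Set (CBar L) :=
  {p | ∃ x ∈ interior Uᶜ, p ∈ frontier (connectedComponentIn (interior Uᶜ) x)}

/-- The universe of `EP(EO(C), G)`. -/
def Ep (G : Subgroup (Equiv.Perm L)) : Set (CBar L) := {p | ∃ g ∈ G, p ∈ endpts (gVar g)}

/-- The orbit of a point of the completion. -/
def orbitOf (G : Subgroup (Equiv.Perm L)) (x : CBar L) : Set (CBar L) :=
  {y | ∃ g ∈ G, bar g x = y}

/-- The set of orbits of `G` in the completion. -/
def orbits (G : Subgroup (Equiv.Perm L)) : Set (Set (CBar L)) := {M | ∃ x, M = orbitOf G x}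

/-- The set of orbits of `G` in `Ep(EO(C), G)`. -/
def epOrbits (G : Subgroup (Equiv.Perm L)) : Set (Set (CBar L)) := {M | ∃ x ∈ Ep G, M = orbitOf G x}

/-- `g` is signed. -/
def SignedElt (g : Equiv.Perm L) : Prop :=
  g * g ≠ 1 ∧ ∀ x₁ x₂ : L, g (g x₁) ≠ x₁ → g (g x₂) ≠ x₂ →
    Eo (g (g x₁)) (g x₁) x₁ (g (g x₂)) (g x₂) x₂

/-- The condition for signed elements to have the same sign. -/
def SameSign (g₁ g₂ : Equiv.Perm L) : Prop :=
  ∀ x₁ x₂ : L, g₁ (g₁ x₁) ≠ x₁ → g₂ (g₂ x₂) ≠ x₂ →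
    Eo (g₁ (g₁ x₁)) (g₁ x₁) x₁ (g₂ (g₂ x₂)) (g₂ x₂) x₂

end Groups

section TwoGroups
variable {L₁ L₂ : Type u} [LinearOrder L₁] [LinearOrder L₂] [CircleBase L₁] [CircleBase L₂]
  {G₁ : Subgroup (Equiv.Perm L₁)} {G₂ : Subgroup (Equiv.Perm L₂)}

/-- `τ` induces `α`: `α(g) = τ ∘ g ∘ τ⁻¹`. -/
def Induces (τ : CBar L₁ ≃ CBar L₂) (α : G₁ ≃* G₂) : Prop :=
  ∀ g : G₁, bar (α g : Equiv.Perm L₂) = (τ.symm.trans (bar (g : Equiv.Perm L₁))).trans τ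

/-- `σ ∪ α` is compatible with the actions of `G₁` on `M₁` and of `G₂` on `M₂`. -/
def Equivariant {M₁ : Set (CBar L₁)} {M₂ : Set (CBar L₂)} (σ : M₁ ≃ M₂) (α : G₁ ≃* G₂) : Prop :=
  ∀ (g : G₁) (x y : M₁), bar (g : Equiv.Perm L₁) (x : CBar L₁) = y ↔
    bar (α g : Equiv.Perm L₂) (σ x : CBar L₂) = σ y

/-- `σ ∪ α` is an isomorphism of `⟨M₁, G₁⟩` with `⟨M₂, G₂⟩`, where the `Mᵢ` are subcircles of the
completed circles. -/
def IsPermIso {M₁ : Set (CBar L₁)} {M₂ : Set (CBar L₂)} (σ : M₁ ≃ M₂) (α : G₁ ≃* G₂) : Prop :=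
  PreservesCr (fun x => (σ x : M₂)) ∧ Equivariant σ α

/-- `σ ∪ α` is an isomorphism of `⟨M₁, G₁⟩` with `⟨M₂*, G₂⟩`, where `M₂*` is `M₂` with the reverse
orientation. -/
def IsPermAntiIso {M₁ : Set (CBar L₁)} {M₂ : Set (CBar L₂)} (σ : M₁ ≃ M₂) (α : G₁ ≃* G₂) : Prop :=
  ReversesCr (fun x => (σ x : M₂)) ∧ Equivariant σ α

end TwoGroups

/-! ## Languages and structures -/

/-- The function symbols of the language of groups: one binary symbol. -/
inductive GrFunc : ℕ → Type
  | comp : GrFunc 2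

/-- The language of groups. -/
def LGR : FirstOrder.Language.{0, 0} := ⟨GrFunc, fun _ => Empty⟩

instance (M : Type*) [Mul M] : LGR.Structure M where
  funMap := fun {n} (f : GrFunc n) v => match n, f, v with
    | _, GrFunc.comp, v => v 0 * v 1
  RelMap := fun r _ => Empty.elim r

/-- The symbols of the language of monocircular permutation groups, functions being regarded as
relations: `Eo` on points, composition of group elements, application of a group element to a
point, and the predicates for points and for group elements. -/
inductive McRel : ℕ → Type
  | eo : McRel 6
  | comp : McRel 3
  | ap : McRel 3
  | pt : McRel 1
  | grp : McRel 1

/-- The language of monocircular permutation groups. -/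
def LMCPG : FirstOrder.Language.{0, 0} := ⟨fun _ => Empty, McRel⟩

section Act
variable {L : Type u} [LinearOrder L] [CircleBase L]

/-- The universe of `ACT(S, H)`: the points of `S` and the elements of `H`. -/
def Act (S : Set (CBar L)) (H : Subgroup (Equiv.Perm L)) : Type u := S ⊕ H

namespace Act
variable {S : Set (CBar L)} {H : Subgroup (Equiv.Perm L)}

def ofPt (x : S) : Act S H := Sum.inl x

def ofGrp (h : H) : Act S H := Sum.inr h

def IsEo (a b c d e f : Act S H) : Prop :=
  ∃ x₁ x₂ x₃ y₁ y₂ y₃ : S, a = ofPt x₁ ∧ b = ofPt x₂ ∧ c = ofPt x₃ ∧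
    d = ofPt y₁ ∧ e = ofPt y₂ ∧ f = ofPt y₃ ∧
    Eo (x₁ : CBar L) (x₂ : CBar L) (x₃ : CBar L) (y₁ : CBar L) (y₂ : CBar L) (y₃ : CBar L)

def IsComp (a b c : Act S H) : Prop :=
  ∃ g h k : H, a = ofGrp g ∧ b = ofGrp h ∧ c = ofGrp k ∧ g * h = k

def IsAp (a b c : Act S H) : Prop :=
  ∃ (g : H) (x y : S), a = ofGrp g ∧ b = ofPt x ∧ c = ofPt y ∧
    bar (g : Equiv.Perm L) (x : CBar L) = y

/-- The structure `ACT(⟨S, Eo⟩, H)`. -/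
instance : LMCPG.Structure (Act S H) where
  funMap := fun f _ => Empty.elim f
  RelMap := fun {n} (r : McRel n) v => match n, r, v with
    | _, McRel.eo, v => IsEo (v 0) (v 1) (v 2) (v 3) (v 4) (v 5)
    | _, McRel.comp, v => IsComp (v 0) (v 1) (v 2)
    | _, McRel.ap, v => IsAp (v 0) (v 1) (v 2)
    | _, McRel.pt, v => ∃ x : S, v 0 = ofPt x
    | _, McRel.grp, v => ∃ h : H, v 0 = ofGrp h

end Act

/-- `EPACT(EO(C), G)`, the action of `G` on `EP(EO(C), G)`. -/
abbrev EPACT (G : Subgroup (Equiv.Perm L)) : Type u := Act (Ep G) G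

/-- `DCACT(EO(C), G)`, the action of `G` on the completed equal orientation structure. -/
abbrev DCACT (G : Subgroup (Equiv.Perm L)) : Type u := Act (Set.univ : Set (CBar L)) G

end Act

section TwoGroups
variable {L₁ L₂ : Type u} [LinearOrder L₁] [LinearOrder L₂] [CircleBase L₁] [CircleBase L₂]

/-- `τ ∪ α`, with `τ` restricted to the points of the first structure, is an isomorphism of
`ACT(S₁, G₁)` with `ACT(S₂, G₂)`. -/
def UnionIsIso (S₁ : Set (CBar L₁)) (S₂ : Set (CBar L₂)) {G₁ : Subgroup (Equiv.Perm L₁)}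
    {G₂ : Subgroup (Equiv.Perm L₂)} (τ : CBar L₁ ≃ CBar L₂) (α : G₁ ≃* G₂) : Prop :=
  ∃ e : FirstOrder.Language.Equiv LMCPG (Act S₁ G₁) (Act S₂ G₂),
    (∀ x : S₁, ∃ y : S₂, e (Act.ofPt x) = Act.ofPt y ∧ (y : CBar L₂) = τ x) ∧
    (∀ g : G₁, e (Act.ofGrp g) = Act.ofGrp (α g))

/-- The orbit correspondence given by `τ` and `α`: `M ↦ τ(M)` is a bijection between the sets of
orbits, and either `τ` and all its restrictions to orbits preserve orientation and yield
isomorphisms of the permutation groups on corresponding orbits, or all of them reverse orientation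
and yield isomorphisms onto the reversed orbits. -/
def OrbitCorrespondence {G₁ : Subgroup (Equiv.Perm L₁)} {G₂ : Subgroup (Equiv.Perm L₂)}
    (τ : CBar L₁ ≃ CBar L₂) (α : G₁ ≃* G₂) : Prop :=
  Set.BijOn (fun M => τ '' M) (orbits G₁) (orbits G₂) ∧
  ((PreservesCr τ ∧ ∀ M ∈ orbits G₁, IsPermIso (τ.image M) α) ∨
    (ReversesCr τ ∧ ∀ M ∈ orbits G₁, IsPermAntiIso (τ.image M) α))

end TwoGroups

/-! ## First order strong interpretations -/

/-- The formulas of a first order strong interpretation of structures for the relational language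
`Lst` in structures for the language `Lg`. -/
structure FOStrInterp (Lg Lst : FirstOrder.Language.{0, 0}) where
  n : ℕ
  univ : Lg.Formula (Fin n)
  eqv : Lg.Formula (Fin 2 × Fin n)
  rel : ∀ {m : ℕ}, Lst.Relations m → Lg.Formula (Fin m × Fin n)
  imap : Lg.Formula (Fin n ⊕ Unit)

/-- There is a strong interpreting mapping of `N` in `M`, where `M` is regarded as a subset of `N`
by means of `ι`. -/
def FOStrInterp.Interprets {Lg Lst : FirstOrder.Language.{0, 0}} (I : FOStrInterp Lg Lst)
    {M N : Type u} [Lg.Structure M] [Lst.Structure N] (ι : M → N) : Prop :=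
  ∃ μ : {a : Fin I.n → M // I.univ.Realize a} → N,
    Function.Surjective μ ∧
    (∀ a b, μ a = μ b ↔ I.eqv.Realize (fun p => (![a.1, b.1] p.1) p.2)) ∧
    (∀ {m : ℕ} (R : Lst.Relations m) (a : Fin m → {a : Fin I.n → M // I.univ.Realize a}),
      FirstOrder.Language.Structure.RelMap R (fun i => μ (a i)) ↔
        (I.rel R).Realize (fun p => (a p.1).1 p.2)) ∧
    (∀ (a : Fin I.n → M) (x : M), I.imap.Realize (Sum.elim a (fun _ => x)) ↔
      ∃ h : I.univ.Realize a, μ ⟨a, h⟩ = ι x)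

/-! ## Second order logic -/

/-- Second order formulas with free first order variables `α`, free relation variables `σ` (of
arities `ar`), `n` bound first order variables, and bound relation variables with the arities
listed in `Γ`. (Functions are coded as relations.) -/
inductive SOBounded (Lg : FirstOrder.Language.{0, 0}) (α : Type) {σ : Type} (ar : σ → ℕ) :
    ℕ → List ℕ → Type
  | falsum {n : ℕ} {Γ : List ℕ} : SOBounded Lg α ar n Γ
  | equal {n : ℕ} {Γ : List ℕ} (s t : Lg.Term (α ⊕ Fin n)) : SOBounded Lg α ar n Γ
  | rel {n : ℕ} {Γ : List ℕ} {k : ℕ} (R : Lg.Relations k) (ts : Fin k → Lg.Term (α ⊕ Fin n)) :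
      SOBounded Lg α ar n Γ
  | freeApp {n : ℕ} {Γ : List ℕ} (X : σ) (ts : Fin (ar X) → Lg.Term (α ⊕ Fin n)) :
      SOBounded Lg α ar n Γ
  | boundApp {n : ℕ} {Γ : List ℕ} (X : Fin Γ.length)
      (ts : Fin (Γ.get X) → Lg.Term (α ⊕ Fin n)) : SOBounded Lg α ar n Γ
  | imp {n : ℕ} {Γ : List ℕ} (φ ψ : SOBounded Lg α ar n Γ) : SOBounded Lg α ar n Γ
  | all {n : ℕ} {Γ : List ℕ} (φ : SOBounded Lg α ar (n + 1) Γ) : SOBounded Lg α ar n Γ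
  | allRel {n : ℕ} {Γ : List ℕ} (k : ℕ) (φ : SOBounded Lg α ar n (k :: Γ)) :
      SOBounded Lg α ar n Γ

/-- Satisfaction in full second order semantics. -/
def SOBounded.Realize {Lg : FirstOrder.Language.{0, 0}} {α σ : Type} {ar : σ → ℕ} {M : Type u}
    [Lg.Structure M] (v : α → M) (V : (X : σ) → Set (Fin (ar X) → M)) :
    {n : ℕ} → {Γ : List ℕ} → SOBounded Lg α ar n Γ → (Fin n → M) →
      ((X : Fin Γ.length) → Set (Fin (Γ.get X) → M)) → Prop
  | _, _, .falsum, _, _ => False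
  | _, _, .equal s t, w, _ => s.realize (Sum.elim v w) = t.realize (Sum.elim v w)
  | _, _, .rel R ts, w, _ =>
      FirstOrder.Language.Structure.RelMap R (fun i => (ts i).realize (Sum.elim v w))
  | _, _, .freeApp X ts, w, _ => (fun i => (ts i).realize (Sum.elim v w)) ∈ V X
  | _, _, .boundApp X ts, w, W => (fun i => (ts i).realize (Sum.elim v w)) ∈ W X
  | _, _, .imp φ ψ, w, W => φ.Realize v V w W → ψ.Realize v V w W
  | n, _, .all φ, w, W => ∀ a : M, φ.Realize v V (Fin.snoc (α := fun _ : Fin (n + 1) => M) w a) W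
  | _, Γ, .allRel k φ, w, W => ∀ R : Set (Fin k → M),
      φ.Realize v V w
        (Fin.cons (α := fun X : Fin (Γ.length + 1) => Set (Fin ((k :: Γ).get X) → M)) R W)

/-- Second order formulas with free variables as indicated. -/
abbrev SOFormula (Lg : FirstOrder.Language.{0, 0}) (α : Type) {σ : Type} (ar : σ → ℕ) : Type :=
  SOBounded Lg α ar 0 []

def SOFormula.Sat {Lg : FirstOrder.Language.{0, 0}} {α σ : Type} {ar : σ → ℕ}
    (φ : SOFormula Lg α ar) {M : Type u} [Lg.Structure M] (v : α → M)
    (V : (X : σ) → Set (Fin (ar X) → M)) : Prop :=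
  SOBounded.Realize v V φ Fin.elim0 (fun X => Fin.elim0 X)

/-- The formulas of a second order strong interpretation. Points are represented by tuples of `n`
elements and `s` relations, the relations having the arities `ar`. -/
structure SOStrInterp (Lg Lst : FirstOrder.Language.{0, 0}) where
  n : ℕ
  s : ℕ
  ar : Fin s → ℕ
  univ : SOFormula Lg (Fin n) ar
  eqv : SOFormula Lg (Fin 2 × Fin n) (fun p : Fin 2 × Fin s => ar p.2)
  rel : ∀ {m : ℕ}, Lst.Relations m →
    SOFormula Lg (Fin m × Fin n) (fun p : Fin m × Fin s => ar p.2)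
  imap : SOFormula Lg (Fin n ⊕ Unit) ar

/-- The tuples of elements and relations that satisfy the universe formula. -/
structure SOStrInterp.Rep {Lg Lst : FirstOrder.Language.{0, 0}} (I : SOStrInterp Lg Lst)
    (M : Type u) [Lg.Structure M] where
  elt : Fin I.n → M
  set : (j : Fin I.s) → Set (Fin (I.ar j) → M)
  sat : I.univ.Sat elt set

/-- There is a strong interpreting mapping of `N` in `M`, where `M` is regarded as a subset of `N`
by means of `ι`. -/
def SOStrInterp.Interprets {Lg Lst : FirstOrder.Language.{0, 0}} (I : SOStrInterp Lg Lst)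
    {M N : Type u} [Lg.Structure M] [Lst.Structure N] (ι : M → N) : Prop :=
  ∃ μ : I.Rep M → N,
    Function.Surjective μ ∧
    (∀ a b : I.Rep M, μ a = μ b ↔
      I.eqv.Sat (fun p => (![a, b] p.1).elt p.2) (fun p => (![a, b] p.1).set p.2)) ∧
    (∀ {m : ℕ} (R : Lst.Relations m) (a : Fin m → I.Rep M),
      FirstOrder.Language.Structure.RelMap R (fun i => μ (a i)) ↔
        (I.rel R).Sat (fun p => (a p.1).elt p.2) (fun p => (a p.1).set p.2)) ∧
    (∀ (a : Fin I.n → M) (A : (j : Fin I.s) → Set (Fin (I.ar j) → M)) (x : M),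
      I.imap.Sat (Sum.elim a (fun _ => x)) A ↔
        ∃ h : I.univ.Sat a A, μ ⟨a, A, h⟩ = ι x)

/-! ## Expressibility in the language of groups, uniformly over the class `K` of all
4-interval-transitive monocircular permutation groups with a nonidentity bounded element -/

/-- The property `P` of `n`-tuples of group elements is expressed, for all members of the class,
by one first order formula in the language of groups. -/
def FOExpressible (n : ℕ)
    (P : ∀ (L : Type u) [LinearOrder L] [CircleBase L] (G : Subgroup (Equiv.Perm L)),
      (Fin n → G) → Prop) : Prop :=
  ∃ ψ : LGR.Formula (Fin n), ∀ (L : Type u) [LinearOrder L] [CircleBase L]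
    (G : Subgroup (Equiv.Perm L)), IsMC 4 G → ∀ g : Fin n → G, ψ.Realize g ↔ P L G g

/-- The same with a second order formula, all of whose free variables are first order. -/
def SOExpressible (n : ℕ)
    (P : ∀ (L : Type u) [LinearOrder L] [CircleBase L] (G : Subgroup (Equiv.Perm L)),
      (Fin n → G) → Prop) : Prop :=
  ∃ ψ : SOFormula LGR (Fin n) Empty.elim, ∀ (L : Type u) [LinearOrder L] [CircleBase L]
    (G : Subgroup (Equiv.Perm L)), IsMC 4 G →
      ∀ g : Fin n → G, ψ.Sat g (fun X => X.elim) ↔ P L G g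

set_option linter.unusedSectionVars false

/-! ### Combinatorics of the circular order relation -/

section Combinatorics
variable {X : Type*} [LinearOrder X]

/-! The completed circle is compact, connected and locally connected, and everything is deduced from
one property of the action on it, `LocAct`: no point of an open arc is fixed by all the group
elements supported in that arc. Given a nonidentity bounded element, 4-interval-transitivity
provides a conjugate squeezed into a prescribed arc that moves a prescribed point of it
(`IsMC.locAct`). Conversely, `LocAct` yields approximate transitivity on positively oriented
quadruples and hence membership in the class (`LocAct.isMC`). The converse is what allows the
results to be applied to Opp(G), Bdd(G) and Bdd'(G) too.

The regular open sets var(g) are recovered from the group by Rubin's method. The first order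
condition `AlgDisj f g` follows from disjointness of the supports of f and g, and implies
disjointness of the supports of f and g^12. This sandwich is tight enough to make var k ⊆ var f,
disjointness of var f and var g, and boundedness first order conditions on the group
(`LocAct.algSub_iff`, `LocAct.dj_iff`, `LocAct.algBdd_iff`).

Orientation is recovered from the bounded elements. They preserve orientation, and a product of
three of them carries a triple of points arbitrarily close to any triple of the same orientation. So
whether such a product can make three sets var(c) meet three sets var(d) is a question about
orientations of triples (`LocAct.meet_iff`). Denying it for a transposed triple says that all
triples drawn from the sets agree in orientation (`LocAct.eoA_iff`).

Points are recovered as limits of families of group elements whose sets var(g) shrink to them: an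
endpoint from a triple of elements (`EndCode`, `EndMem`), an arbitrary point of the completion from
a set of elements (`ValidSet`), where compactness supplies the limit. Equal orientation and
application of group elements are read off from the families (`LocAct.codeEo_iff`,
`LocAct.codeAp_iff`).

All these predicates are built from the group operation by logical operations, so they are handled
once for every `DefClass`. First order definability gives the interpretation on endpoints, the
transfer of elementary equivalence and the expressibility results. Second order definability gives
the interpretation on the completion. Invariance under isomorphism shows that an isomorphism of
groups carries point codes to point codes, which defines the map τ of completed circles
(`LocAct.exists_inducing`). It is unique because only the identity centralizes the group
(`LocAct.eq_one_of_commute`). The statements about one group follow by applying this to its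
automorphisms and to its locally moving subgroups. -/

theorem Cr.cyc {a b c : X} (h : Cr a b c) : Cr b c a := by grind [Cr]

theorem Cr.cyc' {a b c : X} (h : Cr a b c) : Cr c a b := by grind [Cr]

theorem Cr.ne₁₂ {a b c : X} (h : Cr a b c) : a ≠ b := by grind [Cr]

theorem Cr.ne₂₃ {a b c : X} (h : Cr a b c) : b ≠ c := by grind [Cr]

theorem Cr.ne₁₃ {a b c : X} (h : Cr a b c) : a ≠ c := by grind [Cr]

theorem Cr.not_rev {a b c : X} (h : Cr a b c) : ¬ Cr c b a := by grind [Cr]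

theorem cr_or_rev {a b c : X} (h₁ : a ≠ b) (h₂ : b ≠ c) (h₃ : a ≠ c) : Cr a b c ∨ Cr c b a := by
  grind [Cr]

theorem not_cr_iff {a b z : X} (h : a ≠ b) : ¬ Cr a z b ↔ z = a ∨ z = b ∨ Cr b z a := by
  grind [Cr]

theorem cr_dual {a b c : X} : Cr (OrderDual.toDual a) (OrderDual.toDual b) (OrderDual.toDual c) ↔
    Cr c b a := by
  simp only [Cr, OrderDual.toDual_lt_toDual]; grind

/-- The open arc from `a` to `b`. -/
def arc (a b : X) : Set X := {z | Cr a z b}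

@[simp] theorem mem_arc {a b z : X} : z ∈ arc a b ↔ Cr a z b := Iff.rfl

end Combinatorics

/-- A compact connected circle with the topology generated by its arcs. -/
class CircTop (X : Type*) [LinearOrder X] [TopologicalSpace X] : Prop where
  isOpen_arc (a b : X) : IsOpen (arc a b)
  exists_arc_subset {x : X} {U : Set X} : IsOpen U → x ∈ U → ∃ a b, Cr a x b ∧ arc a b ⊆ U
  dense {a b : X} : a ≠ b → ∃ z, Cr a z b
  preconnected (a b : X) : IsPreconnected (arc a b)
  compact : CompactSpace X
  nontrivial : Nontrivial X

attribute [instance] CircTop.compact CircTop.nontrivial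

open CircTop

/-! ### Topology of a compact connected circle -/

section Topology
variable {X : Type*} [LinearOrder X] [TopologicalSpace X] [CircTop X]

omit [TopologicalSpace X] [CircTop X] in
theorem arc_dual (a b : X) :
    arc (OrderDual.toDual a) (OrderDual.toDual b) = OrderDual.ofDual ⁻¹' arc b a := by
  ext z; exact cr_dual

/-- Reversing the orientation reverses every arc and leaves the topology alone. Each one-sided
statement below is thus obtained for the other side by duality. -/
instance : CircTop Xᵒᵈ where
  isOpen_arc a b := by
    have := (isOpen_arc (OrderDual.ofDual b) (OrderDual.ofDual a)).preimage continuous_ofDual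
    rwa [← arc_dual] at this
  exists_arc_subset {x U} hU hx := by
    obtain ⟨a, b, h, h'⟩ := exists_arc_subset (X := X) (x := OrderDual.ofDual x)
      (hU.preimage continuous_toDual) hx
    exact ⟨OrderDual.toDual b, OrderDual.toDual a, (cr_dual (b := OrderDual.ofDual x)).2 h,
      fun z hz => h' ((cr_dual (b := OrderDual.ofDual z)).1 hz)⟩
  dense {a b} h := by
    obtain ⟨z, hz⟩ := dense (X := X) (a := OrderDual.ofDual b) (b := OrderDual.ofDual a)
      (fun e => h e.symm)
    exact ⟨OrderDual.toDual z, (cr_dual (a := OrderDual.ofDual a) (c := OrderDual.ofDual b)).2 hz⟩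
  preconnected a b := by
    have := (preconnected (OrderDual.ofDual b) (OrderDual.ofDual a)).image OrderDual.toDual
      continuous_toDual.continuousOn
    rwa [OrderDual.toDual.image_eq_preimage_symm, OrderDual.toDual_symm_eq, ← arc_dual] at this
  compact := inferInstanceAs (CompactSpace X)
  nontrivial := inferInstanceAs (Nontrivial X)

theorem exists_closed_arc_subset {x : X} {U : Set X} (hU : IsOpen U) (hx : x ∈ U) :
    ∃ a b, Cr a x b ∧ ∀ z, z = a ∨ z = b ∨ Cr a z b → z ∈ U := by
  obtain ⟨a, b, h, h'⟩ := exists_arc_subset hU hx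
  obtain ⟨a', ha⟩ := dense h.ne₁₂
  obtain ⟨b', hb⟩ := dense h.ne₂₃
  refine ⟨a', b', by grind [Cr], fun z hz => h' ?_⟩
  simp only [mem_arc]
  grind [Cr]

theorem isOpen_ne' (x : X) : IsOpen {z | z ≠ x} := by
  obtain ⟨y, hy⟩ := exists_ne x
  obtain ⟨z, hz⟩ := dense hy
  obtain ⟨w, hw⟩ := dense hy.symm
  have : {z | z ≠ x} = arc x z ∪ arc w x := by
    ext u; simp only [Set.mem_ofPred_eq, Set.mem_union, mem_arc]
    grind [Cr]
  rw [this]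
  exact (isOpen_arc _ _).union (isOpen_arc _ _)

theorem isOpen_cr : IsOpen {p : X × X × X | Cr p.1 p.2.1 p.2.2} := by
  rw [isOpen_iff_forall_mem_open]
  rintro ⟨x, y, z⟩ (h : Cr x y z)
  obtain ⟨a, ha⟩ := dense h.ne₁₂
  obtain ⟨b, hb⟩ := dense h.ne₂₃
  obtain ⟨c, hc⟩ := dense h.ne₁₃.symm
  refine ⟨arc c a ×ˢ arc a b ×ˢ arc b c, ?_,
    (isOpen_arc _ _).prod ((isOpen_arc _ _).prod (isOpen_arc _ _)), ?_⟩
  · rintro ⟨u, v, w⟩ ⟨h₁, h₂, h₃⟩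
    simp only [mem_arc, Set.mem_ofPred_eq] at *
    grind [Cr]
  · simp only [Set.mem_prod, mem_arc]
    grind [Cr]

instance : T2Space X where
  t2 x y hxy := by
    obtain ⟨a, ha⟩ := dense hxy
    obtain ⟨b, hb⟩ := dense hxy.symm
    refine ⟨arc b a, arc a b, isOpen_arc _ _, isOpen_arc _ _, ?_, ?_, ?_⟩
    · simp only [mem_arc]; grind [Cr]
    · simp only [mem_arc]; grind [Cr]
    · rw [Set.disjoint_left]; intro z
      simp only [mem_arc]; grind [Cr]

instance : LocallyConnectedSpace X := by
  refine locallyConnectedSpace_of_connected_bases (ι := X × X) (fun _ p => arc p.1 p.2)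
    (fun x p => Cr p.1 x p.2) (fun x => ?_) (fun x p _ => preconnected _ _)
  refine ⟨fun U => ?_⟩
  rw [mem_nhds_iff]
  constructor
  · rintro ⟨V, hVU, hV, hx⟩
    obtain ⟨a, b, h, h'⟩ := exists_arc_subset hV hx
    exact ⟨(a, b), h, h'.trans hVU⟩
  · rintro ⟨p, h, h'⟩
    exact ⟨_, h', isOpen_arc _ _, h⟩

theorem isClosed_closed_arc {a b : X} (h : a ≠ b) : IsClosed {z | z = a ∨ z = b ∨ Cr a z b} := by
  rw [← isOpen_compl_iff]
  convert isOpen_arc b a using 1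
  ext z
  simp only [Set.mem_compl_iff, Set.mem_ofPred_eq, mem_arc]
  grind [Cr]

theorem closure_arc_subset {a b : X} (h : a ≠ b) :
    closure (arc a b) ⊆ {z | z = a ∨ z = b ∨ Cr a z b} :=
  closure_minimal (fun _ hz => Or.inr (Or.inr hz)) (isClosed_closed_arc h)

theorem left_mem_closure_arc {a b : X} (h : a ≠ b) : a ∈ closure (arc a b) := by
  rw [mem_closure_iff]
  intro U hU ha
  obtain ⟨c, d, h₁, h₂⟩ := exists_arc_subset hU ha
  by_cases hd : Cr a d b
  · obtain ⟨z, hz⟩ := dense h₁.ne₂₃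
    exact ⟨z, h₂ (by simp only [mem_arc]; grind [Cr]), by simp only [mem_arc]; grind [Cr]⟩
  · obtain ⟨z, hz⟩ := dense h
    exact ⟨z, h₂ (by simp only [mem_arc]; grind [Cr]), by simp only [mem_arc]; grind [Cr]⟩

theorem right_mem_closure_arc {a b : X} (h : a ≠ b) : b ∈ closure (arc a b) := by
  have := left_mem_closure_arc (a := OrderDual.toDual b) (b := OrderDual.toDual a)
    (fun e => h e.symm)
  rw [arc_dual] at this
  exact continuous_ofDual.closure_preimage_subset _ this

theorem frontier_arc {a b : X} (h : a ≠ b) : frontier (arc a b) = {a, b} := by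
  rw [(isOpen_arc a b).frontier_eq]
  ext z
  simp only [Set.mem_sdiff, mem_arc, Set.mem_insert_iff, Set.mem_singleton_iff]
  constructor
  · rintro ⟨h₁, h₂⟩
    have := closure_arc_subset h h₁
    simp only [Set.mem_ofPred_eq] at this
    tauto
  · rintro (rfl | rfl)
    · exact ⟨left_mem_closure_arc h, by grind [Cr]⟩
    · exact ⟨right_mem_closure_arc h, by grind [Cr]⟩

theorem exists_ne_mem {x : X} {U : Set X} (hU : IsOpen U) (hx : x ∈ U) : ∃ y ∈ U, y ≠ x := by
  obtain ⟨a, b, h, h'⟩ := exists_arc_subset hU hx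
  obtain ⟨y, hy⟩ := dense h.ne₁₂
  exact ⟨y, h' (by simp only [mem_arc]; grind [Cr]), hy.ne₂₃⟩

/-- Seen from `w`, the set is a final segment of the circle cut at `w`. Its initial end exists
because an arc ending at `w` is connected and cannot be split by a nonempty proper clopen piece. -/
theorem eq_arc_of_final {w : X} {T : Set X} (hT : IsOpen T) (hne : T.Nonempty) (hw : w ∉ T)
    (hup : ∀ y ∈ T, ∀ z, Cr y z w → z ∈ T) (hu : ∃ u, u ≠ w ∧ u ∉ T) :
    ∃ p, p ≠ w ∧ T = arc p w := by
  obtain ⟨u, huw, huT⟩ := hu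
  obtain ⟨y, hy⟩ := hne
  obtain ⟨c, hc⟩ := dense huw.symm
  have hyw : y ≠ w := fun h => hw (h ▸ hy)
  have hyu : y ≠ u := fun h => huT (h ▸ hy)
  have h₁ : ¬ Cr y u w := fun h => huT (hup y hy u h)
  -- If every limit point of `T` in the arc from `c` to `w` belonged to `T`, then `T` and the
  -- complement of its closure would disconnect this arc.
  have hp : ∃ p, Cr c p w ∧ p ∈ closure T ∧ p ∉ T := by
    by_contra! hcon
    obtain ⟨t, -, ht₁, ht₂⟩ := preconnected c w T (closure T)ᶜ hT isClosed_closure.isOpen_compl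
      (fun t ht => by
        by_cases h : t ∈ closure T
        · exact Or.inl (hcon t ht h)
        · exact Or.inr h)
      ⟨y, by simp only [mem_arc]; grind [Cr], hy⟩
      ⟨u, by simp only [mem_arc]; grind [Cr], fun h => huT (hcon u (by grind [Cr]) h)⟩
    exact ht₂ (subset_closure ht₁)
  obtain ⟨p, hp₁, hp₂⟩ := hp
  refine ⟨p, hp₁.ne₂₃, ?_⟩
  ext z
  constructor
  · intro hz
    have h₂ : ¬ Cr z p w := fun h => hp₂.2 (hup z hz p h)
    have h₃ : z ≠ p := fun h => hp₂.2 (h ▸ hz)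
    have h₄ : z ≠ w := fun h => hw (h ▸ hz)
    have := hp₁.ne₂₃
    simp only [mem_arc]
    grind [Cr]
  · intro (hz : Cr p z w)
    obtain ⟨t, ht, htT⟩ := mem_closure_iff.1 hp₂.1 (arc w z) (isOpen_arc _ _)
      (by simp only [mem_arc]; grind [Cr])
    exact hup t htT z (by simp only [mem_arc] at ht; grind [Cr])

theorem eq_arc_of_initial {w : X} {T : Set X} (hT : IsOpen T) (hne : T.Nonempty) (hw : w ∉ T)
    (hup : ∀ y ∈ T, ∀ z, Cr w z y → z ∈ T) (hu : ∃ u, u ≠ w ∧ u ∉ T) :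
    ∃ p, p ≠ w ∧ T = arc w p := by
  obtain ⟨p, hp, h⟩ := eq_arc_of_final (w := OrderDual.toDual w) (T := OrderDual.ofDual ⁻¹' T)
    (hT.preimage continuous_ofDual) hne hw (fun y hy z hz => hup _ hy _ (cr_dual.1 hz)) hu
  refine ⟨OrderDual.ofDual p, hp, Set.ext fun z => ?_⟩
  have := Set.ext_iff.1 h (OrderDual.toDual z)
  exact this.trans (cr_dual (a := OrderDual.ofDual p) (b := z) (c := w))

/-- Cut the circle at a point `w` of `V`. In the resulting chain `A` is convex, and it is the
intersection of the final and the initial segment that it generates. Both segments are arcs with `w`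
as one end. -/
theorem eq_arc_of_isPreconnected {A V : Set X} (hA : IsOpen A) (hc : IsPreconnected A)
    (hne : A.Nonempty) (hV : IsOpen V) (hVne : V.Nonempty) (hd : Disjoint A V) :
    ∃ p q, A = arc p q := by
  obtain ⟨w, hw⟩ := hVne
  obtain ⟨c, d, hcd, hsub⟩ := exists_arc_subset hV hw
  have hnot : ∀ z, Cr c z d → z ∉ A := fun z hz hzA => Set.disjoint_left.1 hd hzA (hsub hz)
  have hconv : ∀ x ∈ A, ∀ y ∈ A, ∀ z, Cr w x z → Cr w z y → z ∈ A := by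
    intro x hx y hy z h₁ h₂
    by_contra hz
    obtain ⟨t, -, ht₁, ht₂⟩ := hc (arc w z) (arc z w) (isOpen_arc _ _) (isOpen_arc _ _) (by
      intro t ht
      have h₃ : t ≠ z := fun h => hz (h ▸ ht)
      have h₄ : t ≠ w := fun h => hnot w hcd (h ▸ ht)
      simp only [Set.mem_union, mem_arc]
      grind [Cr]) ⟨x, hx, h₁⟩ ⟨y, hy, by simp only [mem_arc]; grind [Cr]⟩
    simp only [mem_arc] at ht₁ ht₂
    grind [Cr]
  have hwA : w ∉ A := hnot w hcd
  have hT : ∃ p, p ≠ w ∧ A ∪ ⋃ y ∈ A, arc y w = arc p w := by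
    refine eq_arc_of_final (hA.union (isOpen_biUnion fun y _ => isOpen_arc _ _))
      (hne.mono Set.subset_union_left) ?_ ?_ ?_
    · simp only [Set.mem_union, Set.mem_iUnion, mem_arc, not_or]
      exact ⟨hwA, by grind [Cr]⟩
    · rintro y (hy | hy) z hz
      · exact Or.inr (Set.mem_biUnion hy hz)
      · simp only [Set.mem_iUnion, mem_arc] at hy
        obtain ⟨t, ht, hty⟩ := hy
        exact Or.inr (Set.mem_biUnion ht (by simp only [mem_arc]; grind [Cr]))
    · obtain ⟨u, hu⟩ := dense hcd.ne₂₃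
      refine ⟨u, hu.ne₁₂.symm, ?_⟩
      simp only [Set.mem_union, Set.mem_iUnion, mem_arc, not_or]
      refine ⟨hnot u (by grind [Cr]), ?_⟩
      rintro ⟨t, ht, h⟩
      exact hnot t (by grind [Cr]) ht
  have hS : ∃ q, q ≠ w ∧ A ∪ ⋃ y ∈ A, arc w y = arc w q := by
    refine eq_arc_of_initial (hA.union (isOpen_biUnion fun y _ => isOpen_arc _ _))
      (hne.mono Set.subset_union_left) ?_ ?_ ?_
    · simp only [Set.mem_union, Set.mem_iUnion, mem_arc, not_or]
      exact ⟨hwA, by grind [Cr]⟩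
    · rintro y (hy | hy) z hz
      · exact Or.inr (Set.mem_biUnion hy hz)
      · simp only [Set.mem_iUnion, mem_arc] at hy
        obtain ⟨t, ht, hty⟩ := hy
        exact Or.inr (Set.mem_biUnion ht (by simp only [mem_arc]; grind [Cr]))
    · obtain ⟨u, hu⟩ := dense hcd.ne₁₂
      refine ⟨u, hu.ne₂₃, ?_⟩
      simp only [Set.mem_union, Set.mem_iUnion, mem_arc, not_or]
      refine ⟨hnot u (by grind [Cr]), ?_⟩
      rintro ⟨t, ht, h⟩
      exact hnot t (by grind [Cr]) ht
  obtain ⟨p, hp, hpT⟩ := hT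
  obtain ⟨q, hq, hqS⟩ := hS
  obtain ⟨x, hx⟩ := hne
  have h₁ : ∀ z ∈ A, Cr p z w := fun z hz => by
    have : z ∈ arc p w := hpT ▸ Or.inl hz
    exact this
  have h₂ : ∀ z ∈ A, Cr w z q := fun z hz => by
    have : z ∈ arc w q := hqS ▸ Or.inl hz
    exact this
  have hx₁ := h₁ x hx
  have hx₂ := h₂ x hx
  refine ⟨p, q, Set.Subset.antisymm (fun z hz => ?_) (fun z hz => ?_)⟩
  · have := h₁ z hz
    have := h₂ z hz
    simp only [mem_arc]
    grind [Cr]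
  · simp only [mem_arc] at hz
    have h₃ : z ∈ arc p w := by simp only [mem_arc]; grind [Cr]
    have h₄ : z ∈ arc w q := by simp only [mem_arc]; grind [Cr]
    rw [← hpT] at h₃
    rw [← hqS] at h₄
    rcases h₃ with h₃ | h₃
    · exact h₃
    rcases h₄ with h₄ | h₄
    · exact h₄
    simp only [Set.mem_iUnion, mem_arc] at h₃ h₄
    obtain ⟨y, hy, hy'⟩ := h₃
    obtain ⟨y', hyy, hyy'⟩ := h₄
    exact hconv y hy y' hyy z (by grind [Cr]) hyy'

end Topology

/-! ### Monocircular maps, equal orientation and homeomorphisms -/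

section Monocircular
variable {X Y Z : Type*} [LinearOrder X] [LinearOrder Y] [LinearOrder Z]

theorem Monocircular.preservesEo {f : X → Y} (h : Monocircular f) : PreservesEo f := by
  intro x₁ x₂ x₃ y₁ y₂ y₃
  unfold Eo
  rcases h with h | h
  · rw [h x₁ x₂ x₃, h y₁ y₂ y₃, h x₃ x₂ x₁, h y₃ y₂ y₁]
  · rw [h x₁ x₂ x₃, h y₁ y₂ y₃, h x₃ x₂ x₁, h y₃ y₂ y₁]
    exact or_comm

/-- A fixed positive triple serves as a standard of comparison. Its image is positive or negative,
and this decides the behaviour of `f` on all triples. -/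
theorem PreservesEo.monocircular {f : X → Y} (hX : ∃ a b c : X, Cr a b c) (h : PreservesEo f) :
    Monocircular f := by
  obtain ⟨a, b, c, habc⟩ := hX
  have key : ∀ x y z, Cr x y z ↔ Eo (f a) (f b) (f c) (f x) (f y) (f z) := by
    intro x y z
    rw [← h]
    exact ⟨fun h' => Or.inl ⟨habc, h'⟩, fun h' => h'.elim (·.2) fun h'' =>
      absurd h''.1 habc.not_rev⟩
  rcases (key a b c).1 habc with h' | h'
  · refine Or.inl fun x y z => (key x y z).trans ?_
    exact ⟨fun h'' => h''.elim (·.2) fun h3 => absurd h3.1 h'.1.not_rev, fun h'' => Or.inl ⟨h'.1, h''⟩⟩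
  · refine Or.inr fun x y z => (key x y z).trans ?_
    exact ⟨fun h'' => h''.elim (fun h3 => absurd h3.1 h'.1.not_rev) (·.2), fun h'' => Or.inr ⟨h'.1, h''⟩⟩

theorem PreservesCr.comp {g : Y → Z} {f : X → Y} (hg : PreservesCr g) (hf : PreservesCr f) :
    PreservesCr (g ∘ f) := fun _ _ _ => (hf _ _ _).trans (hg _ _ _)

theorem Monocircular.comp {g : Y → Z} {f : X → Y} (hg : Monocircular g) (hf : Monocircular f) :
    Monocircular (g ∘ f) := by
  rcases hg with hg | hg <;> rcases hf with hf | hf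
  · exact Or.inl fun _ _ _ => (hf _ _ _).trans (hg _ _ _)
  · exact Or.inr fun _ _ _ => (hf _ _ _).trans (hg _ _ _)
  · exact Or.inr fun _ _ _ => (hf _ _ _).trans (hg _ _ _)
  · exact Or.inl fun _ _ _ => (hf _ _ _).trans (hg _ _ _)

theorem PreservesCr.symm {f : X ≃ Y} (h : PreservesCr f) : PreservesCr f.symm := by
  intro x y z
  rw [h, f.apply_symm_apply, f.apply_symm_apply, f.apply_symm_apply]

theorem Monocircular.symm {f : X ≃ Y} (h : Monocircular f) : Monocircular f.symm := by
  rcases h with h | h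
  · exact Or.inl h.symm
  · refine Or.inr fun x y z => ?_
    rw [h, f.apply_symm_apply, f.apply_symm_apply, f.apply_symm_apply]

theorem PreservesCr.image_arc {f : X ≃ Y} (h : PreservesCr f) (a b : X) :
    f '' arc a b = arc (f a) (f b) := by
  rw [f.image_eq_preimage_symm]
  ext z
  simp only [Set.mem_preimage, mem_arc]
  rw [h, f.apply_symm_apply]

theorem ReversesCr.image_arc {f : X ≃ Y} (h : ReversesCr f) (a b : X) :
    f '' arc a b = arc (f b) (f a) := by
  rw [f.image_eq_preimage_symm]
  ext z
  simp only [Set.mem_preimage, mem_arc]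
  rw [h, f.apply_symm_apply]

theorem Monocircular.image_arc {f : X ≃ Y} (h : Monocircular f) (a b : X) :
    ∃ c d, (a ≠ b → c ≠ d) ∧ f '' arc a b = arc c d := by
  rcases h with h | h
  · exact ⟨_, _, f.injective.ne, h.image_arc a b⟩
  · exact ⟨_, _, fun h => f.injective.ne h.symm, h.image_arc a b⟩

variable [TopologicalSpace X] [TopologicalSpace Y] [CircTop X] [CircTop Y]

theorem exists_cr (X : Type*) [LinearOrder X] [TopologicalSpace X] [CircTop X] :
    ∃ a b c : X, Cr a b c := by
  obtain ⟨a, b, h⟩ := exists_pair_ne X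
  obtain ⟨z, hz⟩ := dense h
  exact ⟨a, z, b, hz⟩

omit [TopologicalSpace Y] [CircTop Y] in
theorem preservesEo_iff {f : X → Y} : PreservesEo f ↔ Monocircular f :=
  ⟨fun h => h.monocircular (exists_cr X), fun h => h.preservesEo⟩

theorem Monocircular.continuous_symm {f : X ≃ Y} (h : Monocircular f) : Continuous f.symm := by
  rw [continuous_def]
  intro U hU
  rw [← f.image_eq_preimage_symm, isOpen_iff_forall_mem_open]
  rintro _ ⟨x, hx, rfl⟩
  obtain ⟨a, b, hab, hs⟩ := exists_arc_subset hU hx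
  obtain ⟨c, d, -, hcd⟩ := h.image_arc a b
  refine ⟨f '' arc a b, Set.image_mono hs, ?_, ⟨x, hab, rfl⟩⟩
  rw [hcd]
  exact isOpen_arc _ _

theorem Monocircular.continuous {f : X ≃ Y} (h : Monocircular f) : Continuous f :=
  h.symm.continuous_symm

/-- A monocircular bijection as a homeomorphism. -/
def Monocircular.homeo {f : X ≃ Y} (h : Monocircular f) : X ≃ₜ Y :=
  ⟨f, h.continuous, h.continuous_symm⟩

theorem Monocircular.eq_of_dense {S : Type*} {i : S → X} (hi : DenseRange i) {f g : X ≃ Y}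
    (hf : Monocircular f) (hg : Monocircular g) (h : ∀ s, f (i s) = g (i s)) : f = g := by
  have := hi.equalizer hf.continuous hg.continuous (funext h)
  exact Equiv.ext (congrFun this)

/-- The points `z`, `w` are separated by the points `x`, `y`. -/
def CrSep (x y z w : X) : Prop := (Cr x z y ∧ Cr y w x) ∨ (Cr x w y ∧ Cr y z x)

omit [TopologicalSpace X] [CircTop X] in
theorem cr_iff_not_crSep {a b c d : X} (h : Cr a b c) (ha : d ≠ a) (hb : d ≠ b) :
    Cr a b d ↔ ¬ CrSep a b c d := by
  unfold CrSep; grind [Cr]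

omit [TopologicalSpace X] [CircTop X] in
theorem cr_iff_not_crSep' {a b c d : X} (h : Cr c b a) (ha : d ≠ a) (hb : d ≠ b) :
    Cr d b a ↔ ¬ CrSep a b c d := by
  unfold CrSep; grind [Cr]

/-- Two points not separated by `x` and `y` lie in a common arc between these. The image of that arc
is connected and avoids `f x` and `f y`, so it cannot meet both arcs that they bound. -/
theorem crSep_of_continuous {f : X ≃ Y} (hf : Continuous f) {x y z w : X}
    (h : ¬ CrSep x y z w) (hz : z ≠ x ∧ z ≠ y) (hw : w ≠ x ∧ w ≠ y) (hxy : x ≠ y) :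
    ¬ CrSep (f x) (f y) (f z) (f w) := by
  have key : ∀ a b : X, a ≠ b → Cr a z b → Cr a w b → ¬ CrSep (f a) (f b) (f z) (f w) := by
    intro a b hab h₁ h₂ h₃
    have hpre := (preconnected a b).image f hf.continuousOn
    obtain ⟨_, ⟨u, -, rfl⟩, ht₁, ht₂⟩ := hpre (arc (f a) (f b)) (arc (f b) (f a)) (isOpen_arc _ _)
      (isOpen_arc _ _) (by
        rintro _ ⟨u, hu, rfl⟩
        have h₄ : f u ≠ f a := f.injective.ne hu.ne₁₂.symm
        have h₅ : f u ≠ f b := f.injective.ne hu.ne₂₃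
        simp only [Set.mem_union, mem_arc]
        have := f.injective.ne hab
        grind [Cr])
      (by rcases h₃ with h₃ | h₃
          · exact ⟨f z, ⟨z, h₁, rfl⟩, h₃.1⟩
          · exact ⟨f w, ⟨w, h₂, rfl⟩, h₃.1⟩)
      (by rcases h₃ with h₃ | h₃
          · exact ⟨f w, ⟨w, h₂, rfl⟩, h₃.2⟩
          · exact ⟨f z, ⟨z, h₁, rfl⟩, h₃.2⟩)
    simp only [mem_arc] at ht₁ ht₂
    grind [Cr]
  have h' : (Cr x z y ∧ Cr x w y) ∨ (Cr y z x ∧ Cr y w x) := by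
    unfold CrSep at h
    grind [Cr]
  rcases h' with h' | h'
  · exact key x y hxy h'.1 h'.2
  · intro h₃
    refine key y x hxy.symm h'.1 h'.2 ?_
    unfold CrSep at *
    tauto

theorem crSep_iff_of_homeo {f : X ≃ Y} (hf : Continuous f) (hf' : Continuous f.symm)
    {x y z w : X} (hz : z ≠ x ∧ z ≠ y) (hw : w ≠ x ∧ w ≠ y) (hxy : x ≠ y) :
    CrSep x y z w ↔ CrSep (f x) (f y) (f z) (f w) := by
  constructor
  · intro h
    by_contra h'
    have := crSep_of_continuous hf' h' ⟨f.injective.ne hz.1, f.injective.ne hz.2⟩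
      ⟨f.injective.ne hw.1, f.injective.ne hw.2⟩ (f.injective.ne hxy)
    simp only [f.symm_apply_apply] at this
    exact this h
  · intro h
    by_contra h'
    exact crSep_of_continuous hf h' hz hw hxy h

/-- `f` preserves the orientation of the triple `a, b, c`. -/
def CrAgree (f : X → Y) (a b c : X) : Prop :=
  (Cr a b c ∧ Cr (f a) (f b) (f c)) ∨ (Cr c b a ∧ Cr (f c) (f b) (f a))

omit [TopologicalSpace X] [TopologicalSpace Y] [CircTop X] [CircTop Y] in
theorem CrAgree.rotate {f : X → Y} {a b c : X} (h : CrAgree f a b c) : CrAgree f b c a := by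
  unfold CrAgree at *; grind [Cr]

omit [TopologicalSpace X] [TopologicalSpace Y] [CircTop X] [CircTop Y] in
theorem CrAgree.swap {f : X → Y} {a b c : X} (h : CrAgree f a b c) : CrAgree f b a c := by
  unfold CrAgree at *; grind [Cr]

/-- With two points of a triple kept, a new third point reverses the orientation exactly when they
separate it from the old one. A homeomorphism preserves separation. -/
theorem CrAgree.replace {f : X ≃ Y} (hf : Continuous f) (hf' : Continuous f.symm)
    {a b c : X} (h : CrAgree f a b c) {d : X} (ha : d ≠ a) (hb : d ≠ b) : CrAgree f a b d := by
  by_cases hdc : d = c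
  · subst hdc; exact h
  have hab : a ≠ b := by unfold CrAgree at h; grind [Cr]
  have hc : c ≠ a ∧ c ≠ b := by unfold CrAgree at h; grind [Cr]
  have h₁ := crSep_iff_of_homeo hf hf' hc ⟨ha, hb⟩ hab
  have h₂ := f.injective.ne ha
  have h₃ := f.injective.ne hb
  have h₄ := f.injective.ne hab
  rcases h with h | h
  · have h₅ := cr_iff_not_crSep h.1 ha hb
    have h₆ := cr_iff_not_crSep h.2 h₂ h₃
    by_cases h₇ : Cr a b d
    · exact Or.inl ⟨h₇, h₆.2 fun h => h₅.1 h₇ (h₁.2 h)⟩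
    · exact Or.inr ⟨(cr_or_rev hab hb.symm ha.symm).resolve_left h₇,
        (cr_or_rev h₄ h₃.symm h₂.symm).resolve_left (by tauto)⟩
  · have h₅ := cr_iff_not_crSep' h.1 ha hb
    have h₆ := cr_iff_not_crSep' h.2 h₂ h₃
    by_cases h₇ : Cr d b a
    · exact Or.inr ⟨h₇, h₆.2 fun h => h₅.1 h₇ (h₁.2 h)⟩
    · exact Or.inl ⟨(cr_or_rev hab hb.symm ha.symm).resolve_right h₇,
        (cr_or_rev h₄ h₃.symm h₂.symm).resolve_right (by tauto)⟩

/-- Any triple of distinct points is reached from any other by exchanging one point at a time,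
together with permutations of the triple. -/
theorem CrAgree.all {f : X ≃ Y} (hf : Continuous f) (hf' : Continuous f.symm)
    {p q r : X} (h : CrAgree f p q r) {x y z : X} (hxy : x ≠ y) (hyz : y ≠ z) (hxz : x ≠ z) :
    CrAgree f x y z := by
  have key : ∀ {c}, CrAgree f x y c → CrAgree f x y z :=
    fun hc => hc.replace hf hf' hxz.symm hyz.symm
  have key₂ : ∀ {b c}, CrAgree f x b c → CrAgree f x y z := fun {b c} hc => by
    by_cases hb : y = b
    · subst hb; exact key hc
    · exact key (hc.replace hf hf' hxy.symm hb).rotate.rotate.swap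
  by_cases h₁ : x = p
  · subst h₁; exact key₂ h
  by_cases h₂ : x = q
  · subst h₂; exact key₂ h.swap
  exact key₂ (h.replace hf hf' h₁ h₂).rotate.rotate

theorem preservesCr_of_agree {f : X ≃ Y} (hf : Continuous f) (hf' : Continuous f.symm)
    {p q r : X} (h : Cr p q r) (h' : Cr (f p) (f q) (f r)) : PreservesCr f := by
  intro x y z
  have h₀ : CrAgree f p q r := Or.inl ⟨h, h'⟩
  constructor
  · intro hx
    rcases h₀.all hf hf' hx.ne₁₂ hx.ne₂₃ hx.ne₁₃ with h | h
    · exact h.2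
    · exact absurd hx h.1.not_rev
  · intro hx
    have := h₀.all hf hf' (x := x) (y := y) (z := z) (fun e => hx.ne₁₂ (congrArg f e))
      (fun e => hx.ne₂₃ (congrArg f e)) (fun e => hx.ne₁₃ (congrArg f e))
    rcases this with h | h
    · exact h.1
    · exact absurd hx h.2.not_rev

theorem monocircular_of_homeo {f : X ≃ Y} (hf : Continuous f) (hf' : Continuous f.symm) :
    Monocircular f := by
  obtain ⟨p, q, r, h⟩ := exists_cr X
  rcases cr_or_rev (f.injective.ne h.ne₁₂) (f.injective.ne h.ne₂₃) (f.injective.ne h.ne₁₃) with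
    h' | h'
  · exact Or.inl (preservesCr_of_agree hf hf' h h')
  · refine Or.inr fun x y z => ?_
    have := preservesCr_of_agree (f := f.trans OrderDual.toDual)
      (continuous_toDual.comp hf) (hf'.comp continuous_ofDual) h
      ((cr_dual (a := f p) (b := f q) (c := f r)).2 h') x y z
    exact this.trans (cr_dual (a := f x) (b := f y) (c := f z))

theorem preservesEo_iff_homeo {f : X ≃ Y} :
    PreservesEo f ↔ Continuous f ∧ Continuous f.symm := by
  rw [preservesEo_iff]
  exact ⟨fun h => ⟨h.continuous, h.continuous_symm⟩, fun h => monocircular_of_homeo h.1 h.2⟩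

end Monocircular

/-! ### Extension from dense subsets of compact circles -/

section Extension
variable {X Y S : Type*} [LinearOrder X] [TopologicalSpace X] [CircTop X]
  [LinearOrder Y] [TopologicalSpace Y] [CircTop Y] {i : S → X} {j : S → Y}

theorem exists_mem_arc_of_dense (hi : DenseRange i) {a b : X} (h : a ≠ b) : ∃ s, Cr a (i s) b := by
  obtain ⟨z, hz⟩ := dense h
  exact hi.exists_mem_open (isOpen_arc a b) ⟨z, hz⟩

theorem exists_arc_ne_of_dense (hi : DenseRange i) {x y : X} (h : x ≠ y) :
    ∃ a b, Cr (i a) x (i b) ∧ ¬ Cr (i a) y (i b) := by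
  obtain ⟨a, ha⟩ := exists_mem_arc_of_dense hi h.symm
  obtain ⟨b, hb⟩ := exists_mem_arc_of_dense hi h
  exact ⟨a, b, by grind [Cr], by grind [Cr]⟩

/-- The points `x` and `y` determine corresponding cuts of `S`. -/
def SameCut (i : S → X) (j : S → Y) (x : X) (y : Y) : Prop :=
  ∀ a b, Cr (i a) x (i b) → Cr (j a) y (j b)

omit [TopologicalSpace X] [CircTop X] in
theorem SameCut.eq_of_left (hj : DenseRange j)
    (hij : ∀ a b c, Cr (i a) (i b) (i c) ↔ Cr (j a) (j b) (j c)) {s : S} {y : Y}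
    (h : SameCut i j (i s) y) : y = j s := by
  by_contra hne
  obtain ⟨a, b, h₁, h₂⟩ := exists_arc_ne_of_dense hj (Ne.symm hne)
  exact h₂ (h a b ((hij _ _ _).2 h₁))

omit [TopologicalSpace X] [CircTop X] in
-- If `x` failed to lie between `i a` and `i b`, it would be one of these points or lie in the
-- opposite arc. Then `y` would be `j a` or `j b`, or lie in the wrong arc.
theorem SameCut.symm (hj : DenseRange j)
    (hij : ∀ a b c, Cr (i a) (i b) (i c) ↔ Cr (j a) (j b) (j c)) {x : X} {y : Y}
    (h : SameCut i j x y) : SameCut j i y x := by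
  intro a b hab
  obtain ⟨c, hc⟩ := exists_mem_arc_of_dense hj hab.ne₁₃
  have hne := ((hij _ _ _).2 hc).ne₁₃
  by_contra hcon
  rcases (not_cr_iff hne).1 hcon with hx | hx | hx
  · subst hx
    exact hab.ne₁₂ (h.eq_of_left hj hij).symm
  · subst hx
    exact hab.ne₂₃ (h.eq_of_left hj hij)
  · have := h b a hx
    grind [Cr]

omit [TopologicalSpace X] [CircTop X] in
theorem SameCut.unique (hj : DenseRange j)
    (hij : ∀ a b c, Cr (i a) (i b) (i c) ↔ Cr (j a) (j b) (j c)) {x : X} {y y' : Y}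
    (h : SameCut i j x y) (h' : SameCut i j x y') : y = y' := by
  by_contra hne
  obtain ⟨a, b, h₁, h₂⟩ := exists_arc_ne_of_dense hj hne
  exact h₂ (h' a b (h.symm hj hij a b h₁))

theorem exists_refine (hi : DenseRange i) {x : X} {U : Set X} (hU : IsOpen U) (hx : x ∈ U) :
    ∃ e f u v, Cr (i e) x (i f) ∧ Cr u (i e) (i f) ∧ Cr u (i f) v ∧
      ∀ z, z = u ∨ z = v ∨ Cr u z v → z ∈ U := by
  obtain ⟨u, v, h, hs⟩ := exists_closed_arc_subset hU hx
  obtain ⟨e, he⟩ := exists_mem_arc_of_dense hi h.ne₁₂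
  obtain ⟨f, hf⟩ := exists_mem_arc_of_dense hi h.ne₂₃
  exact ⟨e, f, u, v, by grind [Cr], by grind [Cr], by grind [Cr], hs⟩

theorem exists_refine_arcs (hi : DenseRange i) {x : X} {a b c d : S} (h₁ : Cr (i a) x (i b))
    (h₂ : Cr (i c) x (i d)) :
    ∃ e f, Cr (i e) x (i f) ∧ Cr (i a) (i e) (i f) ∧ Cr (i a) (i f) (i b) ∧
      Cr (i c) (i e) (i f) ∧ Cr (i c) (i f) (i d) := by
  obtain ⟨e, f, u, v, h, h', h'', hs⟩ := exists_refine hi ((isOpen_arc _ _).inter (isOpen_arc _ _))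
    (show x ∈ arc (i a) (i b) ∩ arc (i c) (i d) from ⟨h₁, h₂⟩)
  have ha : ¬ (i a = u ∨ i a = v ∨ Cr u (i a) v) := fun h => by
    have := (hs _ h).1; simp only [mem_arc] at this; grind [Cr]
  have hc : ¬ (i c = u ∨ i c = v ∨ Cr u (i c) v) := fun h => by
    have := (hs _ h).2; simp only [mem_arc] at this; grind [Cr]
  have hf := hs (i f) (Or.inr (Or.inr h''))
  simp only [Set.mem_inter_iff, mem_arc] at hf
  refine ⟨e, f, h, ?_, hf.1, ?_, hf.2⟩
  · clear hs hf hc h₁ h₂; grind [Cr]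
  · clear hs hf ha h₁ h₂; grind [Cr]

/-- The closed arcs from `j a` to `j b`, taken over all `a`, `b` whose images in `X` enclose `x`,
are nonempty, compact and directed under reverse inclusion, so they have a common point. -/
theorem exists_sameCut (hi : DenseRange i)
    (hij : ∀ a b c, Cr (i a) (i b) (i c) ↔ Cr (j a) (j b) (j c)) (x : X) :
    ∃ y, SameCut i j x y := by
  let P := {p : S × S // Cr (i p.1) x (i p.2)}
  let C : P → Set Y := fun p => {z | z = j p.1.1 ∨ z = j p.1.2 ∨ Cr (j p.1.1) z (j p.1.2)}
  have hne : ∀ p : P, j p.1.1 ≠ j p.1.2 := fun p => by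
    obtain ⟨c, hc⟩ := exists_mem_arc_of_dense hi p.2.ne₁₃
    exact ((hij _ _ _).1 hc).ne₁₃
  have hcl : ∀ p, IsClosed (C p) := fun p => isClosed_closed_arc (hne p)
  have : Nonempty P := by
    obtain ⟨e, f, _, _, h, -⟩ := exists_refine hi isOpen_univ (Set.mem_univ x)
    exact ⟨⟨(e, f), h⟩⟩
  have hdir : Directed (fun s t => s ⊇ t) C := by
    intro p q
    obtain ⟨e, f, h, h₁, h₂, h₃, h₄⟩ := exists_refine_arcs hi p.2 q.2
    rw [hij] at h₁ h₂ h₃ h₄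
    refine ⟨⟨(e, f), h⟩, fun z hz => ?_, fun z hz => ?_⟩
    · simp only [C, Set.mem_ofPred_eq] at hz ⊢
      clear h₃ h₄; grind [Cr]
    · simp only [C, Set.mem_ofPred_eq] at hz ⊢
      clear h₁ h₂; grind [Cr]
  obtain ⟨y, hy⟩ := IsCompact.nonempty_iInter_of_directed_nonempty_isCompact_isClosed C hdir
    (fun p => ⟨j p.1.1, Or.inl rfl⟩) (fun p => (hcl p).isCompact) hcl
  rw [Set.mem_iInter] at hy
  refine ⟨y, fun a b hab => ?_⟩
  -- The common point lies in the closed arc of a strictly smaller enclosing pair, hence in the open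
  -- arc of the given pair.
  obtain ⟨e, f, h, h₁, h₂, -⟩ := exists_refine_arcs hi hab hab
  rw [hij] at h₁ h₂
  have := hy ⟨(e, f), h⟩
  simp only [C, Set.mem_ofPred_eq] at this
  grind [Cr]

/-- A circularly ordered set which is dense in two compact circles determines an isomorphism
between them. -/
theorem exists_extension (hi : DenseRange i) (hj : DenseRange j)
    (hij : ∀ a b c, Cr (i a) (i b) (i c) ↔ Cr (j a) (j b) (j c)) :
    ∃ τ : X ≃ Y, PreservesCr τ ∧ ∀ s, τ (i s) = j s := by
  have hji : ∀ a b c, Cr (j a) (j b) (j c) ↔ Cr (i a) (i b) (i c) := fun a b c => (hij a b c).symm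
  -- Corresponding cuts form a symmetric relation with unique partners, so the two choice functions
  -- are mutually inverse.
  choose F hF using exists_sameCut hi hij
  choose G hG using exists_sameCut hj hji
  let τ : X ≃ Y := ⟨F, G,
    fun x => (hG (F x)).unique hi hji ((hF x).symm hj hij),
    fun y => (hF (G y)).unique hj hij ((hG y).symm hi hji)⟩
  have key : ∀ x y z, Cr x y z → Cr (F x) (F y) (F z) := by
    intro x y z h
    obtain ⟨a, ha⟩ := exists_mem_arc_of_dense hi h.ne₁₂
    obtain ⟨b, hb⟩ := exists_mem_arc_of_dense hi h.ne₂₃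
    obtain ⟨c, hc⟩ := exists_mem_arc_of_dense hi h.ne₁₃.symm
    have h₁ := hF x c a (by grind [Cr])
    have h₂ := hF y a b (by grind [Cr])
    have h₃ := hF z b c (by grind [Cr])
    have h₄ := (hij a b c).1 (by grind [Cr])
    grind [Cr]
  refine ⟨τ, fun x y z => ⟨key x y z, fun h => ?_⟩, fun s => ?_⟩
  · by_contra hcon
    have h₁ : x ≠ y := fun e => h.ne₁₂ (congrArg τ e)
    have h₂ : y ≠ z := fun e => h.ne₂₃ (congrArg τ e)
    have h₃ : x ≠ z := fun e => h.ne₁₃ (congrArg τ e)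
    exact h.not_rev (key z y x ((cr_or_rev h₁ h₂ h₃).resolve_left hcon))
  · exact (hF (i s)).eq_of_left hj hij

theorem exists_extension_rev (hi : DenseRange i) (hj : DenseRange j)
    (hij : ∀ a b c, Cr (i a) (i b) (i c) ↔ Cr (j c) (j b) (j a)) :
    ∃ τ : X ≃ Y, ReversesCr τ ∧ ∀ s, τ (i s) = j s := by
  obtain ⟨τ, h, h'⟩ := exists_extension (Y := Yᵒᵈ) (j := fun s => OrderDual.toDual (j s)) hi hj
    (fun a b c => (hij a b c).trans cr_dual.symm)
  exact ⟨τ.trans OrderDual.ofDual, fun x y z => (h x y z).trans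
    (cr_dual (a := OrderDual.ofDual (τ x)) (b := OrderDual.ofDual (τ y))
      (c := OrderDual.ofDual (τ z))), h'⟩

end Extension

/-! ### Compact circles from conditionally complete chains -/

section Construction

/-- Circular density. -/
theorem exists_arc_subset_of_generateFrom {Y : Type*} [LinearOrder Y] [Nontrivial Y]
    (hd : ∀ a b : Y, a ≠ b → ∃ z, Cr a z b) {x : Y} {U : Set Y}
    (hU : TopologicalSpace.GenerateOpen {I : Set Y | IsCInterval I} U) (hx : x ∈ U) :
    ∃ a b, Cr a x b ∧ arc a b ⊆ U := by
  have hne : ∀ y, y ≠ x → ∃ a b, Cr a x b ∧ ¬ Cr a y b := fun y hy => by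
    obtain ⟨a, ha⟩ := hd y x hy
    obtain ⟨b, hb⟩ := hd x y hy.symm
    exact ⟨a, b, by grind [Cr], by grind [Cr]⟩
  induction hU with
  | basic I hI =>
    rcases hI with ⟨a, b, -, rfl⟩ | rfl | ⟨y, rfl⟩
    · exact ⟨a, b, hx, subset_rfl⟩
    · obtain ⟨y, hy⟩ := exists_ne x
      obtain ⟨a, b, h, -⟩ := hne y hy
      exact ⟨a, b, h, Set.subset_univ _⟩
    · obtain ⟨a, b, h, h'⟩ := hne y (Ne.symm hx)
      exact ⟨a, b, h, fun z hz e => h' (e ▸ hz)⟩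
  | univ =>
    obtain ⟨y, hy⟩ := exists_ne x
    obtain ⟨a, b, h, -⟩ := hne y hy
    exact ⟨a, b, h, Set.subset_univ _⟩
  | inter U V _ _ ihU ihV =>
    obtain ⟨a, b, h, hs⟩ := ihU hx.1
    obtain ⟨c, d, h', hs'⟩ := ihV hx.2
    obtain ⟨e, he⟩ : ∃ e, (e = a ∨ Cr a e x) ∧ (e = c ∨ Cr c e x) := by
      by_cases h₁ : Cr a c x
      · exact ⟨c, Or.inr h₁, Or.inl rfl⟩
      · exact ⟨a, Or.inl rfl, by grind [Cr]⟩
    obtain ⟨f, hf⟩ : ∃ f, (f = b ∨ Cr x f b) ∧ (f = d ∨ Cr x f d) := by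
      by_cases h₁ : Cr x d b
      · exact ⟨d, Or.inr h₁, Or.inl rfl⟩
      · exact ⟨b, Or.inl rfl, by grind [Cr]⟩
    by_cases hef : Cr e x f
    · refine ⟨e, f, hef, fun z hz => ⟨hs ?_, hs' ?_⟩⟩
      · simp only [mem_arc] at hz ⊢
        clear hs hs' h'
        grind [Cr]
      · simp only [mem_arc] at hz ⊢
        clear hs hs' h
        grind [Cr]
    · have hxe : x ≠ e := by grind [Cr]
      obtain ⟨f', hf'⟩ := hd x e hxe
      refine ⟨e, f', by grind [Cr], fun z hz => ⟨hs ?_, hs' ?_⟩⟩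
      · simp only [mem_arc] at hz ⊢
        clear hs hs' h'
        grind [Cr]
      · simp only [mem_arc] at hz ⊢
        clear hs hs' h
        grind [Cr]
  | sUnion S _ ih =>
    obtain ⟨V, hV, hxV⟩ := hx
    obtain ⟨a, b, h, hs⟩ := ih V hV hxV
    exact ⟨a, b, h, hs.trans (Set.subset_sUnion_of_mem hV)⟩

/-- A conditionally complete dense chain with exactly one endpoint yields a compact circle. -/
theorem circTop_of_isBot {X Y : Type*} [ConditionallyCompleteLinearOrder X] [TopologicalSpace X]
    [OrderTopology X] [DenselyOrdered X] [NoMaxOrder X] {e : X} (he : IsBot e)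
    [LinearOrder Y] [T : TopologicalSpace Y]
    (hT : T = TopologicalSpace.generateFrom {I | IsCInterval I}) (f : X ≃o Y) : CircTop Y := by
  have hf : ∀ {a b c : X}, Cr (f a) (f b) (f c) ↔ Cr a b c := by
    intro a b c; simp only [Cr, f.lt_iff_lt]
  have hpre : ∀ a b, f ⁻¹' arc (f a) (f b) = arc a b := fun a b => Set.ext fun z => hf
  have : Nontrivial Y := by
    obtain ⟨x, hx⟩ := exists_gt e
    exact ⟨f e, f x, f.injective.ne hx.ne⟩
  have hd : ∀ a b : Y, a ≠ b → ∃ z, Cr a z b := by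
    intro a b hab
    obtain ⟨a, rfl⟩ := f.surjective a
    obtain ⟨b, rfl⟩ := f.surjective b
    rcases lt_or_gt_of_ne hab with h | h
    · obtain ⟨z, h₁, h₂⟩ := exists_between (f.lt_iff_lt.1 h)
      exact ⟨f z, hf.2 (Or.inl ⟨h₁, h₂⟩)⟩
    · obtain ⟨z, hz⟩ := exists_gt a
      exact ⟨f z, hf.2 (Or.inr (Or.inr ⟨f.lt_iff_lt.1 h, hz⟩))⟩
  have hopen : ∀ a b : Y, IsOpen (arc a b) := by
    intro a b
    by_cases hab : a = b
    · convert isOpen_empty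
      ext z; simp only [mem_arc, Set.mem_empty_iff_false, iff_false]
      subst hab; grind [Cr]
    · rw [hT]
      exact TopologicalSpace.isOpen_generateFrom_of_mem (Or.inl ⟨a, b, hab, rfl⟩)
  have hsub : ∀ {x : Y} {U : Set Y}, IsOpen U → x ∈ U → ∃ a b, Cr a x b ∧ arc a b ⊆ U := by
    intro x U hU hx
    rw [hT] at hU
    exact exists_arc_subset_of_generateFrom hd hU hx
  have harc : ∀ a b : X, b < a → arc a b = Set.Ioi a ∪ Set.Iio b := fun a b h => by
    ext z; simp only [mem_arc, Cr, Set.mem_union, Set.mem_Ioi, Set.mem_Iio]; grind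
  have harc' : ∀ a b : X, a < b → arc a b = Set.Ioo a b := fun a b h => by
    ext z; simp only [mem_arc, Cr, Set.mem_Ioo]; grind
  have hcont : Continuous f := by
    rw [continuous_def]
    intro U hU
    rw [isOpen_iff_forall_mem_open]
    intro x hx
    obtain ⟨a, b, h, hs⟩ := hsub hU hx
    obtain ⟨a, rfl⟩ := f.surjective a
    obtain ⟨b, rfl⟩ := f.surjective b
    refine ⟨arc a b, ?_, ?_, hf.1 h⟩
    · rw [← hpre]; exact Set.preimage_mono hs
    · rcases lt_or_gt_of_ne h.ne₁₃ with h' | h'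
      · rw [harc' a b (f.lt_iff_lt.1 h')]; exact isOpen_Ioo
      · rw [harc a b (f.lt_iff_lt.1 h')]; exact isOpen_Ioi.union isOpen_Iio
  have himg : ∀ a b, f '' arc a b = arc (f a) (f b) := fun a b => by
    rw [← hpre]; exact Set.image_preimage_eq _ f.surjective
  refine ⟨hopen, hsub, fun {_ _} => hd _ _, ?_, ?_, this⟩
  · intro a b
    obtain ⟨a, rfl⟩ := f.surjective a
    obtain ⟨b, rfl⟩ := f.surjective b
    rcases lt_trichotomy a b with h | rfl | h
    · rw [← himg, harc' a b h]
      exact isPreconnected_Ioo.image f hcont.continuousOn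
    · convert isPreconnected_empty
      ext z; simp only [mem_arc, Set.mem_empty_iff_false, iff_false]
      grind [Cr]
    · rw [← himg, harc a b h, Set.image_union]
      have h₁ := (isPreconnected_Ioi (a := a)).image f hcont.continuousOn
      rcases eq_or_lt_of_le (he b) with rfl | hb
      · have : Set.Iio e = ∅ := Set.eq_empty_iff_forall_notMem.2 fun x hx => (he x).not_gt hx
        rw [this, Set.image_empty, Set.union_empty]
        exact h₁
      · have h₂ := (isPreconnected_Iio (a := b)).image f hcont.continuousOn
        -- The circle wraps around: every neighbourhood of the bottom point contains arbitrarily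
        -- large elements of the chain. This joins the two rays that make up an arc through the
        -- bottom point.
        have hcl : f e ∈ closure (f '' Set.Ioi a) := by
          rw [mem_closure_iff]
          intro U hU heU
          obtain ⟨c, d, hcd, hs⟩ := hsub hU heU
          obtain ⟨c, rfl⟩ := f.surjective c
          obtain ⟨d, rfl⟩ := f.surjective d
          obtain ⟨z, hz⟩ := exists_gt (max a c)
          refine ⟨f z, hs ?_, z, (le_max_left _ _).trans_lt hz, rfl⟩
          have := (le_max_right a c).trans_lt hz
          rw [mem_arc, hf]
          have h₅ := hf.1 hcd
          have := he c
          have := he d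
          clear hf hs hcd hd hopen hsub
          simp only [Cr] at *
          grind
        have h₃ := h₁.subset_closure (Set.subset_insert (f e) _)
          (Set.insert_subset hcl subset_closure)
        have hmem : f e ∈ f '' Set.Iio b := ⟨e, hb, rfl⟩
        have h₄ := h₃.union (f e) (Set.mem_insert _ _) hmem h₂
        rwa [Set.insert_union, Set.insert_eq_of_mem (Set.mem_union_right _ hmem)] at h₄
  · constructor
    refine isCompact_of_finite_subcover fun {ι} U hU hcov => ?_
    obtain ⟨i, hi⟩ := Set.mem_iUnion.1 (hcov (Set.mem_univ (f e)))
    -- One member of the cover contains an arc around the bottom point. What is left lies in a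
    -- closed bounded interval of the chain, which is compact.
    obtain ⟨c, d, hcd, hs⟩ := hsub (hU i) hi
    obtain ⟨c, rfl⟩ := f.surjective c
    obtain ⟨d, rfl⟩ := f.surjective d
    have hc : IsCompact (f '' Set.Icc d c) := isCompact_Icc.image hcont
    obtain ⟨t, ht⟩ := hc.elim_finite_subcover U hU ((Set.subset_univ _).trans hcov)
    classical
    refine ⟨insert i t, fun y _ => ?_⟩
    obtain ⟨x, rfl⟩ := f.surjective y
    rw [Set.mem_iUnion₂]
    by_cases hx : x ∈ Set.Icc d c
    · obtain ⟨j, hj, hjx⟩ := Set.mem_iUnion₂.1 (ht ⟨x, hx, rfl⟩)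
      exact ⟨j, Finset.mem_insert_of_mem hj, hjx⟩
    · refine ⟨i, Finset.mem_insert_self _ _, hs ?_⟩
      rw [mem_arc, hf]
      have h₅ := hf.1 hcd
      simp only [Set.mem_Icc] at hx
      have := he c
      have := he d
      clear hf hs hcd hd hopen hsub
      simp only [Cr] at *
      grind

end Construction

/-! ### The completed circle and the extension of automorphisms -/

section CBar
variable {L : Type u} [LinearOrder L] [CircleBase L]

instance : DenselyOrdered L := CircleBase.dense

instance : Nontrivial L := CircleBase.nontrivial

theorem exists_principal_between {a b : DedekindCut L} (h : a < b) :
    ∃ u, a < DedekindCut.principal u ∧ DedekindCut.principal u < b := by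
  obtain ⟨c, hac, hcb⟩ := DedekindCut.lt_iff_exists.mp h
  obtain ⟨d, had, hdc⟩ := DedekindCut.lt_iff_exists'.mp hac
  simp only [DedekindCut.principal_lt_principal] at hdc
  obtain ⟨u, h₁, h₂⟩ := exists_between hdc
  exact ⟨u, had.trans_lt (by simpa using h₁), hcb.trans_lt' (by simpa using h₂)⟩

theorem isCInterval_dual {Y : Type*} [LinearOrder Y] (I : Set Y) :
    IsCInterval (OrderDual.ofDual ⁻¹' I) ↔ IsCInterval I := by
  have : ∀ a b : Y, {z : Yᵒᵈ | Cr (OrderDual.toDual a) z (OrderDual.toDual b)} =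
      OrderDual.ofDual ⁻¹' {z | Cr b z a} := fun a b => arc_dual a b
  constructor
  · rintro (⟨a, b, hab, h⟩ | h | ⟨x, h⟩)
    · exact Or.inl ⟨OrderDual.ofDual b, OrderDual.ofDual a, fun e => hab e.symm,
        h.trans (this (OrderDual.ofDual a) (OrderDual.ofDual b))⟩
    · exact Or.inr (Or.inl h)
    · exact Or.inr (Or.inr ⟨x, h⟩)
  · rintro (⟨a, b, hab, rfl⟩ | h | ⟨x, h⟩)
    · exact Or.inl ⟨OrderDual.toDual b, OrderDual.toDual a, fun e => hab e.symm, (this b a).symm⟩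
    · exact Or.inr (Or.inl h)
    · exact Or.inr (Or.inr ⟨x, h⟩)

theorem CircTop.of_dual {Y : Type*} [LinearOrder Y] [TopologicalSpace Y] (h : CircTop Yᵒᵈ) :
    CircTop Y :=
  inferInstanceAs (CircTop Yᵒᵈᵒᵈ)

/-- After removal of the discarded end, the cuts form a conditionally complete dense chain with
exactly one endpoint: the bottom if the top was discarded, the top otherwise. The second case is the
first one for the dual order. -/
instance : CircTop (CBar L) := by
  by_cases h : NoMaxOrder L
  · have hs : ∀ x : DedekindCut L, x ≠ discardedEnd L ↔ x < ⊤ := fun x => by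
      rw [discardedEnd, if_pos h, lt_top_iff_ne_top]
    let s : Set (DedekindCut L) := Set.Iio ⊤
    obtain ⟨x₀⟩ : Nonempty L := inferInstance
    have hx₀ := (hs _).1 (principal_ne_discardedEnd x₀)
    have hbot : (⊥ : DedekindCut L) < ⊤ := bot_le.trans_lt hx₀
    let _ : Inhabited s := ⟨⟨⊥, hbot⟩⟩
    let _ : TopologicalSpace s := Preorder.topology s
    have : OrderTopology s := ⟨rfl⟩
    have : NoMaxOrder s := ⟨fun a => by
      obtain ⟨z, h₁, h₂⟩ := exists_between (show a.1 < ⊤ from a.2)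
      exact ⟨⟨z, h₂⟩, h₁⟩⟩
    let f : s ≃o CBar L :=
      ⟨⟨fun x => ⟨x.1, (hs _).2 x.2⟩, fun x => ⟨x.1, (hs _).1 x.2⟩, fun _ => rfl, fun _ => rfl⟩,
        Iff.rfl⟩
    exact circTop_of_isBot (X := s) (e := ⟨⊥, hbot⟩) (fun x => bot_le (a := x.1)) rfl f
  · have h' : NoMinOrder L := (CircleBase.atMostOneEndpoint (L := L)).resolve_right h
    have hs : ∀ x : DedekindCut L, x ≠ discardedEnd L ↔ ⊥ < x := fun x => by
      rw [discardedEnd, if_neg h, bot_lt_iff_ne_bot]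
    let s : Set (DedekindCut L)ᵒᵈ := Set.Iio (OrderDual.toDual ⊥)
    obtain ⟨x₀⟩ : Nonempty L := inferInstance
    have hx₀ := (hs _).1 (principal_ne_discardedEnd x₀)
    have hbot : (⊥ : DedekindCut L) < ⊤ := hx₀.trans_le le_top
    let _ : Inhabited s := ⟨⟨OrderDual.toDual ⊤, hbot⟩⟩
    let _ : TopologicalSpace s := Preorder.topology s
    have : OrderTopology s := ⟨rfl⟩
    have : NoMaxOrder s := ⟨fun a => by
      obtain ⟨z, h₁, h₂⟩ := exists_between (show a.1 < OrderDual.toDual ⊥ from a.2)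
      exact ⟨⟨z, h₂⟩, h₁⟩⟩
    let f : s ≃o (CBar L)ᵒᵈ :=
      ⟨⟨fun x => OrderDual.toDual ⟨OrderDual.ofDual x.1, (hs _).2 x.2⟩,
        fun x => ⟨OrderDual.toDual (OrderDual.ofDual x).1, (hs _).1 (OrderDual.ofDual x).2⟩,
        fun _ => rfl, fun _ => rfl⟩, Iff.rfl⟩
    refine CircTop.of_dual (circTop_of_isBot (X := s) (e := ⟨OrderDual.toDual ⊤, hbot⟩)
      (fun x => le_top (a := OrderDual.ofDual x.1)) ?_ f)
    exact congrArg TopologicalSpace.generateFrom (Set.ext fun I => (isCInterval_dual I).symm)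

theorem emb_lt_emb {a b : L} : emb a < emb b ↔ a < b :=
  DedekindCut.principal_lt_principal

theorem emb_injective : Function.Injective (emb : L → CBar L) := fun _ _ h =>
  DedekindCut.principal_inj.1 (congrArg Subtype.val h)

theorem cr_emb {a b c : L} : Cr (emb a) (emb b) (emb c) ↔ Cr a b c := by
  simp only [Cr, emb_lt_emb]

theorem denseRange_emb : DenseRange (emb : L → CBar L) := by
  rw [DenseRange, dense_iff_inter_open]
  rintro U hU ⟨x, hx⟩
  obtain ⟨a, b, hab, hs⟩ := exists_arc_subset hU hx
  suffices ∃ l : L, Cr a (emb l) b by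
    obtain ⟨l, hl⟩ := this
    exact ⟨emb l, hs hl, l, rfl⟩
  have key : ∀ a b : CBar L, a < b → ∃ l : L, a < emb l ∧ emb l < b := fun _ _ h =>
    exists_principal_between h
  rcases hab with h | h | h
  · obtain ⟨l, hl⟩ := key a x h.1
    exact ⟨l, Or.inl ⟨hl.1, hl.2.trans h.2⟩⟩
  · obtain ⟨l, hl⟩ := key x b h.1
    exact ⟨l, Or.inr (Or.inl ⟨hl.2, h.2⟩)⟩
  · obtain ⟨l, hl⟩ := key a x h.2
    exact ⟨l, Or.inr (Or.inr ⟨h.1, hl.1⟩)⟩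

theorem exists_cr_base : ∃ a b c : L, Cr a b c := by
  obtain ⟨a, b, h⟩ := exists_pair_lt L
  obtain ⟨z, h₁, h₂⟩ := exists_between h
  exact ⟨a, z, b, Or.inl ⟨h₁, h₂⟩⟩

theorem mem_autEO_iff {g : Equiv.Perm L} : g ∈ autEO L ↔ Monocircular g :=
  ⟨fun h => PreservesEo.monocircular exists_cr_base h, fun h => h.preservesEo⟩

theorem mem_autEO_cBar_iff {τ : Equiv.Perm (CBar L)} : τ ∈ autEO (CBar L) ↔ Monocircular τ :=
  preservesEo_iff

/-- Both `emb` and `emb ∘ g` have dense range, and they determine the same circular order on `L` up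
to reversal. -/
theorem exists_bar {g : Equiv.Perm L} (hg : g ∈ autEO L) :
    ∃ τ ∈ autEO (CBar L), ∀ x : L, τ (emb x) = emb (g x) := by
  have hd : DenseRange fun x => (emb (g x) : CBar L) := by
    rw [DenseRange, ← Function.comp_def, Set.range_comp, g.range_eq_univ, Set.image_univ]
    exact denseRange_emb
  rcases mem_autEO_iff.1 hg with h | h
  · obtain ⟨τ, h₁, h₂⟩ := exists_extension (i := (emb : L → CBar L)) denseRange_emb hd
      (fun a b c => by rw [cr_emb, cr_emb]; exact h a b c)
    exact ⟨τ, mem_autEO_cBar_iff.2 (Or.inl h₁), h₂⟩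
  · obtain ⟨τ, h₁, h₂⟩ := exists_extension_rev (i := (emb : L → CBar L)) denseRange_emb hd
      (fun a b c => by rw [cr_emb, cr_emb]; exact h a b c)
    exact ⟨τ, mem_autEO_cBar_iff.2 (Or.inr h₁), h₂⟩

theorem bar_emb {g : Equiv.Perm L} (hg : g ∈ autEO L) (x : L) : bar g (emb x) = emb (g x) := by
  rw [bar, dif_pos (exists_bar hg)]
  exact (exists_bar hg).choose_spec.2 x

theorem bar_mem {g : Equiv.Perm L} (hg : g ∈ autEO L) : bar g ∈ autEO (CBar L) := by
  rw [bar, dif_pos (exists_bar hg)]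
  exact (exists_bar hg).choose_spec.1

theorem bar_monocircular {g : Equiv.Perm L} (hg : g ∈ autEO L) : Monocircular (bar g) :=
  mem_autEO_cBar_iff.1 (bar_mem hg)

theorem mem_autEO_of_extension {g : Equiv.Perm L} {τ : Equiv.Perm (CBar L)} (hτ : Monocircular τ)
    (h : ∀ x, τ (emb x) = emb (g x)) : g ∈ autEO L := by
  rw [mem_autEO_iff]
  rcases hτ with hτ | hτ
  · exact Or.inl fun x y z => by rw [← cr_emb, hτ, h, h, h, cr_emb]
  · exact Or.inr fun x y z => by rw [← cr_emb, hτ, h, h, h, cr_emb]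

theorem bar_eq {g : Equiv.Perm L} {τ : Equiv.Perm (CBar L)} (hτ : Monocircular τ)
    (h : ∀ x, τ (emb x) = emb (g x)) : bar g = τ := by
  have hg := mem_autEO_of_extension hτ h
  exact (bar_monocircular hg).eq_of_dense denseRange_emb hτ fun x => (bar_emb hg x).trans (h x).symm

theorem bar_one : bar (1 : Equiv.Perm L) = 1 :=
  bar_eq (mem_autEO_cBar_iff.1 (one_mem _)) fun _ => rfl

theorem bar_mul {g h : Equiv.Perm L} (hg : g ∈ autEO L) (hh : h ∈ autEO L) :
    bar (g * h) = bar g * bar h :=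
  bar_eq (mem_autEO_cBar_iff.1 (mul_mem (bar_mem hg) (bar_mem hh))) fun x => by
    simp only [Equiv.Perm.coe_mul, Function.comp_apply, bar_emb hh, bar_emb hg]

theorem bar_injOn {g h : Equiv.Perm L} (hg : g ∈ autEO L) (hh : h ∈ autEO L)
    (e : bar g = bar h) : g = h := by
  ext x
  refine emb_injective ?_
  rw [← bar_emb hg, ← bar_emb hh, e]

/-- The action on the completed circle. -/
noncomputable def barHom {G : Subgroup (Equiv.Perm L)} (hG : G ≤ autEO L) :
    G →* Equiv.Perm (CBar L) where
  toFun g := bar g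
  map_one' := bar_one
  map_mul' g h := bar_mul (hG g.2) (hG h.2)

theorem barHom_injective {G : Subgroup (Equiv.Perm L)} (hG : G ≤ autEO L) :
    Function.Injective (barHom hG) := fun g h e =>
  Subtype.ext (bar_injOn (hG g.2) (hG h.2) e)

theorem bar_inv {g : Equiv.Perm L} (hg : g ∈ autEO L) : bar g⁻¹ = (bar g)⁻¹ :=
  map_inv (barHom (le_refl (autEO L))) ⟨g, hg⟩

theorem mem_autCR_iff {g : Equiv.Perm L} (hg : g ∈ autEO L) :
    g ∈ autCR L ↔ PreservesCr (bar g) := by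
  constructor
  · intro h
    rcases bar_monocircular hg with h' | h'
    · exact h'
    · obtain ⟨a, b, c, habc⟩ := exists_cr_base (L := L)
      have h₁ := (h a b c).1 habc
      have h₂ := (h' _ _ _).1 (cr_emb.2 habc)
      rw [bar_emb hg, bar_emb hg, bar_emb hg, cr_emb] at h₂
      exact absurd h₁ h₂.not_rev
  · intro h x y z
    rw [← cr_emb, h, bar_emb hg, bar_emb hg, bar_emb hg, cr_emb]

end CBar

/-! ### Supports of permutations of a circle -/

section Support
variable {X : Type*} [LinearOrder X] [TopologicalSpace X]

/-- The support of a permutation. -/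
def psupp (f : Equiv.Perm X) : Set X := {x | f x ≠ x}

/-- The interior of the closure of the support. -/
def pvar (f : Equiv.Perm X) : Set X := interior (closure (psupp f))

omit [LinearOrder X] [TopologicalSpace X] in
@[simp] theorem mem_psupp {f : Equiv.Perm X} {x : X} : x ∈ psupp f ↔ f x ≠ x := Iff.rfl

theorem psupp_one : psupp (1 : Equiv.Perm X) = ∅ := by ext; simp [psupp]

theorem psupp_inv (f : Equiv.Perm X) : psupp f⁻¹ = psupp f := by
  ext x
  simp only [mem_psupp, ne_eq, Equiv.Perm.inv_eq_iff_eq]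
  exact not_congr eq_comm

theorem psupp_mul_subset (f g : Equiv.Perm X) : psupp (f * g) ⊆ psupp f ∪ psupp g := by
  intro x hx
  by_contra h
  simp only [Set.mem_union, mem_psupp, not_or, not_not] at h
  exact hx (by rw [Equiv.Perm.mul_apply, h.2, h.1])

theorem psupp_conj (f g : Equiv.Perm X) : psupp (f * g * f⁻¹) = f '' psupp g := by
  rw [f.image_eq_preimage_symm]
  ext x
  simp only [mem_psupp, Set.mem_preimage, Equiv.Perm.mul_apply]
  exact not_congr (f.eq_symm_apply).symm

theorem apply_mem_psupp {f : Equiv.Perm X} {x : X} : f x ∈ psupp f ↔ x ∈ psupp f := by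
  simp only [mem_psupp, ne_eq, f.injective.eq_iff]

theorem isOpen_pvar (f : Equiv.Perm X) : IsOpen (pvar f) := isOpen_interior

variable [CircTop X]

theorem Monocircular.isOpen_psupp {f : Equiv.Perm X} (h : Monocircular f) : IsOpen (psupp f) :=
  isOpen_ne_fun h.continuous continuous_id

theorem Monocircular.psupp_subset_pvar {f : Equiv.Perm X} (h : Monocircular f) :
    psupp f ⊆ pvar f :=
  interior_maximal subset_closure h.isOpen_psupp

theorem Monocircular.pvar_image {Y : Type*} [LinearOrder Y] [TopologicalSpace Y] [CircTop Y]
    {τ : X ≃ Y} (hτ : Monocircular τ) (S : Set X) :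
    τ '' interior (closure S) = interior (closure (τ '' S)) := by
  have h₁ := hτ.homeo.image_interior (closure S)
  have h₂ := hτ.homeo.image_closure S
  exact h₁.trans (congrArg interior h₂)

theorem Monocircular.pvar_conj {f g : Equiv.Perm X} (h : Monocircular f) :
    pvar (f * g * f⁻¹) = f '' pvar g := by
  rw [pvar, psupp_conj, pvar, h.pvar_image]

theorem disjoint_pvar_iff {f : Equiv.Perm X} (h : Monocircular f) {U : Set X} (hU : IsOpen U) :
    Disjoint (pvar f) U ↔ Disjoint (psupp f) U := by
  constructor
  · exact fun h' => h'.mono_left h.psupp_subset_pvar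
  · intro h'
    exact (h'.closure_left hU).mono_left interior_subset

theorem preservesCr_of_fixed {f : Equiv.Perm X} (h : Monocircular f) {p q r : X} (hpqr : Cr p q r)
    (hp : f p = p) (hq : f q = q) (hr : f r = r) : PreservesCr f := by
  rcases h with h | h
  · exact h
  · have := (h p q r).1 hpqr
    rw [hp, hq, hr] at this
    exact absurd hpqr this.not_rev

theorem fixed_of_psupp_subset {f : Equiv.Perm X} {U : Set X} (h : psupp f ⊆ U) {x : X}
    (hx : x ∉ U) : f x = x := by
  by_contra hne
  exact hx (h hne)

/-- An element supported in a bounded arc fixes both ends of the arc and a further point outside it.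
A map that reverses orientation cannot fix three points. -/
theorem preservesCr_of_psupp_subset {f : Equiv.Perm X} (h : Monocircular f) {a b : X} (hab : a ≠ b)
    (hs : psupp f ⊆ arc a b) : PreservesCr f := by
  obtain ⟨c, hc⟩ := dense hab.symm
  refine preservesCr_of_fixed h hc ?_ ?_ ?_ <;> refine fixed_of_psupp_subset hs ?_ <;>
    simp only [mem_arc] <;> grind [Cr]

theorem fixes_left {f : Equiv.Perm X} {a b : X} (hs : psupp f ⊆ arc a b) : f a = a :=
  fixed_of_psupp_subset hs fun h => h.ne₁₂ rfl

theorem fixes_right {f : Equiv.Perm X} {a b : X} (hs : psupp f ⊆ arc a b) : f b = b :=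
  fixed_of_psupp_subset hs fun h => h.ne₂₃ rfl

theorem apply_mem_arc {f : Equiv.Perm X} (h : Monocircular f) {a b x : X}
    (hs : psupp f ⊆ arc a b) (hx : Cr a x b) : Cr a (f x) b := by
  have := (preservesCr_of_psupp_subset h hx.ne₁₃ hs a x b).1 hx
  rwa [fixes_left hs, fixes_right hs] at this

theorem exists_open_cr {x y z : X} (h : Cr x y z) : ∃ U V W : Set X, IsOpen U ∧ IsOpen V ∧
    IsOpen W ∧ x ∈ U ∧ y ∈ V ∧ z ∈ W ∧ ∀ a ∈ U, ∀ b ∈ V, ∀ c ∈ W, Cr a b c := by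
  obtain ⟨U, T, hU, hT, hx, hyz, hs⟩ := isOpen_prod_iff.1 isOpen_cr x (y, z) h
  obtain ⟨V, W, hV, hW, hy, hz, hs'⟩ := isOpen_prod_iff.1 hT y z hyz
  exact ⟨U, V, W, hU, hV, hW, hx, hy, hz, fun a ha b hb c hc =>
    hs (Set.mk_mem_prod ha (hs' (Set.mk_mem_prod hb hc)))⟩

end Support

/-! ### Locally moving actions and their approximate transitivity -/

section LocAct
variable {X : Type*} [LinearOrder X] [TopologicalSpace X] {G : Type*} [Group G]

/-- A faithful action on a circle such that no point of an arc is fixed by all the group elements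
whose support lies in the arc. -/
structure LocAct (ρ : G →* Equiv.Perm X) : Prop where
  inj : Function.Injective ρ
  mono : ∀ g, Monocircular (ρ g)
  loc : ∀ {a b p : X}, Cr a p b → ∃ g, psupp (ρ g) ⊆ arc a b ∧ ρ g p ≠ p

/-- The support of the permutation lies in a bounded arc. -/
def PBdd (f : Equiv.Perm X) : Prop := ∃ a b, a ≠ b ∧ psupp f ⊆ arc a b

/-- The same action on the circle with the reversed orientation. -/
def dualHom (ρ : G →* Equiv.Perm X) : G →* Equiv.Perm Xᵒᵈ := ρ

theorem Monocircular.dual {f : Equiv.Perm X} (h : Monocircular f) :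
    Monocircular (X := Xᵒᵈ) (Y := Xᵒᵈ) f := by
  rcases h with h | h
  · refine Or.inl fun x y z => ?_
    exact (cr_dual (X := X)).trans ((h _ _ _).trans (cr_dual (X := X)).symm)
  · refine Or.inr fun x y z => ?_
    exact (cr_dual (X := X)).trans ((h _ _ _).trans (cr_dual (X := X)).symm)

theorem LocAct.dual {ρ : G →* Equiv.Perm X} (h : LocAct ρ) : LocAct (dualHom ρ) where
  inj := h.inj
  mono g := (h.mono g).dual
  loc {a b p} hp := by
    obtain ⟨g, hg, hg'⟩ := h.loc (cr_dual (X := X).1 hp)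
    exact ⟨g, fun x hx => cr_dual (X := X).2 (hg hx), hg'⟩

variable [CircTop X] {ρ : G →* Equiv.Perm X} (hρ : LocAct ρ)
include hρ

/-- Let `S` consist of the points of the circle that images of `x` under elements supported in the
arc from `a` to `v` can pass, measured from `a`. If `u` is not among them, `S` is an arc from `a` to
some `p` in the given arc. These elements map `S` into itself, so none of them, nor its inverse,
moves `p` forwards. Then they all fix `p`, against `LocAct.loc`. -/
theorem LocAct.push_right {a x u v : X} (hx : Cr a x v) (hu : Cr a u v) :
    ∃ h, psupp (ρ h) ⊆ arc a v ∧ Cr a u (ρ h x) := by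
  by_contra! hcon
  let S : Set X := ⋃ h : {h : G // psupp (ρ h) ⊆ arc a v}, arc a (ρ h x)
  have hmem : ∀ {y}, y ∈ S ↔ ∃ h, psupp (ρ h) ⊆ arc a v ∧ Cr a y (ρ h x) := by
    intro y
    simp only [S, Set.mem_iUnion, mem_arc, Subtype.exists, exists_prop]
  obtain ⟨p, hpa, hp⟩ := eq_arc_of_initial (w := a) (T := S) (isOpen_iUnion fun _ => isOpen_arc _ _)
    (by
      obtain ⟨z, hz⟩ := dense hx.ne₁₂
      exact ⟨z, hmem.2 ⟨1, by simp [psupp_one], by simpa using hz⟩⟩)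
    (fun h => by obtain ⟨h, -, h'⟩ := hmem.1 h; exact h'.ne₁₂ rfl)
    (fun y hy z hz => by
      obtain ⟨h, h₁, h₂⟩ := hmem.1 hy
      exact hmem.2 ⟨h, h₁, by grind [Cr]⟩)
    ⟨u, hu.ne₁₂.symm, fun h => by obtain ⟨h, h₁, h₂⟩ := hmem.1 h; exact hcon h h₁ h₂⟩
  have hup : ¬ Cr a u p := fun h => by
    obtain ⟨h, h₁, h₂⟩ := hmem.1 (hp.symm ▸ h : u ∈ S)
    exact hcon h h₁ h₂
  have hpv : Cr a p v := by grind [Cr]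
  have key : ∀ g, psupp (ρ g) ⊆ arc a v → ¬ Cr a p (ρ g p) := by
    intro g hg h
    have hpres := preservesCr_of_psupp_subset (hρ.mono g) hpv.ne₁₃ hg
    have h₁ : p ∈ ρ g '' S := by
      rw [hp, hpres.image_arc, fixes_left hg]
      exact h
    have h₂ : ρ g '' S ⊆ S := by
      rintro _ ⟨y, hy, rfl⟩
      obtain ⟨h, h₁, h₂⟩ := hmem.1 hy
      refine hmem.2 ⟨g * h, ?_, ?_⟩
      · rw [map_mul]
        exact (psupp_mul_subset _ _).trans (Set.union_subset hg h₁)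
      · rw [map_mul, Equiv.Perm.mul_apply]
        have := (hpres a y (ρ h x)).1 h₂
        rwa [fixes_left hg] at this
    have := h₂ h₁
    rw [hp] at this
    exact this.ne₂₃ rfl
  obtain ⟨g, hg, hgp⟩ := hρ.loc hpv
  have h₁ := apply_mem_arc (hρ.mono g) hg hpv
  have h₂ : Cr a (ρ g p) p := by
    have := key g hg
    grind [Cr]
  have hg' : psupp (ρ g⁻¹) ⊆ arc a v := by rwa [map_inv, psupp_inv]
  have h₃ := (preservesCr_of_psupp_subset (hρ.mono g⁻¹) hpv.ne₁₃ hg' a (ρ g p) p).1 h₂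
  rw [fixes_left hg', ← Equiv.Perm.mul_apply, ← map_mul, inv_mul_cancel, map_one,
    Equiv.Perm.one_apply] at h₃
  exact key g⁻¹ hg' h₃

theorem LocAct.push_left {b x u v : X} (hx : Cr v x b) (hu : Cr v u b) :
    ∃ h, psupp (ρ h) ⊆ arc v b ∧ Cr (ρ h x) u b := by
  obtain ⟨h, h₁, h₂⟩ := hρ.dual.push_right (a := OrderDual.toDual b) (x := OrderDual.toDual x)
    (u := OrderDual.toDual u) (v := OrderDual.toDual v) (cr_dual.2 hx) (cr_dual.2 hu)
  exact ⟨h, fun y hy => cr_dual.1 (h₁ hy), cr_dual.1 h₂⟩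

/-- The elements supported in an arc move every point of the arc arbitrarily close to every
other point of the arc. -/
theorem LocAct.exists_move {a b x v : X} (hx : Cr a x b) (hv : Cr a v b) {V : Set X}
    (hV : IsOpen V) (hvV : v ∈ V) : ∃ h, psupp (ρ h) ⊆ arc a b ∧ ρ h x ∈ V := by
  obtain ⟨c', d', h, hs⟩ := exists_arc_subset (hV.inter (isOpen_arc a b)) ⟨hvV, hv⟩
  obtain ⟨c, hc⟩ := dense h.ne₁₂
  obtain ⟨d, hd⟩ := dense h.ne₂₃
  have hs' : ∀ z, Cr c' z d' → z ∈ V ∧ Cr a z b := fun z hz => hs hz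
  have hc₁ := (hs' c (by grind [Cr])).2
  have hd₁ := (hs' d (by grind [Cr])).2
  have hcd : ∀ z, Cr c z d → z ∈ V := fun z hz => (hs' z (by grind [Cr])).1
  have hacd : Cr a c d := by
    have ha : ¬ Cr c' a d' := fun h => (hs' a h).2.ne₁₂ rfl
    clear hs hs' hcd
    grind [Cr]
  -- The target is the arc from `c` to `d`. A point in front of `d` is pushed forwards past `c` by
  -- an element that fixes `d`; any other point is pushed backwards past `d` by an element that
  -- fixes `c`.
  by_cases hxd : Cr a x d
  · obtain ⟨g, h₁, h₂⟩ := hρ.push_right hxd hacd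
    have h₃ := apply_mem_arc (hρ.mono g) h₁ hxd
    refine ⟨g, fun z hz => ?_, hcd _ (by grind [Cr])⟩
    have := h₁ hz
    simp only [mem_arc] at *
    grind [Cr]
  · have h₄ : Cr c x b := by grind [Cr]
    obtain ⟨g, h₁, h₂⟩ := hρ.push_left h₄ (u := d) (by grind [Cr])
    have h₃ := apply_mem_arc (hρ.mono g) h₁ h₄
    refine ⟨g, fun z hz => ?_, hcd _ (by grind [Cr])⟩
    have := h₁ hz
    simp only [mem_arc] at *
    grind [Cr]

theorem LocAct.exists_move_fixing {x y v : X} (hx : x ≠ y) (hv : v ≠ y) {V : Set X}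
    (hV : IsOpen V) (hvV : v ∈ V) : ∃ h, PBdd (ρ h) ∧ ρ h y = y ∧ ρ h x ∈ V := by
  obtain ⟨b, h₁, h₂⟩ : ∃ b, Cr y x b ∧ Cr y v b := by
    by_cases h : Cr y x v
    · obtain ⟨z, hz⟩ := dense hv
      exact ⟨z, by grind [Cr], by grind [Cr]⟩
    · obtain ⟨z, hz⟩ := dense hx
      exact ⟨z, by grind [Cr], by grind [Cr]⟩
  obtain ⟨h, hs, hm⟩ := hρ.exists_move h₁ h₂ hV hvV
  exact ⟨h, ⟨y, b, h₁.ne₁₃, hs⟩, fixes_left hs, hm⟩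

theorem LocAct.preservesCr {h : G} (hh : PBdd (ρ h)) : PreservesCr (ρ h) := by
  obtain ⟨a, b, hab, hs⟩ := hh
  exact preservesCr_of_psupp_subset (hρ.mono h) hab hs

/-- The points are moved one after the other, each by a bounded element that fixes those already
placed. The third move takes place in the arc between the images of the second and the first point.
The targets are first shrunk so that they stay in the right circular order whichever points of them
are hit. -/
theorem LocAct.exists_move_triple {x₁ x₂ x₃ y₁ y₂ y₃ : X} (hx : Cr x₁ x₂ x₃) (hy : Cr y₁ y₂ y₃)
    {V₁ V₂ V₃ : Set X} (hV₁ : IsOpen V₁) (hV₂ : IsOpen V₂) (hV₃ : IsOpen V₃) (h₁ : y₁ ∈ V₁)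
    (h₂ : y₂ ∈ V₂) (h₃ : y₃ ∈ V₃) : ∃ b₁ b₂ b₃, PBdd (ρ b₁) ∧ PBdd (ρ b₂) ∧ PBdd (ρ b₃) ∧
      ρ (b₃ * b₂ * b₁) x₁ ∈ V₁ ∧ ρ (b₃ * b₂ * b₁) x₂ ∈ V₂ ∧ ρ (b₃ * b₂ * b₁) x₃ ∈ V₃ := by
  obtain ⟨U₁, U₂, U₃, hU₁, hU₂, hU₃, hy₁, hy₂, hy₃, hU⟩ := exists_open_cr hy
  -- The first move is made in the circle cut at an auxiliary point, which has to avoid both source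
  -- and target.
  obtain ⟨y, hyx, hyy⟩ : ∃ y, y ≠ x₁ ∧ y ≠ y₁ := by
    by_cases h : x₂ = y₁
    · exact ⟨x₃, hx.ne₁₃.symm, h ▸ hx.ne₂₃.symm⟩
    · exact ⟨x₂, hx.ne₁₂.symm, h⟩
  obtain ⟨b₁, hb₁, -, hm₁⟩ := hρ.exists_move_fixing hyx.symm hyy.symm (hV₁.inter hU₁) ⟨h₁, hy₁⟩
  have hx₁ := (hρ.preservesCr hb₁ _ _ _).1 hx
  obtain ⟨b₂, hb₂, hf₂, hm₂⟩ := hρ.exists_move_fixing hx₁.ne₁₂.symm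
    (hU _ hm₁.2 _ hy₂ _ hy₃).ne₁₂.symm (hV₂.inter hU₂) ⟨h₂, hy₂⟩
  have hx₂ := (hρ.preservesCr hb₂ _ _ _).1 hx₁
  rw [hf₂] at hx₂
  obtain ⟨b₃, hs, hm₃⟩ := hρ.exists_move (a := ρ b₂ (ρ b₁ x₂)) (b := ρ b₁ x₁) hx₂.cyc
    (hU _ hm₁.2 _ hm₂.2 _ hy₃).cyc hV₃ h₃
  refine ⟨b₁, b₂, b₃, hb₁, hb₂, ⟨_, _, hx₂.ne₁₂.symm, hs⟩, ?_, ?_, ?_⟩ <;>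
    simp only [map_mul, Equiv.Perm.mul_apply]
  · rw [hf₂, fixes_right hs]; exact hm₁.1
  · rw [fixes_left hs]; exact hm₂.1
  · exact hm₃

/-- The fourth point is moved inside the arc between the images of the third and the first. This arc
does not contain the image of the second, so all three points already placed stay put. -/
theorem LocAct.exists_move_quadruple {x₁ x₂ x₃ x₄ y₁ y₂ y₃ y₄ : X} (hx : Cr x₁ x₂ x₃)
    (hx' : Cr x₁ x₃ x₄) (hy : Cr y₁ y₂ y₃) (hy' : Cr y₁ y₃ y₄) {V₁ V₂ V₃ V₄ : Set X}
    (hV₁ : IsOpen V₁) (hV₂ : IsOpen V₂) (hV₃ : IsOpen V₃) (hV₄ : IsOpen V₄) (h₁ : y₁ ∈ V₁)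
    (h₂ : y₂ ∈ V₂) (h₃ : y₃ ∈ V₃) (h₄ : y₄ ∈ V₄) :
    ∃ g, ρ g x₁ ∈ V₁ ∧ ρ g x₂ ∈ V₂ ∧ ρ g x₃ ∈ V₃ ∧ ρ g x₄ ∈ V₄ := by
  obtain ⟨U₁, U₃, U₄, hU₁, hU₃, hU₄, hy₁, hy₃, hy₄, hU⟩ := exists_open_cr hy'
  obtain ⟨b₁, b₂, b₃, hb₁, hb₂, hb₃, hm₁, hm₂, hm₃⟩ := hρ.exists_move_triple hx hy
    (hV₁.inter hU₁) hV₂ (hV₃.inter hU₃) ⟨h₁, hy₁⟩ h₂ ⟨h₃, hy₃⟩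
  have hp : PreservesCr (ρ (b₃ * b₂ * b₁)) := by
    rw [map_mul, map_mul]
    exact ((hρ.preservesCr hb₃).comp (hρ.preservesCr hb₂)).comp (hρ.preservesCr hb₁)
  generalize b₃ * b₂ * b₁ = g at *
  have hx₁ := (hp _ _ _).1 hx
  have hx₃ := (hp _ _ _).1 hx'
  obtain ⟨b₄, hs, hm₄⟩ := hρ.exists_move hx₃.cyc (hU _ hm₁.2 _ hm₃.2 _ hy₄).cyc hV₄ h₄
  have hf : ρ b₄ (ρ g x₂) = ρ g x₂ := fixed_of_psupp_subset hs (by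
    simp only [mem_arc]; grind [Cr])
  refine ⟨b₄ * g, ?_, ?_, ?_, ?_⟩ <;> simp only [map_mul, Equiv.Perm.mul_apply]
  · rw [fixes_right hs]; exact hm₁.1
  · rw [hf]; exact hm₂
  · rw [fixes_left hs]; exact hm₃.1
  · exact hm₄

end LocAct

/-! ### The class of groups in terms of locally moving actions -/

section IsMC
variable {L : Type u} [LinearOrder L] [CircleBase L]

theorem bddElt_iff (g : Equiv.Perm L) : BddElt g ↔ PBdd (bar g) := by
  constructor
  · rintro ⟨_, ⟨a, b, hab, rfl⟩, h⟩
    exact ⟨a, b, hab, h⟩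
  · rintro ⟨a, b, hab, h⟩
    exact ⟨_, ⟨a, b, hab, rfl⟩, h⟩

theorem exists_emb_arc {U : Set (CBar L)} (hU : IsOpen U) (hne : U.Nonempty) :
    ∃ a b : L, a ≠ b ∧ ∀ z, Cr a z b → emb z ∈ U := by
  obtain ⟨x, hx⟩ := hne
  obtain ⟨e, f, u, v, h₁, h₂, h₃, h₄⟩ := exists_refine denseRange_emb hU hx
  refine ⟨e, f, fun h => h₂.ne₂₃ (congrArg emb h), fun z hz => h₄ _ (Or.inr (Or.inr ?_))⟩
  rw [← cr_emb] at hz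
  clear h₁
  grind [Cr]

theorem crTuple_four {X : Type*} [LinearOrder X] {x : Fin 4 → X} :
    CrTuple x ↔ Cr (x 0) (x 1) (x 2) ∧ Cr (x 0) (x 2) (x 3) := by
  constructor
  · intro h
    exact ⟨h 0 1 2 (by decide) (by decide), h 0 2 3 (by decide) (by decide)⟩
  · rintro ⟨h₁, h₂⟩ i j k hij hjk
    have h₃ : Cr (x 0) (x 1) (x 3) := by grind [Cr]
    have h₄ : Cr (x 1) (x 2) (x 3) := by grind [Cr]
    fin_cases i <;> fin_cases j <;> fin_cases k <;> first | assumption | (exfalso; revert hij hjk; decide)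

theorem IntervalTransitive.exists_open {G : Subgroup (Equiv.Perm L)} (h : IntervalTransitive 4 G)
    {U V : Fin 4 → Set (CBar L)} (hU : ∀ i, IsOpen (U i)) (hV : ∀ i, IsOpen (V i))
    (hUc : Crs U) (hVc : Crs V) : ∃ g ∈ G, ∃ m : Fin 4 → L, ∀ i,
      emb (m i) ∈ U i ∧ emb (g (m i)) ∈ V i := by
  choose a b hab hs using fun i => exists_emb_arc (hU i) (hUc.1 i)
  choose c d hcd ht using fun i => exists_emb_arc (hV i) (hVc.1 i)
  have key : ∀ {a b : Fin 4 → L} {U : Fin 4 → Set (CBar L)}, (∀ i, a i ≠ b i) → Crs U →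
      (∀ i z, Cr (a i) z (b i) → emb z ∈ U i) → Crs fun i => {z | Cr (a i) z (b i)} := by
    intro a b U hab hU hs
    refine ⟨fun i => ?_, fun x hx i j k hij hjk => ?_⟩
    · obtain ⟨l, hl⟩ := exists_mem_arc_of_dense denseRange_emb (emb_injective.ne (hab i))
      exact ⟨l, cr_emb.1 hl⟩
    · exact cr_emb.1 (hU.2 (fun i => emb (x i)) (fun i => hs i _ (hx i)) i j k hij hjk)
  obtain ⟨g, hg, hm⟩ := h _ _ (fun i => Or.inl ⟨a i, b i, hab i, rfl⟩)
    (fun i => Or.inl ⟨c i, d i, hcd i, rfl⟩) (key hab hUc hs) (key hcd hVc ht)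
  have : ∀ i, ∃ m, Cr (a i) m (b i) ∧ Cr (c i) (g m) (d i) := fun i => by
    obtain ⟨_, ⟨m, hm, rfl⟩, hm'⟩ := hm i
    exact ⟨m, hm, hm'⟩
  choose m hm₁ hm₂ using this
  exact ⟨g, hg, m, fun i => ⟨hs i _ (hm₁ i), ht i _ (hm₂ i)⟩⟩

theorem crs_four {X : Type*} [LinearOrder X] {U : Fin 4 → Set X} (hne : ∀ i, (U i).Nonempty)
    (h : ∀ a ∈ U 0, ∀ b ∈ U 1, ∀ c ∈ U 2, ∀ d ∈ U 3, Cr a b c ∧ Cr a c d) : Crs U :=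
  ⟨hne, fun _ hx => crTuple_four.2 (h _ (hx 0) _ (hx 1) _ (hx 2) _ (hx 3))⟩

/-- A conjugate of a bounded element `b` does it. The first two of the four intervals lie in an arc
of points moved by `b`, and are carried to the two sides of `p`. The other two lie outside the
support of `b`, and are carried close to the ends of the given arc, so that they confine the support
of the conjugate to this arc. -/
theorem IsMC.locAct {G : Subgroup (Equiv.Perm L)} (h : IsMC 4 G) : LocAct (barHom h.le_autEO) where
  inj := barHom_injective _
  mono g := bar_monocircular (h.le_autEO g.2)
  loc {s t p} hp := by
    obtain ⟨b, hb, hb1, hbdd⟩ := h.exists_bdd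
    obtain ⟨x, y, hxy, hsub⟩ := (bddElt_iff b).1 hbdd
    have hbm := bar_monocircular (h.le_autEO hb)
    obtain ⟨x₀, hx₀⟩ : (psupp (bar b)).Nonempty := by
      rw [Set.nonempty_iff_ne_empty]
      intro he
      refine hb1 (bar_injOn (h.le_autEO hb) (one_mem _) (Equiv.ext fun z => ?_))
      by_contra hz
      rw [bar_one] at hz
      have : z ∈ psupp (bar b) := hz
      rw [he] at this
      exact this
    obtain ⟨c, d, hcd, hcs⟩ := exists_closed_arc_subset hbm.isOpen_psupp hx₀
    obtain ⟨v, hv⟩ := dense hxy.symm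
    have hcx : ∀ z, z = c ∨ z = d ∨ Cr c z d → Cr x z y := fun z hz => hsub (hcs z hz)
    have hne : ∀ a b : CBar L, a ≠ b → (arc a b).Nonempty := fun a b h => dense h
    obtain ⟨s₁, hs₁⟩ := dense hp.ne₁₂
    obtain ⟨t₁, ht₁⟩ := dense hp.ne₂₃
    obtain ⟨o₁, o₂, o₃⟩ : Cr x c x₀ ∧ Cr x x₀ d ∧ Cr x d y := by
      have h₁ := hcx c (Or.inl rfl)
      have h₂ := hcx d (Or.inr (Or.inl rfl))
      have h₃ : ¬ Cr c x d := fun h => (hcx x (Or.inr (Or.inr h))).ne₁₂ rfl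
      clear hcs hsub hcx
      exact ⟨by grind [Cr], by grind [Cr], h₂⟩
    have hUc : Crs ![arc c x₀, arc x₀ d, arc y v, arc v x] := by
      refine crs_four (fun i => ?_) ?_
      · fin_cases i
        exacts [hne _ _ hcd.ne₁₂, hne _ _ hcd.ne₂₃, hne _ _ hv.ne₁₂, hne _ _ hv.ne₂₃]
      · intro m₁ h₁ m₂ h₂ m₃ h₃ m₄ h₄
        simp only [Matrix.cons_val, mem_arc] at h₁ h₂ h₃ h₄
        clear hcs hsub hcx
        have h₅ : Cr x m₁ x₀ := by grind [Cr]
        have h₆ : Cr x x₀ m₂ := by grind [Cr]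
        have h₇ : Cr x m₂ y := by grind [Cr]
        have h₈ : Cr x y m₃ := by grind [Cr]
        have h₉ : Cr x m₃ m₄ := by grind [Cr]
        clear h₁ h₂ h₃ h₄ hcd hv o₁ o₂ o₃ hs₁ ht₁ hp
        exact ⟨by grind [Cr], by grind [Cr]⟩
    have hVc : Crs ![arc s₁ p, arc p t₁, arc t₁ t, arc s s₁] := by
      refine crs_four (fun i => ?_) ?_
      · fin_cases i
        exacts [hne _ _ hs₁.ne₂₃, hne _ _ ht₁.ne₁₂, hne _ _ ht₁.ne₂₃, hne _ _ hs₁.ne₁₂]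
      · intro m₁ h₁ m₂ h₂ m₃ h₃ m₄ h₄
        simp only [Matrix.cons_val, mem_arc] at h₁ h₂ h₃ h₄
        have h₅ : Cr m₁ p m₂ := by grind [Cr]
        have h₆ : Cr p m₂ m₃ := by grind [Cr]
        have h₇ : Cr m₄ m₁ p := by grind [Cr]
        have h₈ : Cr m₃ m₄ p := by grind [Cr]
        clear h₁ h₂ h₃ h₄ hs₁ ht₁
        constructor
        · grind [Cr]
        · grind [Cr]
    obtain ⟨g, hg, m, hm⟩ := h.intervalTransitive.exists_open
      (fun i => by fin_cases i <;> exact isOpen_arc _ _)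
      (fun i => by fin_cases i <;> exact isOpen_arc _ _) hUc hVc
    have hgE := h.le_autEO hg
    have hgm := bar_monocircular hgE
    have hU := crTuple_four.1 (hUc.2 (fun i => emb (m i)) fun i => (hm i).1)
    have hV := crTuple_four.1 (hVc.2 (fun i => emb (g (m i))) fun i => (hm i).2)
    have m₀ := hm 0
    have m₁ := hm 1
    have m₂ := hm 2
    have m₃ := hm 3
    simp only [← bar_emb hgE] at hV m₀ m₁ m₂ m₃
    simp only [Matrix.cons_val, mem_arc] at m₀ m₁ m₂ m₃
    generalize emb (m 0) = k₀ at *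
    generalize emb (m 1) = k₁ at *
    generalize emb (m 2) = k₂ at *
    generalize emb (m 3) = k₃ at *
    -- One positive triple has a positive image, which excludes a reversal of the orientation.
    have hpres : PreservesCr (bar g) := by
      rcases hgm with h | h
      · exact h
      · exact absurd ((h _ _ _).1 hU.1) hV.1.not_rev
    refine ⟨⟨g * b * g⁻¹, mul_mem (mul_mem hg hb) (inv_mem hg)⟩, ?_, ?_⟩
    · show psupp (bar (g * b * g⁻¹)) ⊆ _
      rw [bar_mul (mul_mem hgE (h.le_autEO hb)) (inv_mem hgE), bar_mul hgE (h.le_autEO hb),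
        bar_inv hgE, psupp_conj]
      rintro _ ⟨z, hz, rfl⟩
      have hz' : Cr x z y := hsub hz
      have h₁ : Cr k₃ z k₂ := by
        have h₁ := m₂.1
        have h₂ := m₃.1
        clear hsub hcs hcx hm hUc hVc hU hV m₀ m₁ m₂ m₃ o₁ o₂ o₃
        grind [Cr]
      have h₂ := (hpres _ _ _).1 h₁
      have h₃ := m₂.2
      have h₄ := m₃.2
      have h₅ : Cr s s₁ t₁ := by clear h₁ h₂; grind [Cr]
      have h₆ : Cr s t₁ t := by clear h₁ h₂; grind [Cr]
      clear hsub hcs hcx hm hUc hVc hU hV m₀ m₁ m₂ m₃ o₁ o₂ o₃ h₁ hs₁ ht₁ hp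
      simp only [mem_arc]
      grind [Cr]
    · show bar (g * b * g⁻¹) p ≠ p
      rw [bar_mul (mul_mem hgE (h.le_autEO hb)) (inv_mem hgE), bar_mul hgE (h.le_autEO hb),
        bar_inv hgE]
      change p ∈ psupp _
      rw [psupp_conj]
      obtain ⟨q, rfl⟩ := (bar g).surjective p
      refine ⟨q, hcs q (Or.inr (Or.inr ?_)), rfl⟩
      have h₁ : Cr k₀ q k₁ := by
        rw [hpres]
        have h₁ := m₀.2
        have h₂ := m₁.2
        clear hsub hcs hcx hm hUc hVc hU hV m₀ m₁ m₂ m₃ o₁ o₂ o₃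
        grind [Cr]
      have h₂ := m₀.1
      have h₃ := m₁.1
      clear hsub hcs hcx hm hUc hVc hU hV m₀ m₁ m₂ m₃ o₁ o₂ o₃ hs₁ ht₁ hp hv hb1
      grind [Cr]

theorem exists_open_of_isCInterval {I : Set L} (hI : IsCInterval I) {l : L} (hl : l ∈ I) :
    ∃ U : Set (CBar L), IsOpen U ∧ emb l ∈ U ∧ ∀ z, emb z ∈ U → z ∈ I := by
  rcases hI with ⟨a, b, -, rfl⟩ | rfl | ⟨a, rfl⟩
  · exact ⟨arc (emb a) (emb b), isOpen_arc _ _, cr_emb.2 hl, fun z hz => cr_emb.1 hz⟩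
  · exact ⟨Set.univ, isOpen_univ, trivial, fun _ _ => trivial⟩
  · exact ⟨{z | z ≠ emb a}, isOpen_ne' _, fun h => hl (emb_injective h), fun z hz e => hz (e ▸ rfl)⟩

/-- The converse of `IsMC.locAct`. It reduces membership of a subgroup in the class to exhibiting
local moves, as is done for Opp(G), Bdd(G) and Bdd'(G). -/
theorem LocAct.isMC {G : Subgroup (Equiv.Perm L)} {hG : G ≤ autEO L} (h : LocAct (barHom hG)) :
    IsMC 4 G where
  le_autEO := hG
  intervalTransitive I J hI hJ hIc hJc := by
    choose x hx using hIc.1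
    choose y hy using hJc.1
    choose V hV hyV hVJ using fun i => exists_open_of_isCInterval (hJ i) (hy i)
    have h₁ := crTuple_four.1 (hIc.2 x hx)
    have h₂ := crTuple_four.1 (hJc.2 y hy)
    simp only [← cr_emb] at h₁ h₂
    obtain ⟨g, hg₀, hg₁, hg₂, hg₃⟩ := h.exists_move_quadruple h₁.1 h₁.2 h₂.1 h₂.2 (hV 0) (hV 1)
      (hV 2) (hV 3) (hyV 0) (hyV 1) (hyV 2) (hyV 3)
    have key : ∀ i, bar (g : Equiv.Perm L) (emb (x i)) ∈ V i := fun i => by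
      fin_cases i <;> assumption
    refine ⟨g, g.2, fun i => ⟨(g : Equiv.Perm L) (x i), ⟨x i, hx i, rfl⟩, hVJ i _ ?_⟩⟩
    rw [← bar_emb (hG g.2)]
    exact key i
  exists_bdd := by
    obtain ⟨a, p, b, hp⟩ := exists_cr (CBar L)
    obtain ⟨g, hg, hgp⟩ := h.loc hp
    refine ⟨g, g.2, fun e => hgp ?_, (bddElt_iff _).2 ⟨a, b, hp.ne₁₃, hg⟩⟩
    change bar (g : Equiv.Perm L) p = p
    rw [e, bar_one]
    rfl

end IsMC

/-! ### Group-theoretic counterparts of topological relations -/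

section GroupPredicates
variable {G : Type*} [Group G]

/-- Algebraic disjointness. -/
def AlgDisj (f g : G) : Prop :=
  ∀ h, ¬ f * h = h * f → ∃ f₁ f₂, f₁ * g = g * f₁ ∧ f₂ * g = g * f₂ ∧ ∃ k,
    k * ((f₂ * h * f₂⁻¹ * h⁻¹) * f₁) = f₁ * (f₂ * h * f₂⁻¹ * h⁻¹) ∧ k * g = g * k ∧ ¬ k = 1

/-- The group-theoretic counterpart of `var k ⊆ var f`. -/
def AlgSub (k f : G) : Prop :=
  ∀ g, AlgDisj f g → k * (g ^ 12) = g ^ 12 * k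

/-- The group-theoretic counterpart of the disjointness of `var f` and `var g`. -/
def Dj (f g : G) : Prop := ∀ k, AlgSub k f → AlgSub k g → k = 1

/-- The group-theoretic counterpart of boundedness. -/
def AlgBdd (b : G) : Prop := ∃ z, ¬ z = 1 ∧ Dj z b

/-- A product of three bounded elements carries the `cᵢ` so as to meet the `dᵢ`. -/
def Meet (c₁ c₂ c₃ d₁ d₂ d₃ : G) : Prop :=
  ∃ b₁ b₂ b₃, AlgBdd b₁ ∧ AlgBdd b₂ ∧ AlgBdd b₃ ∧
    ¬ Dj (b₃ * b₂ * b₁ * c₁ * (b₃ * b₂ * b₁)⁻¹) d₁ ∧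
    ¬ Dj (b₃ * b₂ * b₁ * c₂ * (b₃ * b₂ * b₁)⁻¹) d₂ ∧
    ¬ Dj (b₃ * b₂ * b₁ * c₃ * (b₃ * b₂ * b₁)⁻¹) d₃

/-- The group-theoretic counterpart of equal orientation. -/
def EoA (c₁ c₂ c₃ d₁ d₂ d₃ : G) : Prop :=
  ¬ c₁ = 1 ∧ ¬ c₂ = 1 ∧ ¬ c₃ = 1 ∧ ¬ d₁ = 1 ∧ ¬ d₂ = 1 ∧ ¬ d₃ = 1 ∧ ¬ Meet c₁ c₂ c₃ d₂ d₁ d₃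

/-- The elements `c` and `d` are separated by two further elements. -/
def Apart (c d : G) : Prop := ∃ u v, EoA c u d d v c

end GroupPredicates

/-! ### Recovering inclusion and disjointness of the sets var(g) -/

section Semantics
variable {X : Type*} [LinearOrder X] [TopologicalSpace X] {G : Type*} [Group G] [CircTop X]
  {ρ : G →* Equiv.Perm X} (hρ : LocAct ρ)
include hρ

theorem LocAct.eq_one_iff {g : G} : g = 1 ↔ psupp (ρ g) = ∅ := by
  constructor
  · rintro rfl; rw [map_one, psupp_one]
  · intro h
    refine hρ.inj (Equiv.ext fun x => ?_)
    rw [map_one]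
    exact fixed_of_psupp_subset (U := ∅) h.le (Set.notMem_empty x)

theorem LocAct.nonempty_of_ne_one {g : G} (h : ¬ g = 1) : (psupp (ρ g)).Nonempty :=
  Set.nonempty_iff_ne_empty.2 fun e => h (hρ.eq_one_iff.2 e)

theorem LocAct.ne_one_of_mem {g : G} {x : X} (h : x ∈ psupp (ρ g)) : ¬ g = 1 := fun e => by
  rw [hρ.eq_one_iff.1 e] at h
  exact h

theorem LocAct.isOpen_psupp (g : G) : IsOpen (psupp (ρ g)) := (hρ.mono g).isOpen_psupp

theorem LocAct.psupp_subset (g : G) : psupp (ρ g) ⊆ pvar (ρ g) := (hρ.mono g).psupp_subset_pvar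

theorem LocAct.eq_one_of_pvar {g : G} (h : pvar (ρ g) = ∅) : g = 1 :=
  hρ.eq_one_iff.2 (Set.subset_empty_iff.1 (h ▸ hρ.psupp_subset g))

theorem LocAct.pvar_nonempty {g : G} (h : ¬ g = 1) : (pvar (ρ g)).Nonempty :=
  (hρ.nonempty_of_ne_one h).mono (hρ.psupp_subset g)

/-- Every neighbourhood of a point supports an element that moves the point. -/
theorem LocAct.exists_mem {x : X} {U : Set X} (hU : IsOpen U) (hx : x ∈ U) :
    ∃ g, psupp (ρ g) ⊆ U ∧ pvar (ρ g) ⊆ U ∧ x ∈ psupp (ρ g) ∧ PBdd (ρ g) := by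
  obtain ⟨a, b, h, hs⟩ := exists_closed_arc_subset hU hx
  obtain ⟨g, hg, hgx⟩ := hρ.loc h
  refine ⟨g, fun z hz => hs z (Or.inr (Or.inr (hg hz))), fun z hz => hs z ?_, hgx,
    ⟨a, b, h.ne₁₃, hg⟩⟩
  exact closure_arc_subset h.ne₁₃ (closure_mono hg (interior_subset hz))

theorem LocAct.commute_of_disjoint {f g : G} (h : Disjoint (psupp (ρ f)) (psupp (ρ g))) :
    f * g = g * f := by
  refine hρ.inj (Equiv.ext fun x => ?_)
  rw [map_mul, map_mul, Equiv.Perm.mul_apply, Equiv.Perm.mul_apply]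
  rw [Set.disjoint_left] at h
  by_cases hx : x ∈ psupp (ρ f)
  · have h₁ : ρ g x = x := by_contra fun h' => h hx h'
    have h₂ : ρ g (ρ f x) = ρ f x := by_contra fun h' => h (apply_mem_psupp.2 hx) h'
    rw [h₁, h₂]
  · have h₁ : ρ f x = x := not_not.1 hx
    have h₂ : ρ f (ρ g x) = ρ g x := by
      by_contra h'
      by_cases hgx : x ∈ psupp (ρ g)
      · exact h h' (apply_mem_psupp.2 hgx)
      · have : ρ g x = x := not_not.1 hgx
        rw [this] at h'
        exact hx h'
    rw [h₁, h₂]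

theorem LocAct.exists_disjoint_image {f : G} {x : X} (hx : ρ f x ≠ x) {U : Set X} (hU : IsOpen U)
    (hxU : x ∈ U) : ∃ V, IsOpen V ∧ x ∈ V ∧ V ⊆ U ∧ Disjoint V (ρ f '' V) := by
  obtain ⟨A, B, hA, hB, hxA, hxB, hAB⟩ := t2_separation hx.symm
  refine ⟨U ∩ (A ∩ ρ f ⁻¹' B), hU.inter (hA.inter (hB.preimage (hρ.mono f).continuous)),
    ⟨hxU, hxA, hxB⟩, Set.inter_subset_left, ?_⟩
  rw [Set.disjoint_left]
  rintro _ hz ⟨y, hy, rfl⟩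
  exact Set.disjoint_left.1 hAB hz.2.1 hy.2.2

/-- If `f` displaces a small neighbourhood of `x` off itself and `g` moves `x` inside that
neighbourhood, then `f` and `g` do not commute. -/
theorem LocAct.exists_not_commute {U : Set X} (hU : IsOpen U) (hne : U.Nonempty) :
    ∃ f g, psupp (ρ f) ⊆ U ∧ psupp (ρ g) ⊆ U ∧ ¬ f * g = g * f := by
  obtain ⟨x, hx⟩ := hne
  obtain ⟨f, hf, -, hfx, -⟩ := hρ.exists_mem hU hx
  obtain ⟨V, hV, hxV, hVU, hd⟩ := hρ.exists_disjoint_image hfx hU hx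
  obtain ⟨g, hg, -, hgx, -⟩ := hρ.exists_mem hV hxV
  refine ⟨f, g, hf, hg.trans hVU, fun h => ?_⟩
  have h₁ : ρ (f * g) x = ρ (g * f) x := by rw [h]
  rw [map_mul, map_mul, Equiv.Perm.mul_apply, Equiv.Perm.mul_apply] at h₁
  have h₂ : ρ g (ρ f x) = ρ f x := fixed_of_psupp_subset hg fun h' =>
    Set.disjoint_left.1 hd h' ⟨x, hxV, rfl⟩
  rw [h₂] at h₁
  exact hgx ((ρ f).injective h₁)

/-- An element `k` not commuting with `f` moves a point of the support of `f`, hence displaces some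
open `V` inside this support. For noncommuting `f₁`, `f₂` supported in `V`, the commutator of `f₂`
and `k` is `f₂` times an element supported off `V`. Its commutator with `f₁` is therefore that of
`f₁` and `f₂`, a nontrivial element supported off the support of `g`. -/
theorem LocAct.algDisj_of_disjoint {f g : G} (h : Disjoint (psupp (ρ f)) (psupp (ρ g))) :
    AlgDisj f g := by
  intro k hk
  obtain ⟨x, hx, hxk⟩ : ∃ x, x ∈ psupp (ρ f) ∧ ρ k x ≠ x := by
    by_contra! hcon
    refine hk (hρ.commute_of_disjoint ?_)
    exact Set.disjoint_left.2 fun x h₁ h₂ => h₂ (hcon x h₁)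
  obtain ⟨V, hV, hxV, hVU, hd⟩ := hρ.exists_disjoint_image hxk (hρ.isOpen_psupp f) hx
  obtain ⟨f₁, f₂, h₁, h₂, h₁₂⟩ := hρ.exists_not_commute hV ⟨x, hxV⟩
  have hcomm : ∀ {a b : G}, psupp (ρ a) ⊆ V → psupp (ρ b) ⊆ psupp (ρ g) → a * b = b * a :=
    fun ha hb => hρ.commute_of_disjoint ((h.mono_left (ha.trans hVU)).mono_right hb)
  have hconj : psupp (ρ (k * f₂⁻¹ * k⁻¹)) ⊆ ρ k '' V := by
    rw [map_mul, map_mul, map_inv, map_inv, psupp_conj, psupp_inv]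
    exact Set.image_mono h₂
  have hc₁ : f₁ * (k * f₂⁻¹ * k⁻¹) = k * f₂⁻¹ * k⁻¹ * f₁ :=
    hρ.commute_of_disjoint ((hd.mono_left h₁).mono_right hconj)
  refine ⟨f₁, f₂, hcomm h₁ subset_rfl, hcomm h₂ subset_rfl, f₁ * f₂ * f₁⁻¹ * f₂⁻¹, ?_, ?_, ?_⟩
  · have : f₂ * k * f₂⁻¹ * k⁻¹ = f₂ * (k * f₂⁻¹ * k⁻¹) := by group
    rw [this, mul_assoc f₂, ← hc₁]
    group
  · refine hcomm ?_ subset_rfl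
    rw [map_mul, map_mul, map_mul]
    refine (psupp_mul_subset _ _).trans (Set.union_subset ((psupp_mul_subset _ _).trans
      (Set.union_subset ((psupp_mul_subset _ _).trans (Set.union_subset h₁ h₂)) ?_)) ?_)
    · rwa [map_inv, psupp_inv]
    · rwa [map_inv, psupp_inv]
  · intro e
    refine h₁₂ ?_
    have : f₁ * f₂ = f₁ * f₂ * f₁⁻¹ * f₂⁻¹ * (f₂ * f₁) := by group
    rw [this, e, one_mul]

/-- If `f` and `g ^ 12` both moved `x`, a small `V` around `x` would be disjoint from its images
under `f` and under `g`, …, `g ^ 4`. For `k` supported in `V`, the element provided by `AlgDisj` has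
its support in four translates of `V` by elements commuting with `g`. As it commutes with `g` as
well, five successive points of a `g`-orbit lie in these translates, and two of them share one. This
contradicts the choice of `V`. -/
theorem LocAct.disjoint_of_algDisj {f g : G} (h : AlgDisj f g) :
    Disjoint (psupp (ρ f)) (psupp (ρ (g ^ 12))) := by
  rw [Set.disjoint_left]
  intro x hf hg
  have hfar : ∀ n : ℕ, n ∈ Finset.Icc 1 4 → ρ (g ^ n) x ≠ x := by
    intro n hn e
    -- The exponent 12 is the least common multiple of 1, 2, 3, 4: a point fixed by one of these
    -- powers of `g` is fixed by `g ^ 12`.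
    have hdvd : n ∣ 12 := by fin_cases hn <;> decide
    obtain ⟨m, hm⟩ := hdvd
    refine hg ?_
    rw [hm, pow_mul, map_pow]
    exact Function.IsFixedPt.perm_pow e m
  have hV : ∃ V, IsOpen V ∧ x ∈ V ∧ Disjoint V (ρ f '' V) ∧
      ∀ n ∈ Finset.Icc 1 4, Disjoint V (ρ (g ^ n) '' V) := by
    obtain ⟨V₀, hV₀, hx₀, -, hd₀⟩ := hρ.exists_disjoint_image hf isOpen_univ (Set.mem_univ x)
    choose! W hW hxW _ hdW using fun (n : ℕ) (hn : n ∈ Finset.Icc 1 4) =>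
      hρ.exists_disjoint_image (hfar n hn) isOpen_univ (Set.mem_univ x)
    refine ⟨V₀ ∩ ⋂ n ∈ Finset.Icc 1 4, W n, hV₀.inter (isOpen_biInter_finset hW),
      ⟨hx₀, Set.mem_iInter₂.2 hxW⟩, ?_, fun n hn => ?_⟩
    · exact (hd₀.mono_left Set.inter_subset_left).mono_right (Set.image_mono Set.inter_subset_left)
    · have : V₀ ∩ ⋂ n ∈ Finset.Icc 1 4, W n ⊆ W n :=
        Set.inter_subset_right.trans (Set.biInter_subset_of_mem hn)
      exact ((hdW n hn).mono_left this).mono_right (Set.image_mono this)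
  obtain ⟨V, hVo, hxV, hVf, hVg⟩ := hV
  obtain ⟨k, hk, -, hkx, -⟩ := hρ.exists_mem hVo hxV
  obtain ⟨f₁, f₂, h₁, h₂, c, hc, hcg, hc1⟩ := h k (by
    intro e
    have h₁ : ρ (f * k) x = ρ (k * f) x := by rw [e]
    rw [map_mul, map_mul, Equiv.Perm.mul_apply, Equiv.Perm.mul_apply] at h₁
    have h₂ : ρ k (ρ f x) = ρ f x := fixed_of_psupp_subset hk fun h' =>
      Set.disjoint_left.1 hVf h' ⟨x, hxV, rfl⟩
    rw [h₂] at h₁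
    exact hkx ((ρ f).injective h₁))
  -- the support of `c` is covered by four translates of `V` by elements commuting with `g`
  let T : Fin 4 → G := ![f₁ * f₂, f₁, f₂, 1]
  have hT : ∀ i, T i * g = g * T i := by
    intro i
    fin_cases i
    · show f₁ * f₂ * g = g * (f₁ * f₂)
      rw [mul_assoc, h₂, ← mul_assoc, h₁, mul_assoc]
    · exact h₁
    · exact h₂
    · show 1 * g = g * 1
      group
  have hconj : ∀ t : G, ∀ s : G, psupp (ρ s) ⊆ V → psupp (ρ (t * s * t⁻¹)) ⊆ ρ t '' V := by
    intro t s hs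
    rw [map_mul, map_mul, map_inv, psupp_conj]
    exact Set.image_mono hs
  have hk' : psupp (ρ k⁻¹) ⊆ V := by rwa [map_inv, psupp_inv]
  have hcov : psupp (ρ c) ⊆ ⋃ i, ρ (T i) '' V := by
    -- The double commutator of `f₁` with that of `f₂` and `k` expands into four conjugates of `k`
    -- or `k⁻¹`.
    have hc' : c = ((f₁ * f₂) * k * (f₁ * f₂)⁻¹) * (f₁ * k⁻¹ * f₁⁻¹) *
        (1 * k * 1⁻¹) * (f₂ * k⁻¹ * f₂⁻¹) := by
      have : c = f₁ * (f₂ * k * f₂⁻¹ * k⁻¹) * (f₂ * k * f₂⁻¹ * k⁻¹ * f₁)⁻¹ := by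
        rw [← hc]; group
      rw [this]; group
    have hi : ∀ i, ρ (T i) '' V ⊆ ⋃ i, ρ (T i) '' V := fun i =>
      Set.subset_iUnion (fun i => ρ (T i) '' V) i
    rw [hc', map_mul, map_mul, map_mul]
    refine (psupp_mul_subset _ _).trans (Set.union_subset ((psupp_mul_subset _ _).trans
      (Set.union_subset ((psupp_mul_subset _ _).trans (Set.union_subset ?_ ?_)) ?_)) ?_)
    · exact (hconj (f₁ * f₂) k hk).trans (hi 0)
    · exact (hconj f₁ k⁻¹ hk').trans (hi 1)
    · exact (hconj 1 k hk).trans (hi 3)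
    · exact (hconj f₂ k⁻¹ hk').trans (hi 2)
  obtain ⟨y, hy⟩ := hρ.nonempty_of_ne_one hc1
  have hcomm : Commute c g := hcg
  have hyn : ∀ n : ℕ, ρ (g ^ n) y ∈ psupp (ρ c) := by
    intro n h'
    have : ρ (c * g ^ n) y = ρ (g ^ n) y := by rw [map_mul, Equiv.Perm.mul_apply]; exact h'
    rw [(hcomm.pow_right n).eq, map_mul, Equiv.Perm.mul_apply] at this
    exact hy ((ρ (g ^ n)).injective this)
  have hsel : ∀ n : Fin 5, ∃ i : Fin 4, ρ (g ^ (n : ℕ)) y ∈ ρ (T i) '' V := fun n =>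
    Set.mem_iUnion.1 (hcov (hyn n))
  choose F hF using hsel
  -- Five points of the orbit, indexed by the exponents 0 to 4, are distributed over four
  -- translates.
  obtain ⟨m, n, hmn, hFmn⟩ := Fintype.exists_ne_map_eq_of_card_lt F (by simp)
  have key : ∀ m n : Fin 5, m < n → F m = F n → False := by
    intro m n hlt he
    obtain ⟨u, hu, hu'⟩ := hF m
    obtain ⟨w, hw, hw'⟩ := hF n
    rw [← he] at hw'
    obtain ⟨d, hd, hd'⟩ : ∃ d, (n : ℕ) = d + m ∧ d ∈ Finset.Icc 1 4 :=
      ⟨n - m, by omega, by simp; omega⟩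
    refine Set.disjoint_left.1 (hVg d hd') hw ⟨u, hu, ?_⟩
    refine (ρ (T (F m))).injective ?_
    rw [hw', hd, pow_add, map_mul, Equiv.Perm.mul_apply, ← hu', ← Equiv.Perm.mul_apply,
      ← map_mul, ← Equiv.Perm.mul_apply, ← map_mul]
    have : Commute (T (F m)) g := hT _
    rw [(this.pow_right _).eq]
  rcases lt_or_gt_of_ne hmn with h' | h'
  · exact key m n h' hFmn
  · exact key n m h' hFmn.symm

/-- Inside its bounded arc the element acts as an order automorphism, so a point that it moves
forwards or backwards never returns. -/
theorem LocAct.pow_ne_one {g : G} (hb : PBdd (ρ g)) {x : X} (hx : x ∈ psupp (ρ g)) {n : ℕ}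
    (hn : n ≠ 0) : ρ (g ^ n) x ≠ x := by
  obtain ⟨a, b, hab, hs⟩ := hb
  have key : ∀ g : G, psupp (ρ g) ⊆ arc a b → Cr a x (ρ g x) → ∀ n, n ≠ 0 →
      Cr a x (ρ (g ^ n) x) := by
    intro g hs h n hn
    have hp := preservesCr_of_psupp_subset (hρ.mono g) hab hs
    induction n with
    | zero => exact absurd rfl hn
    | succ n ih =>
      rcases Nat.eq_zero_or_pos n with rfl | hpos
      · simpa using h
      · have := (hp _ _ _).1 (ih hpos.ne')
        rw [fixes_left hs, ← Equiv.Perm.mul_apply, ← map_mul, ← pow_succ'] at this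
        grind [Cr]
  have hxa := hs hx
  have hx' := apply_mem_arc (hρ.mono g) hs hxa
  by_cases h : Cr a x (ρ g x)
  · exact (key g hs h n hn).ne₂₃.symm
  · have h₁ : Cr a (ρ g x) x := by
      simp only [mem_psupp, mem_arc] at *
      grind [Cr]
    have hs' : psupp (ρ g⁻¹) ⊆ arc a b := by rwa [map_inv, psupp_inv]
    have h₂ := (preservesCr_of_psupp_subset (hρ.mono g⁻¹) hab hs' _ _ _).1 h₁
    rw [fixes_left hs', ← Equiv.Perm.mul_apply, ← map_mul, inv_mul_cancel, map_one,
      Equiv.Perm.one_apply] at h₂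
    have h₃ := (key g⁻¹ hs' h₂ n hn).ne₂₃
    intro e
    refine h₃ ?_
    rw [inv_pow, map_inv, eq_comm, Equiv.Perm.inv_eq_iff_eq]
    exact e.symm

/-- If the inclusion fails, `k` displaces a small open set `V` off the closure of the support of
`f`. A bounded `g` supported in `V` is disjoint from `f`, but `g ^ 12` moves a point of `V` and
hence does not commute with `k`. Conversely, `AlgDisj f g` puts the support of `g ^ 12` outside var
f, and so outside the support of `k`. -/
theorem LocAct.algSub_iff {k f : G} : AlgSub k f ↔ pvar (ρ k) ⊆ pvar (ρ f) := by
  constructor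
  · intro h
    refine interior_mono (closure_minimal ?_ isClosed_closure)
    by_contra hcon
    obtain ⟨x, hx, hxf⟩ := Set.not_subset.1 hcon
    obtain ⟨V, hV, hxV, hVU, hd⟩ := hρ.exists_disjoint_image hx
      isClosed_closure.isOpen_compl hxf
    obtain ⟨g, hg, -, hgx, hgb⟩ := hρ.exists_mem hV hxV
    have h₁ := h g (hρ.algDisj_of_disjoint (Set.disjoint_left.2 fun z hz hz' =>
      hVU (hg hz') (subset_closure hz)))
    have h₂ : ρ (k * g ^ 12) x = ρ (g ^ 12 * k) x := by rw [h₁]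
    rw [map_mul, map_mul, Equiv.Perm.mul_apply, Equiv.Perm.mul_apply] at h₂
    have h₃ : ρ (g ^ 12) (ρ k x) = ρ k x := by
      rw [map_pow]
      exact Function.IsFixedPt.perm_pow (fixed_of_psupp_subset hg fun h' =>
        Set.disjoint_left.1 hd h' ⟨x, hxV, rfl⟩) 12
    rw [h₃] at h₂
    exact hρ.pow_ne_one hgb hgx (by norm_num) ((ρ k).injective h₂)
  · intro h g hg
    refine hρ.commute_of_disjoint ?_
    have h₁ := (disjoint_pvar_iff (hρ.mono f) (hρ.isOpen_psupp _)).2 (hρ.disjoint_of_algDisj hg)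
    exact h₁.mono_left ((hρ.psupp_subset k).trans h)

theorem LocAct.dj_iff {f g : G} : Dj f g ↔ Disjoint (pvar (ρ f)) (pvar (ρ g)) := by
  constructor
  · intro h
    rw [Set.disjoint_iff_inter_eq_empty]
    by_contra hne
    obtain ⟨x, hx⟩ := Set.nonempty_iff_ne_empty.2 hne
    obtain ⟨k, -, hk, hkx, -⟩ := hρ.exists_mem ((isOpen_pvar _).inter (isOpen_pvar _)) hx
    exact hρ.ne_one_of_mem hkx (h k (hρ.algSub_iff.2 (hk.trans Set.inter_subset_left))
      (hρ.algSub_iff.2 (hk.trans Set.inter_subset_right)))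
  · intro h k h₁ h₂
    refine hρ.eq_one_of_pvar ?_
    exact Set.subset_empty_iff.1 fun x hx =>
      Set.disjoint_left.1 h (hρ.algSub_iff.1 h₁ hx) (hρ.algSub_iff.1 h₂ hx)

theorem LocAct.pvar_conj (h g : G) : pvar (ρ (h * g * h⁻¹)) = ρ h '' pvar (ρ g) := by
  rw [map_mul, map_mul, map_inv, (hρ.mono h).pvar_conj]

end Semantics

/-! ### Recovering boundedness and orientation -/

section OrientationSemantics
variable {X : Type*} [LinearOrder X] [TopologicalSpace X]

theorem Eo.symm {x₁ x₂ x₃ y₁ y₂ y₃ : X} (h : Eo x₁ x₂ x₃ y₁ y₂ y₃) : Eo y₁ y₂ y₃ x₁ x₂ x₃ := by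
  unfold Eo at *; tauto

theorem Eo.swap {x₁ x₂ x₃ y₁ y₂ y₃ : X} (h : Eo x₁ x₂ x₃ y₁ y₂ y₃) : Eo x₃ x₂ x₁ y₃ y₂ y₁ := by
  unfold Eo at *; tauto

theorem Eo.eq_left {x₁ x₂ x₃ y₁ y₂ y₃ : X} (h : Eo x₁ x₂ x₃ y₁ y₂ y₃) (hx : Cr x₁ x₂ x₃) :
    Cr y₁ y₂ y₃ := by
  rcases h with h | h
  · exact h.2
  · exact absurd h.1 hx.not_rev

theorem Eo.eq_right {x₁ x₂ x₃ y₁ y₂ y₃ : X} (h : Eo x₁ x₂ x₃ y₁ y₂ y₃) (hy : Cr y₁ y₂ y₃) :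
    Cr x₁ x₂ x₃ := h.symm.eq_left hy

theorem Eo.ne {x₁ x₂ x₃ y₁ y₂ y₃ : X} (h : Eo x₁ x₂ x₃ y₁ y₂ y₃) :
    x₁ ≠ x₂ ∧ x₂ ≠ x₃ ∧ x₁ ≠ x₃ := by
  rcases h with h | h
  · exact ⟨h.1.ne₁₂, h.1.ne₂₃, h.1.ne₁₃⟩
  · exact ⟨h.1.ne₂₃.symm, h.1.ne₁₂.symm, h.1.ne₁₃.symm⟩

theorem eo_or_eo {x₁ x₂ x₃ y₁ y₂ y₃ : X} (hx : x₁ ≠ x₂ ∧ x₂ ≠ x₃ ∧ x₁ ≠ x₃)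
    (hy : y₁ ≠ y₂ ∧ y₂ ≠ y₃ ∧ y₁ ≠ y₃) : Eo x₁ x₂ x₃ y₁ y₂ y₃ ∨ Eo x₁ x₂ x₃ y₂ y₁ y₃ := by
  unfold Eo
  grind [Cr]

variable [CircTop X]

theorem exists_mem_ne {U : Set X} (hU : IsOpen U) (hne : U.Nonempty) (x : X) : ∃ y ∈ U, y ≠ x := by
  obtain ⟨y, hy⟩ := hne
  by_cases h : y = x
  · exact h ▸ exists_ne_mem hU hy
  · exact ⟨y, hy, h⟩

/-- If the triple is degenerate, both orientations occur in each of its neighbourhoods. -/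
theorem exists_cr_of_mem_inter {U V W : Set X} (hU : IsOpen U) (hV : IsOpen V) (hW : IsOpen W)
    {x : X} (hxU : x ∈ U) (hxV : x ∈ V) (hne : W.Nonempty) :
    (∃ a ∈ U, ∃ b ∈ V, ∃ c ∈ W, Cr a b c) ∧ ∃ a ∈ U, ∃ b ∈ V, ∃ c ∈ W, Cr c b a := by
  obtain ⟨z, hz, hzx⟩ := exists_mem_ne hW hne x
  obtain ⟨p, q, hpq, hs⟩ := exists_arc_subset ((hU.inter hV).inter (isOpen_ne' z))
    ⟨⟨hxU, hxV⟩, hzx.symm⟩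
  obtain ⟨a, ha⟩ := dense hpq.ne₁₂
  have h₁ : Cr p a q := by grind [Cr]
  have h₂ := hs h₁
  have h₃ : ¬ Cr p z q := fun h => (hs h).2 rfl
  have h₄ : Cr a x z := by clear hs; grind [Cr]
  exact ⟨⟨a, h₂.1.1, x, hxV, z, hz, h₄⟩, x, hxU, a, h₂.1.2, z, hz, by grind [Cr]⟩

theorem exists_distinct {U V W : Set X} (hV : IsOpen V) (hW : IsOpen W)
    (hUne : U.Nonempty) (hVne : V.Nonempty) (hWne : W.Nonempty) :
    ∃ a ∈ U, ∃ b ∈ V, ∃ c ∈ W, a ≠ b ∧ b ≠ c ∧ a ≠ c := by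
  obtain ⟨a, ha⟩ := hUne
  obtain ⟨b, hb, hab⟩ := exists_mem_ne hV hVne a
  obtain ⟨c, hc, hac⟩ := exists_mem_ne hW hWne a
  obtain ⟨c, hc, hbc⟩ := exists_mem_ne (hW.inter (isOpen_ne' a)) ⟨c, hc, hac⟩ b
  exact ⟨a, ha, b, hb, c, hc.1, hab.symm, hbc.symm, hc.2.symm⟩

/-- Both orientations occur near a degenerate triple. -/
theorem exists_both {U V W : Set X} (hU : IsOpen U) (hV : IsOpen V) (hW : IsOpen W)
    {x y z : X} (hx : x ∈ U) (hy : y ∈ V) (hz : z ∈ W) (h : ¬ (x ≠ y ∧ y ≠ z ∧ x ≠ z)) :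
    (∃ a ∈ U, ∃ b ∈ V, ∃ c ∈ W, Cr a b c) ∧ ∃ a ∈ U, ∃ b ∈ V, ∃ c ∈ W, Cr c b a := by
  by_cases h₁ : x = y
  · subst h₁
    exact exists_cr_of_mem_inter hU hV hW hx hy ⟨z, hz⟩
  by_cases h₂ : y = z
  · subst h₂
    obtain ⟨⟨a, ha, b, hb, c, hc, h⟩, a', ha', b', hb', c', hc', h'⟩ :=
      exists_cr_of_mem_inter hV hW hU hy hz ⟨x, hx⟩
    exact ⟨⟨c, hc, a, ha, b, hb, by grind [Cr]⟩, c', hc', a', ha', b', hb', by grind [Cr]⟩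
  · have h₃ : x = z := by tauto
    subst h₃
    obtain ⟨⟨a, ha, b, hb, c, hc, h⟩, a', ha', b', hb', c', hc', h'⟩ :=
      exists_cr_of_mem_inter hW hU hV hz hx ⟨y, hy⟩
    exact ⟨⟨b, hb, c, hc, a, ha, by grind [Cr]⟩, b', hb', c', hc', a', ha', by grind [Cr]⟩

variable {G : Type*} [Group G] {ρ : G →* Equiv.Perm X} (hρ : LocAct ρ)
include hρ

/-- A nonidentity element with disjoint var leaves an arc free of the support, and the support then
lies in the complementary arc. Conversely, the complementary arc of a bounded support supports
nonidentity elements. -/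
theorem LocAct.algBdd_iff {b : G} : AlgBdd b ↔ PBdd (ρ b) := by
  constructor
  · rintro ⟨z, hz, hd⟩
    obtain ⟨x, hx⟩ := hρ.pvar_nonempty hz
    obtain ⟨p, q, h, hs⟩ := exists_closed_arc_subset (isOpen_pvar _) hx
    refine ⟨q, p, h.ne₁₃.symm, fun y hy => ?_⟩
    have h₁ : ¬ (y = p ∨ y = q ∨ Cr p y q) := fun h' =>
      Set.disjoint_left.1 (hρ.dj_iff.1 hd) (hs y h') (hρ.psupp_subset b hy)
    have := h.ne₁₃
    clear hs hd h
    simp only [mem_arc]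
    grind [Cr]
  · rintro ⟨p, q, h, hs⟩
    obtain ⟨x, hx⟩ := dense h.symm
    obtain ⟨z, hz, -, hzx, -⟩ := hρ.exists_mem (isOpen_arc q p) hx
    refine ⟨z, hρ.ne_one_of_mem hzx, hρ.dj_iff.2 ?_⟩
    rw [disjoint_pvar_iff (hρ.mono z) (isOpen_pvar _), disjoint_comm,
      disjoint_pvar_iff (hρ.mono b) (hρ.isOpen_psupp z)]
    refine Set.disjoint_left.2 fun y h₁ h₂ => ?_
    have h₃ := hs h₁
    have h₄ := hz h₂
    simp only [mem_arc] at h₃ h₄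
    grind [Cr]

theorem LocAct.preservesCr_mul₃ {b₁ b₂ b₃ : G} (h₁ : PBdd (ρ b₁)) (h₂ : PBdd (ρ b₂))
    (h₃ : PBdd (ρ b₃)) : PreservesCr (ρ (b₃ * b₂ * b₁)) := by
  intro x y z
  rw [map_mul, map_mul]
  exact (hρ.preservesCr h₁ _ _ _).trans ((hρ.preservesCr h₂ _ _ _).trans
    (hρ.preservesCr h₃ _ _ _))

/-- Products of bounded elements preserve orientation, and by `LocAct.exists_move_triple` three
factors suffice to approximate any triple of the same orientation. -/
theorem LocAct.meet_iff {c₁ c₂ c₃ d₁ d₂ d₃ : G} : Meet c₁ c₂ c₃ d₁ d₂ d₃ ↔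
    ∃ x₁ ∈ pvar (ρ c₁), ∃ x₂ ∈ pvar (ρ c₂), ∃ x₃ ∈ pvar (ρ c₃), ∃ y₁ ∈ pvar (ρ d₁),
      ∃ y₂ ∈ pvar (ρ d₂), ∃ y₃ ∈ pvar (ρ d₃), Eo x₁ x₂ x₃ y₁ y₂ y₃ := by
  constructor
  · rintro ⟨b₁, b₂, b₃, h₁, h₂, h₃, m₁, m₂, m₃⟩
    have hp := hρ.preservesCr_mul₃ (hρ.algBdd_iff.1 h₁) (hρ.algBdd_iff.1 h₂) (hρ.algBdd_iff.1 h₃)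
    generalize b₃ * b₂ * b₁ = b at *
    have hop : ∀ c d, IsOpen (pvar (ρ (b * c * b⁻¹)) ∩ pvar (ρ d)) := fun c d =>
      (isOpen_pvar _).inter (isOpen_pvar _)
    -- The intersections are nonempty and open in a circle without isolated points, so distinct
    -- points can be picked from them. Only nondegenerate triples have an orientation.
    obtain ⟨y₁, hy₁, y₂, hy₂, y₃, hy₃, hne⟩ := exists_distinct (hop _ _) (hop _ _)
      (Set.not_disjoint_iff_nonempty_inter.1 fun h => m₁ (hρ.dj_iff.2 h))
      (Set.not_disjoint_iff_nonempty_inter.1 fun h => m₂ (hρ.dj_iff.2 h))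
      (Set.not_disjoint_iff_nonempty_inter.1 fun h => m₃ (hρ.dj_iff.2 h))
    simp only [hρ.pvar_conj] at hy₁ hy₂ hy₃
    obtain ⟨⟨x₁, hx₁, rfl⟩, hy₁⟩ := hy₁
    obtain ⟨⟨x₂, hx₂, rfl⟩, hy₂⟩ := hy₂
    obtain ⟨⟨x₃, hx₃, rfl⟩, hy₃⟩ := hy₃
    refine ⟨x₁, hx₁, x₂, hx₂, x₃, hx₃, _, hy₁, _, hy₂, _, hy₃, ?_⟩
    rcases cr_or_rev hne.1 hne.2.1 hne.2.2 with h | h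
    · exact Or.inl ⟨(hp _ _ _).2 h, h⟩
    · exact Or.inr ⟨(hp _ _ _).2 h, h⟩
  · rintro ⟨x₁, hx₁, x₂, hx₂, x₃, hx₃, y₁, hy₁, y₂, hy₂, y₃, hy₃, h⟩
    have key : ∃ b₁ b₂ b₃, PBdd (ρ b₁) ∧ PBdd (ρ b₂) ∧ PBdd (ρ b₃) ∧
        ρ (b₃ * b₂ * b₁) x₁ ∈ pvar (ρ d₁) ∧ ρ (b₃ * b₂ * b₁) x₂ ∈ pvar (ρ d₂) ∧
        ρ (b₃ * b₂ * b₁) x₃ ∈ pvar (ρ d₃) := by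
      rcases h with ⟨hx, hy⟩ | ⟨hx, hy⟩
      · exact hρ.exists_move_triple hx hy (isOpen_pvar _) (isOpen_pvar _) (isOpen_pvar _) hy₁ hy₂ hy₃
      · obtain ⟨b₁, b₂, b₃, h₁, h₂, h₃, m₁, m₂, m₃⟩ := hρ.exists_move_triple hx hy (isOpen_pvar _)
          (isOpen_pvar _) (isOpen_pvar _) hy₃ hy₂ hy₁
        exact ⟨b₁, b₂, b₃, h₁, h₂, h₃, m₃, m₂, m₁⟩
    obtain ⟨b₁, b₂, b₃, h₁, h₂, h₃, m₁, m₂, m₃⟩ := key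
    refine ⟨b₁, b₂, b₃, hρ.algBdd_iff.2 h₁, hρ.algBdd_iff.2 h₂, hρ.algBdd_iff.2 h₃, ?_, ?_, ?_⟩
    · rw [hρ.dj_iff, hρ.pvar_conj]
      exact fun h => Set.disjoint_left.1 h ⟨x₁, hx₁, rfl⟩ m₁
    · rw [hρ.dj_iff, hρ.pvar_conj]
      exact fun h => Set.disjoint_left.1 h ⟨x₂, hx₂, rfl⟩ m₂
    · rw [hρ.dj_iff, hρ.pvar_conj]
      exact fun h => Set.disjoint_left.1 h ⟨x₃, hx₃, rfl⟩ m₃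

theorem LocAct.ne_one_iff {g : G} : ¬ g = 1 ↔ (pvar (ρ g)).Nonempty :=
  ⟨hρ.pvar_nonempty, fun ⟨x, hx⟩ e => by
    rw [e, map_one, pvar, psupp_one, closure_empty, interior_empty] at hx; exact hx⟩

/-- The failure of `Meet` for the transposed triple excludes oppositely oriented choices. A
degenerate choice is excluded as well, since it can be perturbed within the open sets to either
orientation. -/
theorem LocAct.eoA_iff {c₁ c₂ c₃ d₁ d₂ d₃ : G} : EoA c₁ c₂ c₃ d₁ d₂ d₃ ↔
    ¬ c₁ = 1 ∧ ¬ c₂ = 1 ∧ ¬ c₃ = 1 ∧ ¬ d₁ = 1 ∧ ¬ d₂ = 1 ∧ ¬ d₃ = 1 ∧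
    ∀ x₁ ∈ pvar (ρ c₁), ∀ x₂ ∈ pvar (ρ c₂), ∀ x₃ ∈ pvar (ρ c₃), ∀ y₁ ∈ pvar (ρ d₁),
      ∀ y₂ ∈ pvar (ρ d₂), ∀ y₃ ∈ pvar (ρ d₃), Eo x₁ x₂ x₃ y₁ y₂ y₃ := by
  unfold EoA
  rw [hρ.meet_iff]
  simp only [hρ.ne_one_iff]
  refine and_congr_right fun n₁ => and_congr_right fun n₂ => and_congr_right fun n₃ =>
    and_congr_right fun n₄ => and_congr_right fun n₅ => and_congr_right fun n₆ => ?_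
  have ho : ∀ g, IsOpen (pvar (ρ g)) := fun g => isOpen_pvar _
  constructor
  · intro h x₁ hx₁ x₂ hx₂ x₃ hx₃ y₁ hy₁ y₂ hy₂ y₃ hy₃
    push Not at h
    by_cases hx : x₁ ≠ x₂ ∧ x₂ ≠ x₃ ∧ x₁ ≠ x₃
    · by_cases hy : y₁ ≠ y₂ ∧ y₂ ≠ y₃ ∧ y₁ ≠ y₃
      · exact (eo_or_eo hx hy).resolve_right (h _ hx₁ _ hx₂ _ hx₃ _ hy₂ _ hy₁ _ hy₃)
      · exfalso
        obtain ⟨⟨a, ha, b, hb, c, hc, h'⟩, a', ha', b', hb', c', hc', h''⟩ :=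
          exists_both (ho _) (ho _) (ho _) hy₁ hy₂ hy₃ hy
        rcases cr_or_rev hx.1 hx.2.1 hx.2.2 with hx' | hx'
        · exact h _ hx₁ _ hx₂ _ hx₃ _ hb' _ ha' _ hc' (Or.inl ⟨hx', by grind [Cr]⟩)
        · exact h _ hx₁ _ hx₂ _ hx₃ _ hb _ ha _ hc (Or.inr ⟨hx', by grind [Cr]⟩)
    · exfalso
      obtain ⟨⟨a, ha, b, hb, c, hc, h'⟩, a', ha', b', hb', c', hc', h''⟩ :=
        exists_both (ho _) (ho _) (ho _) hx₁ hx₂ hx₃ hx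
      obtain ⟨y₂, hy₂, y₁, hy₁, y₃, hy₃, hy⟩ := exists_distinct (ho d₁) (ho d₃) n₅ n₄ n₆
      rcases cr_or_rev hy.1 hy.2.1 hy.2.2 with hy' | hy'
      · exact h _ ha _ hb _ hc _ hy₂ _ hy₁ _ hy₃ (Or.inl ⟨h', hy'⟩)
      · exact h _ ha' _ hb' _ hc' _ hy₂ _ hy₁ _ hy₃ (Or.inr ⟨h'', hy'⟩)
  · rintro h ⟨x₁, hx₁, x₂, hx₂, x₃, hx₃, y₂, hy₂, y₁, hy₁, y₃, hy₃, h'⟩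
    have h₁ := h _ hx₁ _ hx₂ _ hx₃ _ hy₁ _ hy₂ _ hy₃
    clear h
    unfold Eo at *
    grind [Cr]

/-- Equal orientation is inherited by elements supported close to the points. -/
theorem LocAct.exists_open_eo {x₁ x₂ x₃ y₁ y₂ y₃ : X} (h : Eo x₁ x₂ x₃ y₁ y₂ y₃) :
    ∃ U₁ U₂ U₃ V₁ V₂ V₃ : Set X, (IsOpen U₁ ∧ IsOpen U₂ ∧ IsOpen U₃ ∧ IsOpen V₁ ∧ IsOpen V₂ ∧
      IsOpen V₃) ∧ (x₁ ∈ U₁ ∧ x₂ ∈ U₂ ∧ x₃ ∈ U₃ ∧ y₁ ∈ V₁ ∧ y₂ ∈ V₂ ∧ y₃ ∈ V₃) ∧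
      ∀ c₁ c₂ c₃ d₁ d₂ d₃ : G, ¬ c₁ = 1 → ¬ c₂ = 1 → ¬ c₃ = 1 → ¬ d₁ = 1 → ¬ d₂ = 1 → ¬ d₃ = 1 →
        pvar (ρ c₁) ⊆ U₁ → pvar (ρ c₂) ⊆ U₂ → pvar (ρ c₃) ⊆ U₃ → pvar (ρ d₁) ⊆ V₁ →
        pvar (ρ d₂) ⊆ V₂ → pvar (ρ d₃) ⊆ V₃ → EoA c₁ c₂ c₃ d₁ d₂ d₃ := by
  rcases h with ⟨hx, hy⟩ | ⟨hx, hy⟩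
  · obtain ⟨U₁, U₂, U₃, hU₁, hU₂, hU₃, hx₁, hx₂, hx₃, hU⟩ := exists_open_cr hx
    obtain ⟨V₁, V₂, V₃, hV₁, hV₂, hV₃, hy₁, hy₂, hy₃, hV⟩ := exists_open_cr hy
    refine ⟨U₁, U₂, U₃, V₁, V₂, V₃, ⟨hU₁, hU₂, hU₃, hV₁, hV₂, hV₃⟩,
      ⟨hx₁, hx₂, hx₃, hy₁, hy₂, hy₃⟩, fun c₁ c₂ c₃ d₁ d₂ d₃ n₁ n₂ n₃ n₄ n₅ n₆ s₁ s₂ s₃ t₁ t₂ t₃ =>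
      hρ.eoA_iff.2 ⟨n₁, n₂, n₃, n₄, n₅, n₆, fun _ a₁ _ a₂ _ a₃ _ b₁ _ b₂ _ b₃ => Or.inl
        ⟨hU _ (s₁ a₁) _ (s₂ a₂) _ (s₃ a₃), hV _ (t₁ b₁) _ (t₂ b₂) _ (t₃ b₃)⟩⟩⟩
  · obtain ⟨U₁, U₂, U₃, hU₁, hU₂, hU₃, hx₁, hx₂, hx₃, hU⟩ := exists_open_cr hx
    obtain ⟨V₁, V₂, V₃, hV₁, hV₂, hV₃, hy₁, hy₂, hy₃, hV⟩ := exists_open_cr hy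
    refine ⟨U₃, U₂, U₁, V₃, V₂, V₁, ⟨hU₃, hU₂, hU₁, hV₃, hV₂, hV₁⟩,
      ⟨hx₃, hx₂, hx₁, hy₃, hy₂, hy₁⟩, fun c₁ c₂ c₃ d₁ d₂ d₃ n₁ n₂ n₃ n₄ n₅ n₆ s₁ s₂ s₃ t₁ t₂ t₃ =>
      hρ.eoA_iff.2 ⟨n₁, n₂, n₃, n₄, n₅, n₆, fun _ a₁ _ a₂ _ a₃ _ b₁ _ b₂ _ b₃ => Or.inr
        ⟨hU _ (s₃ a₃) _ (s₂ a₂) _ (s₁ a₁), hV _ (t₃ b₃) _ (t₂ b₂) _ (t₁ b₁)⟩⟩⟩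

/-- At a common limit point, a small arc around it, avoiding a point of var u and a point of var v,
would contain points of var c and of var d. The triples through these two witnesses would then have
opposite orientations. -/
theorem LocAct.disjoint_of_apart {c d : G} (h : Apart c d) :
    Disjoint (closure (pvar (ρ c))) (closure (pvar (ρ d))) := by
  obtain ⟨u, v, huv⟩ := h
  obtain ⟨n₁, n₂, n₃, -, n₅, -, h⟩ := hρ.eoA_iff.1 huv
  refine Set.disjoint_left.2 fun x hc hd => ?_
  obtain ⟨p, hp, hpx⟩ := exists_mem_ne (isOpen_pvar _) (hρ.pvar_nonempty n₂) x
  obtain ⟨q, hq, hqx⟩ := exists_mem_ne (isOpen_pvar _) (hρ.pvar_nonempty n₅) x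
  obtain ⟨s, t, hst, hs⟩ := exists_arc_subset ((isOpen_ne' p).inter (isOpen_ne' q))
    ⟨hpx.symm, hqx.symm⟩
  obtain ⟨a, ha, hac⟩ := mem_closure_iff.1 hc _ (isOpen_arc s t) hst
  obtain ⟨b, hb, hbd⟩ := mem_closure_iff.1 hd _ (isOpen_arc s t) hst
  have h₁ : ¬ Cr s p t := fun h => (hs h).1 rfl
  have h₂ : ¬ Cr s q t := fun h => (hs h).2 rfl
  have h₃ := h a hac p hp b hbd b hbd q hq a hac
  clear h hs huv
  simp only [mem_arc, Eo] at *
  grind [Cr]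

/-- The separating witnesses are elements with small supports, one in each of the two arcs between
`x` and `y`. -/
theorem LocAct.exists_open_apart {x y : X} (h : x ≠ y) : ∃ U V : Set X, IsOpen U ∧ IsOpen V ∧
    x ∈ U ∧ y ∈ V ∧ ∀ c d : G, ¬ c = 1 → ¬ d = 1 → pvar (ρ c) ⊆ U → pvar (ρ d) ⊆ V →
      Apart c d := by
  obtain ⟨p, hp⟩ := dense h
  obtain ⟨q, hq⟩ := dense h.symm
  obtain ⟨U₁, U₂, U₃, V₁, V₂, V₃, ⟨o₁, o₂, o₃, o₄, o₅, o₆⟩, ⟨m₁, m₂, m₃, m₄, m₅, m₆⟩, hs⟩ :=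
    hρ.exists_open_eo (Or.inl ⟨hp, hq⟩)
  obtain ⟨u, -, hu, hpu, -⟩ := hρ.exists_mem o₂ m₂
  obtain ⟨v, -, hv, hqv, -⟩ := hρ.exists_mem o₅ m₅
  refine ⟨U₁ ∩ V₃, U₃ ∩ V₁, o₁.inter o₆, o₃.inter o₄, ⟨m₁, m₆⟩, ⟨m₃, m₄⟩,
    fun c d hc hd hcU hdV => ⟨u, v, ?_⟩⟩
  exact hs _ _ _ _ _ _ hc (hρ.ne_one_of_mem hpu) hd hd (hρ.ne_one_of_mem hqv) hc
    (hcU.trans Set.inter_subset_left) hu (hdV.trans Set.inter_subset_left)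
    (hdV.trans Set.inter_subset_right) hv (hcU.trans Set.inter_subset_right)

end OrientationSemantics

/-! ### Families of group elements as codes of points -/

section PointCodes
variable {G : Type*} [Group G]

/-- The elements of the families have, pairwise separated, the same orientation. -/
def CodeEo (R₁ R₂ R₃ S₁ S₂ S₃ : Set G) : Prop :=
  ∃ g₁ g₂ g₃ h₁ h₂ h₃, g₁ ∈ R₁ ∧ g₂ ∈ R₂ ∧ g₃ ∈ R₃ ∧ h₁ ∈ S₁ ∧ h₂ ∈ S₂ ∧ h₃ ∈ S₃ ∧
    EoA g₁ g₂ g₃ h₁ h₂ h₃ ∧ Apart g₁ g₂ ∧ Apart g₂ g₃ ∧ Apart g₁ g₃ ∧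
    Apart h₁ h₂ ∧ Apart h₂ h₃ ∧ Apart h₁ h₃

/-- The element `h` carries the point coded by `R` to the point coded by `S`. -/
def CodeAp (h : G) (R S : Set G) : Prop :=
  ¬ ∃ g g', g ∈ R ∧ g' ∈ S ∧ Apart (h * g * h⁻¹) g'

/-- The families that code a point by arbitrarily small neighbourhoods. -/
def ValidSet (S : Set G) : Prop :=
  (∃ g, g ∈ S) ∧ ¬ 1 ∈ S ∧
  (∀ g g', g ∈ S → g' ∈ S → ∃ k, k ∈ S ∧ AlgSub k g ∧ AlgSub k g') ∧
  ∀ e e', Apart e e' → ∃ g, g ∈ S ∧ (Dj g e ∨ Dj g e')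

/-- The element `k` lies between `g` and `c`. -/
def EndBtw (g e c k : G) : Prop := EoA k c e c e g ∧ EoA g k c c e g

/-- The triple codes the end next to `c` of the component of the complement of `g` that contains
`c` and `e`. -/
def EndCode (g e c : G) : Prop := EoA c e g c e g ∧ ∃ k, EndBtw g e c k

/-- The element `d` contains a one-sided neighbourhood of the coded end. -/
def EndMem (g e c d : G) : Prop :=
  ∃ n k, EndBtw g e c n ∧ EndBtw g e c k ∧ EoA k n c c e g ∧
    ∀ k', EndBtw g e c k' → EoA k' n c c e g → AlgSub k' d

end PointCodes

/-! ### Meaning of the codes; codes of arbitrary points by sets -/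

section CodeSemantics
variable {X : Type*} [LinearOrder X] [TopologicalSpace X] {G : Type*} [Group G]

/-- The family `R` converges to `x`. -/
def Conv (ρ : G →* Equiv.Perm X) (R : Set G) (x : X) : Prop :=
  (∀ g ∈ R, x ∈ closure (pvar (ρ g))) ∧ ∀ V, IsOpen V → x ∈ V → ∃ g ∈ R, pvar (ρ g) ⊆ V

variable [CircTop X] {ρ : G →* Equiv.Perm X} (hρ : LocAct ρ)
include hρ

theorem LocAct.ne_one_of_mem_closure {g : G} {x : X} (h : x ∈ closure (pvar (ρ g))) : ¬ g = 1 := by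
  rw [hρ.ne_one_iff]
  exact closure_nonempty_iff.1 ⟨x, h⟩

/-- Distinct limits have members of the two families that are `Apart`. If the limits coincide, the
closures of the sets var of any two members share a point, and no such members exist. -/
theorem LocAct.codeAp_iff {h : G} {R S : Set G} {x y : X} (hR : Conv ρ R x) (hS : Conv ρ S y) :
    CodeAp h R S ↔ ρ h x = y := by
  have hc : ∀ g ∈ R, ρ h x ∈ closure (pvar (ρ (h * g * h⁻¹))) := by
    intro g hg
    rw [hρ.pvar_conj]
    exact image_closure_subset_closure_image (hρ.mono h).continuous ⟨x, hR.1 g hg, rfl⟩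
  constructor
  · intro H
    by_contra hne
    obtain ⟨U, V, hU, hV, hxU, hyV, hUV⟩ := hρ.exists_open_apart hne
    obtain ⟨g, hg, hgU⟩ := hR.2 _ (hU.preimage (hρ.mono h).continuous) hxU
    obtain ⟨g', hg', hgV⟩ := hS.2 _ hV hyV
    refine H ⟨g, g', hg, hg', hUV _ _ (hρ.ne_one_of_mem_closure (hc g hg))
      (hρ.ne_one_of_mem_closure (hS.1 g' hg')) ?_ hgV⟩
    rw [hρ.pvar_conj]
    exact Set.image_subset_iff.2 hgU
  · rintro rfl ⟨g, g', hg, hg', ha⟩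
    exact Set.disjoint_left.1 (hρ.disjoint_of_apart ha) (hc g hg) (hS.1 g' hg')

/-- The `Apart` clauses force the limits to be distinct, because the limits are only known to lie in
closures. If their orientation were the wrong one, elements close to the limits and below the given
members would have both equal and opposite orientation. -/
theorem LocAct.codeEo_iff {R₁ R₂ R₃ S₁ S₂ S₃ : Set G} {x₁ x₂ x₃ y₁ y₂ y₃ : X}
    (hx₁ : Conv ρ R₁ x₁) (hx₂ : Conv ρ R₂ x₂) (hx₃ : Conv ρ R₃ x₃) (hy₁ : Conv ρ S₁ y₁)
    (hy₂ : Conv ρ S₂ y₂) (hy₃ : Conv ρ S₃ y₃) :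
    CodeEo R₁ R₂ R₃ S₁ S₂ S₃ ↔ Eo x₁ x₂ x₃ y₁ y₂ y₃ := by
  constructor
  · rintro ⟨g₁, g₂, g₃, h₁, h₂, h₃, m₁, m₂, m₃, n₁, n₂, n₃, H, a₁₂, a₂₃, a₁₃, b₁₂, b₂₃, b₁₃⟩
    have key : ∀ {x y : X} {g g' : G}, Apart g g' → x ∈ closure (pvar (ρ g)) →
        y ∈ closure (pvar (ρ g')) → x ≠ y := fun ha hx hy e =>
      Set.disjoint_left.1 (hρ.disjoint_of_apart ha) hx (e ▸ hy)
    have c₁ := hx₁.1 _ m₁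
    have c₂ := hx₂.1 _ m₂
    have c₃ := hx₃.1 _ m₃
    have d₁ := hy₁.1 _ n₁
    have d₂ := hy₂.1 _ n₂
    have d₃ := hy₃.1 _ n₃
    refine (eo_or_eo ⟨key a₁₂ c₁ c₂, key a₂₃ c₂ c₃, key a₁₃ c₁ c₃⟩
      ⟨key b₁₂ d₁ d₂, key b₂₃ d₂ d₃, key b₁₃ d₁ d₃⟩).resolve_right fun hE => ?_
    obtain ⟨U₁, U₂, U₃, V₂, V₁, V₃, ⟨o₁, o₂, o₃, o₅, o₄, o₆⟩, ⟨p₁, p₂, p₃, p₅, p₄, p₆⟩, hs⟩ :=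
      hρ.exists_open_eo hE
    have small : ∀ {x : X} {g : G} {U : Set X}, x ∈ closure (pvar (ρ g)) → IsOpen U → x ∈ U →
        ∃ k y, ¬ k = 1 ∧ pvar (ρ k) ⊆ U ∧ pvar (ρ k) ⊆ pvar (ρ g) ∧ y ∈ pvar (ρ k) := by
      intro x g U hx hU hxU
      obtain ⟨y, hyU, hyg⟩ := mem_closure_iff.1 hx U hU hxU
      obtain ⟨k, -, hk, hky, -⟩ := hρ.exists_mem (hU.inter (isOpen_pvar _)) ⟨hyU, hyg⟩
      exact ⟨k, y, hρ.ne_one_of_mem hky, hk.trans Set.inter_subset_left,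
        hk.trans Set.inter_subset_right, hρ.psupp_subset k hky⟩
    obtain ⟨k₁, u₁, e₁, s₁, t₁, f₁⟩ := small c₁ o₁ p₁
    obtain ⟨k₂, u₂, e₂, s₂, t₂, f₂⟩ := small c₂ o₂ p₂
    obtain ⟨k₃, u₃, e₃, s₃, t₃, f₃⟩ := small c₃ o₃ p₃
    obtain ⟨k₄, u₄, e₄, s₄, t₄, f₄⟩ := small d₁ o₄ p₄
    obtain ⟨k₅, u₅, e₅, s₅, t₅, f₅⟩ := small d₂ o₅ p₅
    obtain ⟨k₆, u₆, e₆, s₆, t₆, f₆⟩ := small d₃ o₆ p₆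
    obtain ⟨-, -, -, -, -, -, H₁⟩ := hρ.eoA_iff.1 H
    obtain ⟨-, -, -, -, -, -, H₂⟩ := hρ.eoA_iff.1
      (hs k₁ k₂ k₃ k₅ k₄ k₆ e₁ e₂ e₃ e₅ e₄ e₆ s₁ s₂ s₃ s₅ s₄ s₆)
    have r₁ := H₁ _ (t₁ f₁) _ (t₂ f₂) _ (t₃ f₃) _ (t₄ f₄) _ (t₅ f₅) _ (t₆ f₆)
    have r₂ := H₂ _ f₁ _ f₂ _ f₃ _ f₅ _ f₄ _ f₆
    clear * - r₁ r₂
    unfold Eo at *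
    grind [Cr]
  · intro hE
    obtain ⟨U₁, U₂, U₃, V₁, V₂, V₃, ⟨o₁, o₂, o₃, o₄, o₅, o₆⟩, ⟨p₁, p₂, p₃, p₄, p₅, p₆⟩, hs⟩ :=
      hρ.exists_open_eo hE
    obtain ⟨n₁₂, n₂₃, n₁₃⟩ := hE.ne
    obtain ⟨n₄₅, n₅₆, n₄₆⟩ := hE.symm.ne
    obtain ⟨A₁, A₂, oa₁, oa₂, ma₁, ma₂, hA⟩ := hρ.exists_open_apart n₁₂
    obtain ⟨B₂, B₃, ob₂, ob₃, mb₂, mb₃, hB⟩ := hρ.exists_open_apart n₂₃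
    obtain ⟨C₁, C₃, oc₁, oc₃, mc₁, mc₃, hC⟩ := hρ.exists_open_apart n₁₃
    obtain ⟨D₁, D₂, od₁, od₂, md₁, md₂, hD⟩ := hρ.exists_open_apart n₄₅
    obtain ⟨E₂, E₃, oe₂, oe₃, me₂, me₃, hE'⟩ := hρ.exists_open_apart n₅₆
    obtain ⟨F₁, F₃, of₁, of₃, mf₁, mf₃, hF⟩ := hρ.exists_open_apart n₄₆
    have pick : ∀ {R : Set G} {x : X} {U A B : Set X}, Conv ρ R x → IsOpen U → x ∈ U → IsOpen A →
        x ∈ A → IsOpen B → x ∈ B → ∃ g ∈ R, ¬ g = 1 ∧ pvar (ρ g) ⊆ U ∧ pvar (ρ g) ⊆ A ∧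
          pvar (ρ g) ⊆ B := by
      intro R x U A B hc hU hxU hA hxA hB hxB
      obtain ⟨g, hg, hs⟩ := hc.2 _ ((hU.inter hA).inter hB) ⟨⟨hxU, hxA⟩, hxB⟩
      exact ⟨g, hg, hρ.ne_one_of_mem_closure (hc.1 g hg), fun _ h => (hs h).1.1,
        fun _ h => (hs h).1.2, fun _ h => (hs h).2⟩
    obtain ⟨g₁, i₁, j₁, q₁, r₁, t₁⟩ := pick hx₁ o₁ p₁ oa₁ ma₁ oc₁ mc₁
    obtain ⟨g₂, i₂, j₂, q₂, r₂, t₂⟩ := pick hx₂ o₂ p₂ oa₂ ma₂ ob₂ mb₂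
    obtain ⟨g₃, i₃, j₃, q₃, r₃, t₃⟩ := pick hx₃ o₃ p₃ ob₃ mb₃ oc₃ mc₃
    obtain ⟨h₁, i₄, j₄, q₄, r₄, t₄⟩ := pick hy₁ o₄ p₄ od₁ md₁ of₁ mf₁
    obtain ⟨h₂, i₅, j₅, q₅, r₅, t₅⟩ := pick hy₂ o₅ p₅ od₂ md₂ oe₂ me₂
    obtain ⟨h₃, i₆, j₆, q₆, r₆, t₆⟩ := pick hy₃ o₆ p₆ oe₃ me₃ of₃ mf₃
    exact ⟨g₁, g₂, g₃, h₁, h₂, h₃, i₁, i₂, i₃, i₄, i₅, i₆,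
      hs _ _ _ _ _ _ j₁ j₂ j₃ j₄ j₅ j₆ q₁ q₂ q₃ q₄ q₅ q₆, hA _ _ j₁ j₂ r₁ r₂,
      hB _ _ j₂ j₃ t₂ r₃, hC _ _ j₁ j₃ t₁ t₃, hD _ _ j₄ j₅ r₄ r₅, hE' _ _ j₅ j₆ t₅ r₆,
      hF _ _ j₄ j₆ t₄ t₆⟩

/-- The closures of the sets var(g) are compact and directed, so they have a common point `x`. For
every other point, the clause on `Apart` pairs gives a member missing a neighbourhood of it.
Finitely many of these neighbourhoods cover the complement of a neighbourhood of `x`, and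
directedness merges the corresponding members. -/
theorem LocAct.exists_conv_of_validSet {S : Set G} (hS : ValidSet S) : ∃ x, Conv ρ S x := by
  obtain ⟨⟨g₀, hg₀⟩, h1, hdir, hsm⟩ := hS
  have hne : ∀ g ∈ S, ¬ g = 1 := fun g hg e => h1 (e ▸ hg)
  have : Nonempty S := ⟨⟨g₀, hg₀⟩⟩
  have : CompactSpace X := CircTop.compact
  have hdir' : Directed (· ⊇ ·) fun g : S => closure (pvar (ρ (g : G))) := by
    rintro ⟨g, hg⟩ ⟨g', hg'⟩
    obtain ⟨k, hk, h₁, h₂⟩ := hdir g g' hg hg'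
    exact ⟨⟨k, hk⟩, closure_mono (hρ.algSub_iff.1 h₁), closure_mono (hρ.algSub_iff.1 h₂)⟩
  obtain ⟨x, hx⟩ := IsCompact.nonempty_iInter_of_directed_nonempty_isCompact_isClosed _ hdir'
    (fun g => (hρ.pvar_nonempty (hne g g.2)).closure) (fun g => isClosed_closure.isCompact)
    (fun g => isClosed_closure)
  have hx' : ∀ g ∈ S, x ∈ closure (pvar (ρ g)) := fun g hg => Set.mem_iInter.1 hx ⟨g, hg⟩
  refine ⟨x, hx', fun V hV hxV => ?_⟩
  have hloc : ∀ y ∈ Vᶜ, ∃ W, IsOpen W ∧ y ∈ W ∧ ∃ g ∈ S, Disjoint (pvar (ρ g)) W := by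
    intro y hy
    have hxy : x ≠ y := fun e => hy (e ▸ hxV)
    obtain ⟨U, W, hU, hW, hxU, hyW, h⟩ := hρ.exists_open_apart hxy
    obtain ⟨e, -, he, hex, -⟩ := hρ.exists_mem hU hxU
    obtain ⟨e', -, he', hey, -⟩ := hρ.exists_mem hW hyW
    obtain ⟨g, hg, hd⟩ := hsm e e' (h e e' (hρ.ne_one_of_mem hex) (hρ.ne_one_of_mem hey) he he')
    rw [hρ.dj_iff, hρ.dj_iff] at hd
    -- The chosen member cannot be disjoint from `e`, since `x` is a limit point of its var and lies
    -- in the open set var e. So it is disjoint from `e'`.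
    refine ⟨_, isOpen_pvar (ρ e'), hρ.psupp_subset _ hey, g, hg, hd.resolve_left fun hd => ?_⟩
    exact Set.disjoint_left.1 (hd.closure_left (isOpen_pvar _)) (hx' g hg)
      (hρ.psupp_subset _ hex)
  choose! W hW hyW g hg hd using hloc
  obtain ⟨t, ht, hcov⟩ := hV.isClosed_compl.isCompact.elim_nhds_subcover W
    fun y hy => (hW y hy).mem_nhds (hyW y hy)
  have hfin : ∀ t : Finset X, (∀ y ∈ t, y ∈ Vᶜ) →
      ∃ k ∈ S, ∀ y ∈ t, Disjoint (pvar (ρ k)) (W y) := by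
    classical
    intro t
    induction t using Finset.induction_on with
    | empty => exact fun _ => ⟨g₀, hg₀, by simp⟩
    | insert a t _ ih =>
      intro h
      obtain ⟨k, hk, hkt⟩ := ih fun y hy => h y (Finset.mem_insert_of_mem hy)
      have ha := h a (Finset.mem_insert_self _ _)
      obtain ⟨k', hk', h₁, h₂⟩ := hdir k (g a) hk (hg a ha)
      refine ⟨k', hk', fun y hy => ?_⟩
      rcases Finset.mem_insert.1 hy with rfl | hy
      · exact (hd y ha).mono_left (hρ.algSub_iff.1 h₂)
      · exact (hkt y hy).mono_left (hρ.algSub_iff.1 h₁)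
  obtain ⟨k, hk, hkt⟩ := hfin t ht
  refine ⟨k, hk, fun z hz => by_contra fun hzV => ?_⟩
  obtain ⟨y, hy, hzy⟩ := Set.mem_iUnion₂.1 (hcov hzV)
  exact Set.disjoint_left.1 (hkt y hy) hz hzy

theorem LocAct.conv_pvar (x : X) : Conv ρ {g | x ∈ pvar (ρ g)} x := by
  refine ⟨fun g hg => subset_closure hg, fun V hV hxV => ?_⟩
  obtain ⟨g, -, hg, hgx, -⟩ := hρ.exists_mem hV hxV
  exact ⟨g, hρ.psupp_subset g hgx, hg⟩

theorem LocAct.validSet_pvar (x : X) : ValidSet {g | x ∈ pvar (ρ g)} := by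
  obtain ⟨h₁, h₂⟩ := hρ.conv_pvar x
  refine ⟨?_, fun h => hρ.ne_one_of_mem_closure (h₁ _ h) rfl, fun g g' hg hg' => ?_,
    fun e e' h => ?_⟩
  · obtain ⟨g, hg, -⟩ := h₂ Set.univ isOpen_univ trivial
    exact ⟨g, hg⟩
  · obtain ⟨k, hk, hs⟩ := h₂ _ ((isOpen_pvar (ρ g)).inter (isOpen_pvar (ρ g'))) ⟨hg, hg'⟩
    exact ⟨k, hk, hρ.algSub_iff.2 (hs.trans Set.inter_subset_left),
      hρ.algSub_iff.2 (hs.trans Set.inter_subset_right)⟩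
  · have hd := hρ.disjoint_of_apart h
    by_cases hx : x ∈ closure (pvar (ρ e))
    · obtain ⟨k, hk, hs⟩ := h₂ _ isClosed_closure.isOpen_compl (Set.disjoint_left.1 hd hx)
      exact ⟨k, hk, Or.inr (hρ.dj_iff.2 (Set.disjoint_left.2 fun z hz hz' =>
        hs hz (subset_closure hz')))⟩
    · obtain ⟨k, hk, hs⟩ := h₂ _ isClosed_closure.isOpen_compl hx
      exact ⟨k, hk, Or.inl (hρ.dj_iff.2 (Set.disjoint_left.2 fun z hz hz' =>
        hs hz (subset_closure hz')))⟩

end CodeSemantics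

/-! ### Codes of endpoints by triples of elements -/

section EndSemantics
variable {X : Type*} [LinearOrder X] [TopologicalSpace X]

/-- A component together with one of its limit points is connected. If this point were in the open
set, it would belong to the component, which is open. -/
theorem frontier_connectedComponentIn_subset [LocallyConnectedSpace X] {F : Set X} (hF : IsOpen F)
    {x p : X} (hx : x ∈ F) (hp : p ∈ frontier (connectedComponentIn F x)) : p ∉ F := by
  intro hpF
  have ho : IsOpen (connectedComponentIn F x) := hF.connectedComponentIn
  rw [frontier, ho.interior_eq] at hp
  refine hp.2 ?_
  have h : IsPreconnected (insert p (connectedComponentIn F x)) :=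
    isPreconnected_connectedComponentIn.subset_closure (Set.subset_insert _ _)
      (Set.insert_subset hp.1 subset_closure)
  exact h.subset_connectedComponentIn (Set.mem_insert_of_mem _ (mem_connectedComponentIn hx))
    (Set.insert_subset hpF (connectedComponentIn_subset _ _)) (Set.mem_insert _ _)

variable [CircTop X] {G : Type*} [Group G] {ρ : G →* Equiv.Perm X} (hρ : LocAct ρ)

theorem mem_interior_compl_of_disjoint {U V : Set X} (hU : IsOpen U) (h : Disjoint U V) {x : X}
    (hx : x ∈ U) : x ∈ interior Vᶜ :=
  interior_maximal (Set.disjoint_left.1 h) hU hx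

/-- A component of the complement of a nonempty open set is an arc. -/
theorem exists_component_eq_arc {V : Set X} (hV : IsOpen V) (hne : V.Nonempty) {x : X}
    (hx : x ∈ interior Vᶜ) : ∃ p q, p ≠ q ∧ connectedComponentIn (interior Vᶜ) x = arc p q ∧
      frontier (connectedComponentIn (interior Vᶜ) x) = {p, q} ∧
      (∀ w ∈ V, ¬ Cr p w q) ∧ p ∈ closure V ∧ p ∉ V ∧ q ∈ closure V ∧ q ∉ V := by
  have ho : IsOpen (connectedComponentIn (interior Vᶜ) x) := isOpen_interior.connectedComponentIn
  have hsub : connectedComponentIn (interior Vᶜ) x ⊆ Vᶜ :=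
    (connectedComponentIn_subset _ _).trans interior_subset
  have hd : Disjoint (connectedComponentIn (interior Vᶜ) x) V := Set.disjoint_left.2 hsub
  obtain ⟨p, q, hpq⟩ := eq_arc_of_isPreconnected ho isPreconnected_connectedComponentIn
    ⟨x, mem_connectedComponentIn hx⟩ hV hne hd
  have hne' : p ≠ q := by
    rintro rfl
    obtain ⟨w, hw, hwp⟩ := exists_mem_ne hV hne p
    refine Set.disjoint_left.1 hd (hpq ▸ ?_) hw
    have hx' : x ∈ arc p p := hpq ▸ mem_connectedComponentIn hx
    simp only [mem_arc] at *
    grind [Cr]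
  have hfr : frontier (connectedComponentIn (interior Vᶜ) x) = {p, q} := by
    rw [hpq, frontier_arc hne']
  have key : ∀ r ∈ ({p, q} : Set X), r ∈ closure V ∧ r ∉ V := by
    intro r hr
    rw [← hfr] at hr
    have h := frontier_connectedComponentIn_subset isOpen_interior hx hr
    rw [interior_compl, Set.mem_compl_iff, not_not] at h
    exact ⟨h, closure_minimal hsub hV.isClosed_compl (frontier_subset_closure hr)⟩
  refine ⟨p, q, hne', hpq, hfr, fun w hw h => hsub (hpq ▸ h) hw, ?_, ?_, ?_, ?_⟩
  · exact (key p (by simp)).1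
  · exact (key p (by simp)).2
  · exact (key q (by simp)).1
  · exact (key q (by simp)).2

include hρ

/-- Once `c`, `e`, `g` are positively oriented, comparison with them turns equal orientation into
positive orientation. -/
theorem LocAct.eoA_pos {g e c k₁ k₂ k₃ : G} (h₁ : ¬ c = 1 ∧ ¬ e = 1 ∧ ¬ g = 1)
    (h : ∀ a ∈ pvar (ρ c), ∀ b ∈ pvar (ρ e), ∀ w ∈ pvar (ρ g), Cr a b w) :
    EoA k₁ k₂ k₃ c e g ↔ ¬ k₁ = 1 ∧ ¬ k₂ = 1 ∧ ¬ k₃ = 1 ∧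
      ∀ x₁ ∈ pvar (ρ k₁), ∀ x₂ ∈ pvar (ρ k₂), ∀ x₃ ∈ pvar (ρ k₃), Cr x₁ x₂ x₃ := by
  rw [hρ.eoA_iff]
  constructor
  · rintro ⟨a, b, d, -, -, -, H⟩
    obtain ⟨u, hu⟩ := hρ.pvar_nonempty h₁.1
    obtain ⟨v, hv⟩ := hρ.pvar_nonempty h₁.2.1
    obtain ⟨w, hw⟩ := hρ.pvar_nonempty h₁.2.2
    exact ⟨a, b, d, fun x₁ hx₁ x₂ hx₂ x₃ hx₃ =>
      (H _ hx₁ _ hx₂ _ hx₃ _ hu _ hv _ hw).eq_right (h _ hu _ hv _ hw)⟩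
  · rintro ⟨a, b, d, H⟩
    exact ⟨a, b, d, h₁.1, h₁.2.1, h₁.2.2, fun x₁ hx₁ x₂ hx₂ x₃ hx₃ u hu v hv w hw =>
      Or.inl ⟨H _ hx₁ _ hx₂ _ hx₃, h _ hu _ hv _ hw⟩⟩

/-- The orientation persists in the limit. -/
theorem cr_of_mem_closure {V : Set X} {a b p : X} (hp : p ∈ closure V) (h : ∀ w ∈ V, Cr w a b)
    (ha : a ≠ p) (hb : b ≠ p) : Cr p a b := by
  by_contra hn
  obtain ⟨w, hw⟩ := closure_nonempty_iff.1 ⟨p, hp⟩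
  have hab := (h w hw).ne₂₃
  have hr : Cr p b a := by grind [Cr]
  obtain ⟨U, V₁, V₂, hU, hV₁, hV₂, hpU, hb', ha', hs⟩ := exists_open_cr hr
  obtain ⟨w, hwU, hwV⟩ := mem_closure_iff.1 hp U hU hpU
  have h₁ := hs w hwU b hb' a ha'
  have h₂ := h w hwV
  grind [Cr]

/-- Measured from `p`, the elements between `g` and `c` are those with var in front of var c. The
condition on the existence of one such element guarantees room between `p` and var c. The coded
family consists of the elements that contain everything in front of some such `n`, so its members
accumulate at `p` and can be taken arbitrarily small. -/
theorem LocAct.conv_endMem_of_pos {g e c : G} (h₁ : ¬ c = 1 ∧ ¬ e = 1 ∧ ¬ g = 1)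
    (h : ∀ a ∈ pvar (ρ c), ∀ b ∈ pvar (ρ e), ∀ w ∈ pvar (ρ g), Cr a b w) (hk : ∃ k, EndBtw g e c k)
    {x p : X} (hx : x ∈ pvar (ρ c)) (hp : p ∈ closure (pvar (ρ g)))
    (hpx : ∀ w ∈ pvar (ρ g), Cr p x w) : Conv ρ {d | EndMem g e c d} p := by
  have ho : ∀ k, IsOpen (pvar (ρ k)) := fun k => isOpen_pvar _
  obtain ⟨w₀, hw₀⟩ := hρ.pvar_nonempty h₁.2.2
  obtain ⟨b₀, hb₀⟩ := hρ.pvar_nonempty h₁.2.1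
  have hav : ∀ {k : G}, (∀ a ∈ pvar (ρ k), a ∉ pvar (ρ g)) → ∀ a ∈ pvar (ρ k), a ≠ p := by
    rintro k hk a ha rfl
    obtain ⟨w, hw, hw'⟩ := mem_closure_iff.1 hp _ (ho k) ha
    exact hk w hw hw'
  have hcp : ∀ a ∈ pvar (ρ c), a ≠ p :=
    hav fun a ha hw => (h a ha b₀ hb₀ a hw).ne₁₃ rfl
  have hep : ∀ b ∈ pvar (ρ e), b ≠ p :=
    hav fun b hb hw => (h x hx b hb b hw).ne₂₃ rfl
  have hcep : ∀ a ∈ pvar (ρ c), ∀ b ∈ pvar (ρ e), Cr p a b := fun a ha b hb =>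
    cr_of_mem_closure hρ hp (fun w hw => (h a ha b hb w hw).cyc') (hcp a ha) (hep b hb)
  have hcg : ∀ a ∈ pvar (ρ c), ∀ w ∈ pvar (ρ g), Cr p a w := by
    intro a ha w hw
    have i₁ := hcep a ha b₀ hb₀
    have i₂ := hcep x hx b₀ hb₀
    have i₃ := h a ha b₀ hb₀ w hw
    have i₄ := h x hx b₀ hb₀ w hw
    have i₅ := hpx w hw
    clear * - i₁ i₂ i₃ i₄ i₅
    grind [Cr]
  have hpos := fun {k₁ k₂ k₃ : G} => hρ.eoA_pos (k₁ := k₁) (k₂ := k₂) (k₃ := k₃) h₁ h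
  have hbtw : ∀ k, EndBtw g e c k ↔ ¬ k = 1 ∧
      ∀ z ∈ pvar (ρ k), ∀ a ∈ pvar (ρ c), Cr p z a := by
    intro k
    unfold EndBtw
    rw [hpos, hpos]
    constructor
    · rintro ⟨⟨i₁, -, -, i₂⟩, -, -, -, i₃⟩
      refine ⟨i₁, fun z hz a ha => cr_of_mem_closure hρ hp (fun w hw => i₃ w hw z hz a ha)
        (hav (fun y hy hw => (i₃ y hw y hy x hx).ne₁₂ rfl) z hz) (hcp a ha)⟩
    · rintro ⟨i₁, i₂⟩
      refine ⟨⟨i₁, h₁.1, h₁.2.1, fun z hz a ha b hb => ?_⟩, h₁.2.2, i₁, h₁.1,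
        fun w hw z hz a ha => ?_⟩
      · have j₁ := i₂ z hz a ha
        have j₂ := hcep a ha b hb
        clear * - j₁ j₂
        grind [Cr]
      · have j₁ := i₂ z hz a ha
        have j₂ := hcg a ha w hw
        clear * - j₁ j₂
        grind [Cr]
  obtain ⟨k₀, hk₀⟩ := hk
  obtain ⟨m₀, hm₀⟩ := (hbtw k₀).1 hk₀
  obtain ⟨z₀, hz₀⟩ := hρ.pvar_nonempty m₀
  refine ⟨fun d hd => ?_, fun V hV hpV => ?_⟩
  · obtain ⟨n, k, hn, hk, hkn, hall⟩ := hd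
    obtain ⟨-, -, -, hkn⟩ := hpos.1 hkn
    obtain ⟨mk, hk⟩ := (hbtw k).1 hk
    obtain ⟨z, hz⟩ := hρ.pvar_nonempty mk
    -- An element supported close to `p` on the side of var c qualifies as `k'`, and so its var is
    -- contained in that of `d`.
    refine mem_closure_iff.2 fun O hO hpO => ?_
    obtain ⟨y, hyO, hy⟩ := mem_closure_iff.1 (left_mem_closure_arc (hk z hz x hx).ne₁₂) O hO hpO
    obtain ⟨k', -, hk', hky, -⟩ := hρ.exists_mem (hO.inter (isOpen_arc p z)) ⟨hyO, hy⟩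
    have hz' : ∀ a ∈ pvar (ρ k'), Cr p a z := fun a ha => (hk' ha).2
    refine ⟨y, hyO, hρ.algSub_iff.1 (hall k' ((hbtw k').2 ⟨hρ.ne_one_of_mem hky,
      fun a ha b hb => ?_⟩) (hpos.2 ⟨hρ.ne_one_of_mem hky, ((hbtw n).1 hn).1, h₁.1,
        fun a ha b hb f hf => ?_⟩)) (hρ.psupp_subset _ hky)⟩
    · have j₁ := hz' a ha
      have j₂ := hk z hz b hb
      clear * - j₁ j₂
      grind [Cr]
    · have j₁ := hz' a ha
      have j₂ := hk z hz f hf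
      have j₃ := hkn z hz b hb f hf
      clear * - j₁ j₂ j₃
      grind [Cr]
  -- A small element `d` moving `p` moves a whole arc around `p`. With `n` placed inside this arc,
  -- in front of `z₀` and with room for `k` before it, every `k'` in front of `n` falls into the
  -- arc.
  · obtain ⟨d, -, hd, hpd, -⟩ := hρ.exists_mem hV hpV
    obtain ⟨s, t, hst, hs⟩ := exists_arc_subset (hρ.isOpen_psupp d) hpd
    have hpz := hm₀ z₀ hz₀ x hx
    obtain ⟨m, hm, hm'⟩ : ∃ m, Cr p m t ∧ Cr p m z₀ := by
      by_cases i : Cr p z₀ t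
      · obtain ⟨m, hm⟩ := dense hpz.ne₁₂
        exact ⟨m, by grind [Cr], hm⟩
      · obtain ⟨m, hm⟩ := dense hst.ne₂₃
        have := hpz.ne₁₂
        exact ⟨m, hm, by grind [Cr]⟩
    obtain ⟨u, hu⟩ := dense hm.ne₁₂
    obtain ⟨v, hv⟩ := dense hu.ne₁₂
    obtain ⟨v', hv'⟩ := dense hu.ne₂₃
    obtain ⟨k, -, hk, hkv, -⟩ := hρ.exists_mem (isOpen_arc p u) hv
    obtain ⟨n, -, hn, hnv, -⟩ := hρ.exists_mem (isOpen_arc u m) hv'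
    have bk : EndBtw g e c k := (hbtw k).2 ⟨hρ.ne_one_of_mem hkv, fun z hz a ha => by
      have j₁ : Cr p z u := hk hz
      have j₂ := hm₀ z₀ hz₀ a ha
      clear * - j₁ j₂ hu hm'
      grind [Cr]⟩
    have bn : EndBtw g e c n := (hbtw n).2 ⟨hρ.ne_one_of_mem hnv, fun z hz a ha => by
      have j₁ : Cr u z m := hn hz
      have j₂ := hm₀ z₀ hz₀ a ha
      clear * - j₁ j₂ hu hm'
      grind [Cr]⟩
    refine ⟨d, ⟨n, k, bn, bk, hpos.2 ⟨hρ.ne_one_of_mem hkv, hρ.ne_one_of_mem hnv, h₁.1,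
      fun z hz y hy a ha => ?_⟩, fun k' hk' hk'n => hρ.algSub_iff.2 fun a ha =>
        hρ.psupp_subset d (hs ?_)⟩, hd⟩
    · have j₁ : Cr p z u := hk hz
      have j₂ : Cr u y m := hn hy
      have j₃ := hm₀ z₀ hz₀ a ha
      clear * - j₁ j₂ j₃ hu hm'
      grind [Cr]
    · have j₁ := ((hbtw k').1 hk').2 a ha x hx
      have j₂ := (hpos.1 hk'n).2.2.2 a ha v' (hρ.psupp_subset n hnv) x hx
      have j₃ : Cr u v' m := hv'
      simp only [mem_arc] at *
      clear * - j₁ j₂ j₃ hu hm hm' hst hpz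
      grind [Cr]

/-- The set var c lies in a component of the complement of var g. The orientation of `c`, `e`, `g`
decides which of its two ends is coded; one of the two cases is treated in the dual circle. -/
theorem LocAct.exists_conv_of_endCode {g e c : G} (h : EndCode g e c) :
    ∃ p, (∃ x ∈ interior (pvar (ρ g))ᶜ,
      p ∈ frontier (connectedComponentIn (interior (pvar (ρ g))ᶜ) x)) ∧
      Conv ρ {d | EndMem g e c d} p := by
  obtain ⟨h, hk⟩ := h
  obtain ⟨n₁, n₂, n₃, -, -, -, H⟩ := hρ.eoA_iff.1 h
  obtain ⟨x, hx⟩ := hρ.pvar_nonempty n₁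
  obtain ⟨y, hy⟩ := hρ.pvar_nonempty n₂
  obtain ⟨w, hw⟩ := hρ.pvar_nonempty n₃
  have hd : Disjoint (pvar (ρ c)) (pvar (ρ g)) := Set.disjoint_left.2 fun z hz hz' =>
    (H z hz y hy z hz' z hz y hy z hz').ne.2.2 rfl
  have hx' := mem_interior_compl_of_disjoint (isOpen_pvar _) hd hx
  obtain ⟨p, q, hpq, hA, hfr, hV, hp, hp', hq, hq'⟩ := exists_component_eq_arc (isOpen_pvar _) ⟨w, hw⟩ hx'
  have hxA : Cr p x q := by
    have : x ∈ arc p q := hA ▸ mem_connectedComponentIn hx'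
    exact this
  rcases cr_or_rev (H x hx y hy w hw x hx y hy w hw).ne.1
    (H x hx y hy w hw x hx y hy w hw).ne.2.1 (H x hx y hy w hw x hx y hy w hw).ne.2.2 with ho | ho
  · refine ⟨p, ⟨x, hx', by rw [hfr]; simp⟩, hρ.conv_endMem_of_pos ⟨n₁, n₂, n₃⟩
      (fun a ha b hb f hf => (H _ hx _ hy _ hw _ ha _ hb _ hf).eq_left ho) hk hx hp fun f hf => ?_⟩
    have i₁ := hV f hf
    have i₂ : f ≠ p := fun e => hp' (e ▸ hf)
    clear * - i₁ i₂ hxA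
    grind [Cr]
  · refine ⟨q, ⟨x, hx', by rw [hfr]; simp⟩, hρ.dual.conv_endMem_of_pos (X := Xᵒᵈ) ⟨n₁, n₂, n₃⟩
      (fun a ha b hb f hf => cr_dual (X := X).2 ?_) hk hx hq fun f hf => cr_dual (X := X).2 ?_⟩
    · have i := H _ hx _ hy _ hw _ ha _ hb _ hf
      exact i.swap.eq_left ho
    · have key : ∀ f : X, ¬ Cr p f q → f ≠ q → Cr f x q := fun f i₁ i₂ => by
        clear * - i₁ i₂ hxA
        grind [Cr]
      exact key f (hV f hf) fun e => hq' (e ▸ hf)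

theorem LocAct.exists_endCode_of_arc {g : G} {p q : X} (hpq : p ≠ q)
    (hV : ∀ w ∈ pvar (ρ g), ¬ Cr p w q) (hp : p ∈ closure (pvar (ρ g))) (hp' : p ∉ pvar (ρ g)) :
    ∃ e c, EndCode g e c ∧ Conv ρ {d | EndMem g e c d} p := by
  -- Read from `p`, the auxiliary points come in the order `z`, `v`, `x`, `u`, `y`, `q`. The points
  -- `v` and `u` keep apart the elements `k`, `c`, `e`, chosen around `z`, `x`, `y` respectively.
  obtain ⟨y, hy⟩ := dense hpq
  obtain ⟨x, hx⟩ := dense hy.ne₁₂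
  obtain ⟨z, hz⟩ := dense hx.ne₁₂
  obtain ⟨u, hu⟩ := dense hx.ne₂₃
  obtain ⟨v, hv⟩ := dense hz.ne₂₃
  obtain ⟨k, -, hk, hkz, -⟩ := hρ.exists_mem (isOpen_arc p v) (x := z) (by
    simp only [mem_arc]; clear * - hz hv; grind [Cr])
  obtain ⟨c, -, hc, hcx, -⟩ := hρ.exists_mem (isOpen_arc v u) (x := x) (by
    simp only [mem_arc]; clear * - hz hv hu hx; grind [Cr])
  obtain ⟨e, -, he, hey, -⟩ := hρ.exists_mem (isOpen_arc u q) (x := y) (by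
    simp only [mem_arc]; clear * - hu hx hy; grind [Cr])
  have hg := hρ.ne_one_of_mem_closure hp
  have h₁ := And.intro (hρ.ne_one_of_mem hcx) (And.intro (hρ.ne_one_of_mem hey) hg)
  have hVp : ∀ w ∈ pvar (ρ g), ¬ Cr p w q ∧ w ≠ p := fun w hw => ⟨hV w hw, fun e => hp' (e ▸ hw)⟩
  have hpu : Cr p u q ∧ Cr p v u ∧ Cr p v x ∧ Cr p u y ∧ Cr p x u := by clear * - hx hy hz hu hv; grind [Cr]
  clear hV hp'
  have h : ∀ a ∈ pvar (ρ c), ∀ b ∈ pvar (ρ e), ∀ w ∈ pvar (ρ g), Cr a b w := by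
    intro a ha b hb w hw
    have i₁ := hVp w hw
    have i₂ : Cr v a u := hc ha
    have i₃ : Cr u b q := he hb
    clear * - i₁ i₂ i₃ hpu
    grind [Cr]
  have hpos := fun {k₁ k₂ k₃ : G} => hρ.eoA_pos (k₁ := k₁) (k₂ := k₂) (k₃ := k₃) h₁ h
  have hb : EndBtw g e c k := by
    unfold EndBtw
    rw [hpos, hpos]
    refine ⟨⟨hρ.ne_one_of_mem hkz, h₁.1, h₁.2.1, fun a ha b hb f hf => ?_⟩, hg,
      hρ.ne_one_of_mem hkz, h₁.1, fun a ha b hb f hf => ?_⟩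
    · have i₁ : Cr p a v := hk ha
      have i₂ : Cr v b u := hc hb
      have i₃ : Cr u f q := he hf
      clear * - i₁ i₂ i₃ hpu
      grind [Cr]
    · have i₁ := hVp a ha
      have i₂ : Cr p b v := hk hb
      have i₃ : Cr v f u := hc hf
      clear * - i₁ i₂ i₃ hpu
      grind [Cr]
  refine ⟨e, c, ⟨hpos.2 ⟨h₁.1, h₁.2.1, hg, h⟩, k, hb⟩, hρ.conv_endMem_of_pos h₁ h ⟨k, hb⟩
    (hρ.psupp_subset _ hcx) hp fun w hw => ?_⟩
  have i₁ := hVp w hw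
  clear * - i₁ hpu
  grind [Cr]

theorem LocAct.exists_endCode {g : G} {x p : X} (hx : x ∈ interior (pvar (ρ g))ᶜ)
    (hp : p ∈ frontier (connectedComponentIn (interior (pvar (ρ g))ᶜ) x)) :
    ∃ e c, EndCode g e c ∧ Conv ρ {d | EndMem g e c d} p := by
  have hpF := frontier_connectedComponentIn_subset isOpen_interior hx hp
  rw [interior_compl, Set.mem_compl_iff, not_not] at hpF
  obtain ⟨p', q', hpq, hA, hfr, hV, hp₁, hp₂, hq₁, hq₂⟩ :=
    exists_component_eq_arc (isOpen_pvar _) (closure_nonempty_iff.1 ⟨p, hpF⟩) hx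
  rw [hfr] at hp
  rcases hp with rfl | rfl
  · exact hρ.exists_endCode_of_arc hpq hV hp₁ hp₂
  · exact hρ.dual.exists_endCode_of_arc (X := Xᵒᵈ) hpq.symm
      (fun w hw h => hV w hw (cr_dual (X := X).1 h)) hq₁ hq₂

end EndSemantics

/-! ### Abstract definability and its first and second order versions -/

section Logic
open FirstOrder FirstOrder.Language

/-- Three elements and a set of elements of a group. -/
abbrev Code (M : Type u) : Type u := (Fin 3 → M) × Set M

/-- Properties of families of codes, uniform over all groups. -/
abbrev CPred (β : Type) : Type (u + 1) := ∀ (M : Type u) [Group M], (β → Code M) → Prop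

/-- A class of definable properties closed under the logical operations. -/
structure DefClass where
  Def : ∀ {β : Type}, CPred.{u} β → Prop
  eq : ∀ {β : Type} (i j : β) (a b : Fin 3), Def fun _ _ κ => (κ i).1 a = (κ j).1 b
  mul : ∀ {β : Type} (i j k : β) (a b c : Fin 3),
    Def fun _ _ κ => (κ i).1 a * (κ j).1 b = (κ k).1 c
  fls : ∀ {β : Type}, Def (β := β) fun _ _ _ => False
  imp : ∀ {β : Type} {P Q : CPred.{u} β}, Def P → Def Q → Def fun M _ κ => P M κ → Q M κ
  all_option : ∀ {β : Type} {P : CPred.{u} (Option β)}, Def P →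
    Def fun M _ κ => ∀ c : Code M, P M fun o => o.elim c κ
  reindex : ∀ {β γ : Type} {P : CPred.{u} β} (f : β → γ), Def P →
    Def fun M _ κ => P M fun i => κ (f i)

/-- First order definability in the language of groups. -/
def foClass : DefClass.{u} where
  Def {β} P := ∃ φ : LGR.Formula (β × Fin 3), ∀ (M : Type u) [Group M] (κ : β → Code M),
    φ.Realize (fun p => (κ p.1).1 p.2) ↔ P M κ
  eq i j a b := ⟨Term.equal (Term.var (i, a)) (Term.var (j, b)), fun M _ κ => by
    rw [Formula.realize_equal]; rfl⟩
  mul i j k a b c := ⟨Term.equal (Term.func (L := LGR) GrFunc.comp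
    ![Term.var (i, a), Term.var (j, b)]) (Term.var (k, c)), fun M _ κ => by
    rw [Formula.realize_equal]; rfl⟩
  fls := ⟨⊥, fun _ _ _ => Iff.rfl⟩
  imp := by
    rintro β P Q ⟨φ, hφ⟩ ⟨ψ, hψ⟩
    exact ⟨φ.imp ψ, fun M _ κ => by rw [Formula.realize_imp, hφ, hψ]⟩
  all_option := by
    rintro β P ⟨φ, hφ⟩
    let f : Option β × Fin 3 → (β × Fin 3) ⊕ Fin 3 := fun p => p.1.elim (Sum.inr p.2)
      fun i => Sum.inl (i, p.2)
    refine ⟨Formula.iAlls (Fin 3) (φ.relabel f), fun M _ κ => ?_⟩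
    rw [Formula.realize_iAlls]
    have key : ∀ c : Code M, (φ.relabel f).Realize
        (fun a => Sum.elim (fun p : β × Fin 3 => (κ p.1).1 p.2) c.1 a) ↔
        P M fun o => o.elim c κ := by
      intro c
      rw [Formula.realize_relabel, ← hφ]
      refine iff_of_eq (congrArg _ (funext ?_))
      rintro ⟨_ | i, a⟩ <;> rfl
    -- A first order formula sees only the three elements of a code, so the set is immaterial and
    -- the empty set serves as default.
    exact ⟨fun h c => (key c).1 (h c.1), fun h v => (key (v, ∅)).2 (h _)⟩
  reindex := by
    rintro β γ P f ⟨φ, hφ⟩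
    exact ⟨φ.relabel fun p => (f p.1, p.2), fun M _ κ => by
      rw [Formula.realize_relabel]; exact hφ M fun i => κ (f i)⟩

/-- The set of elements denoted by a relation variable. -/
def setVal {M : Type u} {σ : Type} {ar : σ → ℕ} {Γ : List ℕ}
    (V : (X : σ) → Set (Fin (ar X) → M)) (W : (X : Fin Γ.length) → Set (Fin (Γ.get X) → M)) :
    Option (σ ⊕ Fin Γ.length) → Set M
  | none => ∅
  | some (Sum.inl X) => {a | (fun _ => a) ∈ V X}
  | some (Sum.inr X) => {a | (fun _ => a) ∈ W X}

/-- The codes denoted by variables. -/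
def codeVal {M : Type u} {β α σ : Type} {ar : σ → ℕ} {n : ℕ} {Γ : List ℕ}
    (ν : β → Fin 3 → α ⊕ Fin n) (ξ : β → Option (σ ⊕ Fin Γ.length)) (v : α → M)
    (V : (X : σ) → Set (Fin (ar X) → M)) (w : Fin n → M)
    (W : (X : Fin Γ.length) → Set (Fin (Γ.get X) → M)) (i : β) : Code M :=
  (fun a => Sum.elim v w (ν i a), setVal V W (ξ i))

/-- Second order definability in the language of groups. -/
def SODef {β : Type} (P : CPred.{u} β) : Prop :=
  ∀ (α σ : Type) (ar : σ → ℕ) (n : ℕ) (Γ : List ℕ) (ν : β → Fin 3 → α ⊕ Fin n)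
    (ξ : β → Option (σ ⊕ Fin Γ.length)), ∃ φ : SOBounded LGR α ar n Γ,
    ∀ (M : Type u) [Group M] (v : α → M) (V : (X : σ) → Set (Fin (ar X) → M)) (w : Fin n → M)
      (W : (X : Fin Γ.length) → Set (Fin (Γ.get X) → M)),
      φ.Realize v V w W ↔ P M (codeVal ν ξ v V w W)

/-- A variable to which no relation variable is assigned denotes the empty set, so membership in it
is the false formula. -/
theorem soDef_mem {β : Type} (i j : β) (a : Fin 3) :
    SODef.{u} fun M _ (κ : β → Code M) => (κ i).1 a ∈ (κ j).2 := by
  intro α σ ar n Γ ν ξ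
  rcases h : ξ j with _ | X | X
  · exact ⟨.falsum, fun M _ v V w W => by simp [SOBounded.Realize, codeVal, h, setVal]⟩
  · exact ⟨.freeApp X fun _ => Term.var (ν i a), fun M _ v V w W => by
      simp [SOBounded.Realize, codeVal, h, setVal]⟩
  · exact ⟨.boundApp X fun _ => Term.var (ν i a), fun M _ v V w W => by
      simp [SOBounded.Realize, codeVal, h, setVal]⟩

/-- A quantifier over codes becomes three quantifiers over elements and one over unary relations.
Definability is required in every context of free and bound variables, so that the induction can
pass under these quantifiers. -/
def soClass : DefClass.{u} where
  Def P := SODef P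
  eq i j a b := fun α σ ar n Γ ν ξ => ⟨.equal (Term.var (ν i a)) (Term.var (ν j b)),
    fun M _ v V w W => by simp [SOBounded.Realize, codeVal]⟩
  mul i j k a b c := fun α σ ar n Γ ν ξ => ⟨.equal (Term.func (L := LGR) GrFunc.comp
    ![Term.var (ν i a), Term.var (ν j b)]) (Term.var (ν k c)), fun M _ v V w W => Iff.rfl⟩
  fls := fun α σ ar n Γ ν ξ => ⟨.falsum, fun M _ v V w W => Iff.rfl⟩
  imp := by
    intro β P Q hP hQ α σ ar n Γ ν ξ
    obtain ⟨φ, hφ⟩ := hP α σ ar n Γ ν ξ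
    obtain ⟨ψ, hψ⟩ := hQ α σ ar n Γ ν ξ
    exact ⟨.imp φ ψ, fun M _ v V w W => by rw [SOBounded.Realize, hφ, hψ]⟩
  all_option := by
    intro β P hP α σ ar n Γ ν ξ
    let s : ∀ {m : ℕ}, α ⊕ Fin m → α ⊕ Fin (m + 1) := Sum.map id Fin.castSucc
    let ξ' : Option β → Option (σ ⊕ Fin (1 :: Γ).length) := fun o =>
      o.elim (some (Sum.inr (0 : Fin (Γ.length + 1)))) fun i =>
        (ξ i).map (Sum.map id (Fin.succ : Fin Γ.length → Fin (Γ.length + 1)))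
    obtain ⟨φ, hφ⟩ := hP α σ ar (n + 1 + 1 + 1) (1 :: Γ)
      (fun o => o.elim ![s (s (Sum.inr (Fin.last n))), s (Sum.inr (Fin.last (n + 1))),
        Sum.inr (Fin.last (n + 2))] fun i a => s (s (s (ν i a)))) ξ'
    refine ⟨.all (.all (.all (.allRel 1 φ))), fun M _ v V w W => ?_⟩
    simp only [SOBounded.Realize]
    have hs : ∀ {m : ℕ} (w : Fin m → M) (a : M) (x : α ⊕ Fin m),
        Sum.elim v (Fin.snoc (α := fun _ : Fin (m + 1) => M) w a) (s x) = Sum.elim v w x := by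
      rintro m w a (x | x)
      · rfl
      · exact Fin.snoc_castSucc (α := fun _ : Fin (m + 1) => M) a w x
    have hl : ∀ {m : ℕ} (w : Fin m → M) (a : M),
        Sum.elim v (Fin.snoc (α := fun _ : Fin (m + 1) => M) w a) (Sum.inr (Fin.last m)) = a :=
      fun w a => Fin.snoc_last (α := fun _ : Fin (_ + 1) => M) a w
    have key : ∀ a b c (R : Set (Fin 1 → M)),
        φ.Realize v V (Fin.snoc (α := fun _ : Fin (n + 1 + 1 + 1) => M)
          (Fin.snoc (α := fun _ : Fin (n + 1 + 1) => M)
            (Fin.snoc (α := fun _ : Fin (n + 1) => M) w a) b) c)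
          (Fin.cons (α := fun X : Fin (Γ.length + 1) => Set (Fin ((1 :: Γ).get X) → M)) R W) ↔
        P M fun o => o.elim (![a, b, c], {x | (fun _ => x) ∈ R}) (codeVal ν ξ v V w W) := by
      intro a b c R
      rw [hφ]
      refine iff_of_eq (congrArg _ (funext ?_))
      rintro (_ | i)
      · refine Prod.ext (funext fun t => ?_) rfl
        fin_cases t
        · exact (hs _ _ _).trans ((hs _ _ _).trans (hl _ _))
        · exact (hs _ _ _).trans (hl _ _)
        · exact hl _ _
      · refine Prod.ext (funext fun t => (hs _ _ _).trans ((hs _ _ _).trans (hs _ _ _))) ?_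
        show setVal V _ (ξ' (some i)) = setVal V W (ξ i)
        simp only [ξ', Option.elim]
        rcases ξ i with _ | X | X <;> rfl
    constructor
    · intro h c
      have := (key (c.1 0) (c.1 1) (c.1 2) {f | f 0 ∈ c.2}).1 (h _ _ _ _)
      have hc : (![c.1 0, c.1 1, c.1 2], {x | (fun _ => x) ∈ {f : Fin 1 → M | f 0 ∈ c.2}}) = c := by
        refine Prod.ext (funext fun t => ?_) rfl
        fin_cases t <;> rfl
      rwa [hc] at this
    · exact fun h a b c R => (key a b c R).2 (h _)
  reindex := by
    intro β γ P f hP α σ ar n Γ ν ξ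
    obtain ⟨φ, hφ⟩ := hP α σ ar n Γ (fun i => ν (f i)) (fun i => ξ (f i))
    exact ⟨φ, fun M _ v V w W => by rw [hφ]; rfl⟩

end Logic

/-- Elements depending on families of codes, uniform over all groups. -/
abbrev ETerm (β : Type) : Type (u + 1) := ∀ (M : Type u) [Group M], (β → Code M) → M

/-! ### Calculus of definable properties -/

namespace DefClass
variable {𝓛 : DefClass.{u}} {β γ : Type}

theorem congr {P Q : CPred.{u} β} (hP : 𝓛.Def P)
    (h : ∀ (M : Type u) [Group M] (κ : β → Code M), P M κ ↔ Q M κ) : 𝓛.Def Q := by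
  have : P = Q := by
    funext M _ κ
    exact propext (h M κ)
  exact this ▸ hP

theorem not {P : CPred.{u} β} (hP : 𝓛.Def P) : 𝓛.Def fun M _ κ => ¬ P M κ := 𝓛.imp hP 𝓛.fls

theorem tru : 𝓛.Def (β := β) fun _ _ _ => True := congr (𝓛.imp 𝓛.fls 𝓛.fls) fun _ _ _ => by simp

theorem and {P Q : CPred.{u} β} (hP : 𝓛.Def P) (hQ : 𝓛.Def Q) :
    𝓛.Def fun M _ κ => P M κ ∧ Q M κ :=
  congr (not (𝓛.imp hP (not hQ))) fun _ _ _ => by tauto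

theorem or {P Q : CPred.{u} β} (hP : 𝓛.Def P) (hQ : 𝓛.Def Q) :
    𝓛.Def fun M _ κ => P M κ ∨ Q M κ :=
  congr (𝓛.imp (not hP) hQ) fun _ _ _ => by tauto

theorem all {P : ∀ (M : Type u) [Group M], (β → Code M) → Code M → Prop}
    (h : 𝓛.Def (β := Option β) fun M _ κ => P M (fun i => κ (some i)) (κ none)) :
    𝓛.Def fun M _ κ => ∀ c, P M κ c := 𝓛.all_option h

theorem ex {P : ∀ (M : Type u) [Group M], (β → Code M) → Code M → Prop}
    (h : 𝓛.Def (β := Option β) fun M _ κ => P M (fun i => κ (some i)) (κ none)) :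
    𝓛.Def fun M _ κ => ∃ c, P M κ c :=
  congr (not (all (P := fun M _ κ c => ¬ P M κ c) (not h))) fun _ _ _ => by simp

theorem all_elt {P : ∀ (M : Type u) [Group M], (β → Code M) → M → Prop}
    (h : 𝓛.Def (β := Option β) fun M _ κ => P M (fun i => κ (some i)) ((κ none).1 0)) :
    𝓛.Def fun M _ κ => ∀ a, P M κ a :=
  congr (all (P := fun M _ κ c => P M κ (c.1 0)) h) fun _ _ _ =>
    ⟨fun h a => h (fun _ => a, ∅), fun h _ => h _⟩

theorem ex_elt {P : ∀ (M : Type u) [Group M], (β → Code M) → M → Prop}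
    (h : 𝓛.Def (β := Option β) fun M _ κ => P M (fun i => κ (some i)) ((κ none).1 0)) :
    𝓛.Def fun M _ κ => ∃ a, P M κ a :=
  congr (not (all_elt (P := fun M _ κ c => ¬ P M κ c) (not h))) fun _ _ _ => by simp

/-- Definability of the graph of a function. -/
def EDef (𝓛 : DefClass.{u}) (t : ETerm.{u} β) : Prop :=
  𝓛.Def (β := Option β) fun M _ κ => (κ none).1 0 = t M fun i => κ (some i)

theorem var (i : β) (a : Fin 3) : 𝓛.EDef fun M _ (κ : β → Code M) => (κ i).1 a :=
  𝓛.eq none (some i) 0 a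

theorem eq_elt {s t : ETerm.{u} β} (hs : 𝓛.EDef s) (ht : 𝓛.EDef t) :
    𝓛.Def fun M _ κ => s M κ = t M κ :=
  congr (ex_elt (P := fun M _ κ a => a = s M κ ∧ a = t M κ) (and hs ht)) fun _ _ _ => by simp

theorem EDef.reindex {t : ETerm.{u} β} (f : β → γ) (ht : 𝓛.EDef t) :
    𝓛.EDef fun M _ κ => t M fun i => κ (f i) :=
  𝓛.reindex (Option.map f) ht

theorem EDef.mul {s t : ETerm.{u} β} (hs : 𝓛.EDef s) (ht : 𝓛.EDef t) :
    𝓛.EDef fun M _ κ => s M κ * t M κ := by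
  have h₁ : 𝓛.Def (β := Option (Option (Option β))) fun M _ κ =>
      (κ (some none)).1 0 = s M (fun i => κ (some (some (some i)))) ∧
      (κ none).1 0 = t M (fun i => κ (some (some (some i)))) ∧
      (κ (some none)).1 0 * (κ none).1 0 = (κ (some (some none))).1 0 :=
    and (eq_elt (var _ _) (hs.reindex fun i => some (some (some i))))
      (and (eq_elt (var _ _) (ht.reindex fun i => some (some (some i)))) (𝓛.mul _ _ _ _ _ _))
  refine congr (ex_elt (P := fun M _ κ a => ∃ b, a = s M (fun i => κ (some i)) ∧
    b = t M (fun i => κ (some i)) ∧ a * b = (κ none).1 0) (ex_elt (P := fun M _ κ b =>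
      (κ none).1 0 = s M (fun i => κ (some (some i))) ∧ b = t M (fun i => κ (some (some i))) ∧
        (κ none).1 0 * b = (κ (some none)).1 0) h₁)) fun M _ κ => ?_
  simp [eq_comm]

theorem EDef.one : 𝓛.EDef fun M _ (_ : β → Code M) => (1 : M) :=
  congr (𝓛.mul none none none 0 0 0) fun M _ κ => by simp

theorem EDef.pow {t : ETerm.{u} β} (ht : 𝓛.EDef t) (n : ℕ) : 𝓛.EDef fun M _ κ => t M κ ^ n := by
  induction n with
  | zero => simpa using EDef.one
  | succ n ih => simpa only [pow_succ] using ih.mul ht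

theorem EDef.inv {t : ETerm.{u} β} (ht : 𝓛.EDef t) : 𝓛.EDef fun M _ κ => (t M κ)⁻¹ :=
  congr (eq_elt (EDef.mul (var none 0) (ht.reindex some)) EDef.one) fun M _ κ => by
    rw [← eq_inv_iff_mul_eq_one]

theorem EDef.conj {s t : ETerm.{u} β} (hs : 𝓛.EDef s) (ht : 𝓛.EDef t) :
    𝓛.EDef fun M _ κ => s M κ * t M κ * (s M κ)⁻¹ := (hs.mul ht).mul hs.inv

theorem ex_fin {n : ℕ} : ∀ {β : Type} {P : CPred.{u} (β ⊕ Fin n)}, 𝓛.Def P →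
    𝓛.Def fun M _ κ => ∃ κ' : Fin n → Code M, P M (Sum.elim κ κ') := by
  induction n with
  | zero =>
    intro β P h
    refine congr (𝓛.reindex (Sum.elim id Fin.elim0) h) fun M _ κ => ?_
    have key : ∀ κ' : Fin 0 → Code M, Sum.elim κ κ' =
        fun i : β ⊕ Fin 0 => κ (Sum.elim id Fin.elim0 i) := fun κ' => by
      funext i
      rcases i with i | i
      · rfl
      · exact i.elim0
    exact ⟨fun h => ⟨Fin.elim0, (key _).symm ▸ h⟩, fun ⟨κ', h⟩ => key κ' ▸ h⟩
  | succ n ih =>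
    intro β P h
    let f : β ⊕ Fin (n + 1) → Option β ⊕ Fin n := Sum.elim (fun i => Sum.inl (some i))
      (Fin.cases (Sum.inl none) Sum.inr)
    refine congr (ex (P := fun M _ κ c => ∃ κ' : Fin n → Code M, P M fun i => Sum.elim
      (fun o : Option β => o.elim c κ) κ' (f i)) (congr (ih (𝓛.reindex f h))
        fun M _ κ => ?_)) fun M _ κ => ?_
    · have : κ = fun o => o.elim (κ none) fun i => κ (some i) := by
        funext o
        cases o <;> rfl
      exact exists_congr fun κ' => by rw [← this]
    · have key : ∀ (c : Code M) (κ' : Fin n → Code M),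
          (fun i => Sum.elim (fun o : Option β => o.elim c κ) κ' (f i)) =
          Sum.elim κ (Fin.cons (α := fun _ => Code M) c κ') := by
        intro c κ'
        funext i
        rcases i with i | i
        · rfl
        · induction i using Fin.cases <;> rfl
      constructor
      · rintro ⟨c, κ', h⟩
        exact ⟨_, key c κ' ▸ h⟩
      · rintro ⟨κ', h⟩
        refine ⟨κ' 0, fun i => κ' i.succ, ?_⟩
        rw [key]
        have : Fin.cons (α := fun _ => Code M) (κ' 0) (fun i => κ' i.succ) = κ' :=
          Fin.cons_self_tail κ'
        rwa [this]

theorem all_fin {n : ℕ} : ∀ {P : Fin n → CPred.{u} β}, (∀ i, 𝓛.Def (P i)) →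
    𝓛.Def fun M _ κ => ∀ i, P i M κ := by
  induction n with
  | zero => exact fun _ => congr tru fun _ _ _ => by simp
  | succ n ih =>
    intro P h
    exact congr (and (h 0) (ih fun i => h i.succ)) fun M _ κ =>
      (Fin.forall_fin_succ (P := fun i => P i M κ)).symm

/-- Terms are substituted by naming their values with existentially quantified codes, so no
substitution inside formulas is needed. -/
theorem sub {n : ℕ} {P : ∀ (M : Type u) [Group M], (Fin n → M) → Prop}
    (h : 𝓛.Def (β := Fin n) fun M _ κ => P M fun i => (κ i).1 0) {t : Fin n → ETerm.{u} β}
    (ht : ∀ i, 𝓛.EDef (t i)) : 𝓛.Def fun M _ κ => P M fun i => t i M κ := by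
  refine congr (ex_fin (P := fun M _ κ => (∀ i, (κ (Sum.inr i)).1 0 = t i M fun j => κ (Sum.inl j)) ∧
    P M fun i => (κ (Sum.inr i)).1 0) (and (all_fin fun i => ?_)
      (𝓛.reindex Sum.inr h))) fun M _ κ => ?_
  · exact eq_elt (var _ _) ((ht i).reindex Sum.inl)
  · constructor
    · rintro ⟨κ', h₁, h₂⟩
      have : (fun i => (κ' i).1 0) = fun i => t i M κ := funext h₁
      exact this ▸ h₂
    · exact fun h => ⟨fun i => (fun _ => t i M κ, ∅), fun i => rfl, h⟩

def Def₁ (𝓛 : DefClass.{u}) (P : ∀ (M : Type u) [Group M], M → Prop) : Prop :=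
  𝓛.Def (β := Fin 1) fun M _ κ => P M ((κ 0).1 0)

def Def₂ (𝓛 : DefClass.{u}) (P : ∀ (M : Type u) [Group M], M → M → Prop) : Prop :=
  𝓛.Def (β := Fin 2) fun M _ κ => P M ((κ 0).1 0) ((κ 1).1 0)

def Def₃ (𝓛 : DefClass.{u}) (P : ∀ (M : Type u) [Group M], M → M → M → Prop) : Prop :=
  𝓛.Def (β := Fin 3) fun M _ κ => P M ((κ 0).1 0) ((κ 1).1 0) ((κ 2).1 0)

def Def₄ (𝓛 : DefClass.{u}) (P : ∀ (M : Type u) [Group M], M → M → M → M → Prop) : Prop :=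
  𝓛.Def (β := Fin 4) fun M _ κ => P M ((κ 0).1 0) ((κ 1).1 0) ((κ 2).1 0) ((κ 3).1 0)

def Def₆ (𝓛 : DefClass.{u}) (P : ∀ (M : Type u) [Group M], M → M → M → M → M → M → Prop) : Prop :=
  𝓛.Def (β := Fin 6) fun M _ κ => P M ((κ 0).1 0) ((κ 1).1 0) ((κ 2).1 0) ((κ 3).1 0)
    ((κ 4).1 0) ((κ 5).1 0)

variable {s t s' t' p q : ETerm.{u} β}

theorem Def₁.app {P} (h : 𝓛.Def₁ P) (hs : 𝓛.EDef s) : 𝓛.Def fun M _ κ => P M (s M κ) :=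
  sub (P := fun M _ v => P M (v 0)) h (t := ![s]) (by simpa [Fin.forall_fin_succ] using hs)

theorem Def₂.app {P} (h : 𝓛.Def₂ P) (hs : 𝓛.EDef s) (ht : 𝓛.EDef t) :
    𝓛.Def fun M _ κ => P M (s M κ) (t M κ) :=
  sub (P := fun M _ v => P M (v 0) (v 1)) h (t := ![s, t])
    (by simpa [Fin.forall_fin_succ] using ⟨hs, ht⟩)

theorem Def₃.app {P} (h : 𝓛.Def₃ P) (hs : 𝓛.EDef s) (ht : 𝓛.EDef t) (hs' : 𝓛.EDef s') :
    𝓛.Def fun M _ κ => P M (s M κ) (t M κ) (s' M κ) :=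
  sub (P := fun M _ v => P M (v 0) (v 1) (v 2)) h (t := ![s, t, s'])
    (by simpa [Fin.forall_fin_succ] using ⟨hs, ht, hs'⟩)

theorem Def₄.app {P} (h : 𝓛.Def₄ P) (hs : 𝓛.EDef s) (ht : 𝓛.EDef t) (hs' : 𝓛.EDef s')
    (ht' : 𝓛.EDef t') : 𝓛.Def fun M _ κ => P M (s M κ) (t M κ) (s' M κ) (t' M κ) :=
  sub (P := fun M _ v => P M (v 0) (v 1) (v 2) (v 3)) h (t := ![s, t, s', t'])
    (by simpa [Fin.forall_fin_succ] using ⟨hs, ht, hs', ht'⟩)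

theorem Def₆.app {P} (h : 𝓛.Def₆ P) (hs : 𝓛.EDef s) (ht : 𝓛.EDef t) (hs' : 𝓛.EDef s')
    (ht' : 𝓛.EDef t') (hp : 𝓛.EDef p) (hq : 𝓛.EDef q) :
    𝓛.Def fun M _ κ => P M (s M κ) (t M κ) (s' M κ) (t' M κ) (p M κ) (q M κ) :=
  sub (P := fun M _ v => P M (v 0) (v 1) (v 2) (v 3) (v 4) (v 5)) h (t := ![s, t, s', t', p, q])
    (by simpa [Fin.forall_fin_succ] using ⟨hs, ht, hs', ht', hp, hq⟩)

theorem eq_one (hs : 𝓛.EDef s) : 𝓛.Def fun M _ κ => s M κ = 1 := eq_elt hs EDef.one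

theorem commute (hs : 𝓛.EDef s) (ht : 𝓛.EDef t) :
    𝓛.Def fun M _ κ => s M κ * t M κ = t M κ * s M κ := eq_elt (hs.mul ht) (ht.mul hs)

/-- This and the following proofs replay the logical form of the definitions. Since the class is
arbitrary, they yield first order definability, second order definability and invariance under
isomorphisms at once. -/
theorem algDisj : 𝓛.Def₂ fun _ _ => AlgDisj := by
  refine all_elt (imp _ (not (commute (var _ _) (var _ _))) (ex_elt (ex_elt (and
    (commute (var _ _) (var _ _)) (and (commute (var _ _) (var _ _)) (ex_elt (and
      (eq_elt ?_ ?_) (and (commute (var _ _) (var _ _)) (not (eq_one (var _ _)))))))))))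
  · exact (var _ _).mul (((((var _ _).mul (var _ _)).mul (var _ _).inv).mul (var _ _).inv).mul
      (var _ _))
  · exact (var _ _).mul ((((var _ _).mul (var _ _)).mul (var _ _).inv).mul (var _ _).inv)

theorem algSub : 𝓛.Def₂ fun _ _ => AlgSub :=
  all_elt (imp _ (algDisj.app (var _ _) (var _ _)) (commute (var _ _) ((var _ _).pow 12)))

theorem dj : 𝓛.Def₂ fun _ _ => Dj :=
  all_elt (imp _ (algSub.app (var _ _) (var _ _)) (imp _ (algSub.app (var _ _) (var _ _))
    (eq_one (var _ _))))

theorem algBdd : 𝓛.Def₁ fun _ _ => AlgBdd :=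
  ex_elt (and (not (eq_one (var _ _))) (dj.app (var _ _) (var _ _)))

theorem meet : 𝓛.Def₆ fun _ _ => Meet := by
  refine ex_elt (ex_elt (ex_elt (and (algBdd.app (var _ _)) (and (algBdd.app (var _ _))
    (and (algBdd.app (var _ _)) (and (not (dj.app ?_ (var _ _))) (and (not (dj.app ?_ (var _ _)))
      (not (dj.app ?_ (var _ _)))))))))) <;>
  exact (((var _ _).mul (var _ _)).mul (var _ _)).conj (var _ _)

theorem eoA : 𝓛.Def₆ fun _ _ => EoA :=
  and (not (eq_one (var _ _))) (and (not (eq_one (var _ _))) (and (not (eq_one (var _ _)))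
    (and (not (eq_one (var _ _))) (and (not (eq_one (var _ _))) (and (not (eq_one (var _ _)))
      (not (meet.app (var _ _) (var _ _) (var _ _) (var _ _) (var _ _) (var _ _))))))))

theorem apart : 𝓛.Def₂ fun _ _ => Apart :=
  ex_elt (ex_elt (eoA.app (var _ _) (var _ _) (var _ _) (var _ _) (var _ _) (var _ _)))

theorem endBtw : 𝓛.Def₄ fun _ _ => EndBtw :=
  and (eoA.app (var _ _) (var _ _) (var _ _) (var _ _) (var _ _) (var _ _))
    (eoA.app (var _ _) (var _ _) (var _ _) (var _ _) (var _ _) (var _ _))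

theorem endCode : 𝓛.Def₃ fun _ _ => EndCode :=
  and (eoA.app (var _ _) (var _ _) (var _ _) (var _ _) (var _ _) (var _ _))
    (ex_elt (endBtw.app (var _ _) (var _ _) (var _ _) (var _ _)))

theorem endMem : 𝓛.Def₄ fun _ _ => EndMem :=
  ex_elt (ex_elt (and (endBtw.app (var _ _) (var _ _) (var _ _) (var _ _))
    (and (endBtw.app (var _ _) (var _ _) (var _ _) (var _ _))
      (and (eoA.app (var _ _) (var _ _) (var _ _) (var _ _) (var _ _) (var _ _))
        (all_elt (imp _ (endBtw.app (var _ _) (var _ _) (var _ _) (var _ _))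
          (imp _ (eoA.app (var _ _) (var _ _) (var _ _) (var _ _) (var _ _) (var _ _))
            (algSub.app (var _ _) (var _ _)))))))))

end DefClass

/-- A member of the class. -/
structure MCGroup : Type (u + 1) where
  L : Type u
  [ord : LinearOrder L]
  [base : CircleBase L]
  G : Subgroup (Equiv.Perm L)
  mc : IsMC 4 G

attribute [instance] MCGroup.ord MCGroup.base

/-! ### Members of the class and definable codings of their points -/

namespace MCGroup
variable (K : MCGroup.{u})

/-- The action of the group on the completed circle. -/
noncomputable def ρ : K.G →* Equiv.Perm (CBar K.L) := barHom K.mc.le_autEO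

theorem loc : LocAct K.ρ := K.mc.locAct

theorem ρ_apply (g : K.G) : K.ρ g = bar (g : Equiv.Perm K.L) := rfl

theorem exists_endCode_of_mem {x : CBar K.L} (hx : x ∈ Ep K.G) :
    ∃ g e c : K.G, EndCode g e c ∧ Conv K.ρ {d | EndMem g e c d} x := by
  obtain ⟨g, hg, y, hy, hp⟩ := hx
  exact ⟨⟨g, hg⟩, K.loc.exists_endCode (g := ⟨g, hg⟩) hy hp⟩

theorem exists_mem_of_endCode {g e c : K.G} (h : EndCode g e c) :
    ∃ x ∈ Ep K.G, Conv K.ρ {d | EndMem g e c d} x := by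
  obtain ⟨p, ⟨x, hx, hp⟩, hc⟩ := K.loc.exists_conv_of_endCode h
  exact ⟨p, ⟨g, g.2, x, hx, hp⟩, hc⟩

end MCGroup

/-- A definable coding of the points of definable sets of points, by families of group elements. -/
structure PointSys (𝓛 : DefClass.{u}) (S : ∀ K : MCGroup.{u}, Set (CBar K.L)) where
  valid : ∀ (M : Type u) [Group M], Code M → Prop
  nbd : ∀ (M : Type u) [Group M], Code M → Set M
  valid_def : ∀ {β : Type} (i : β), 𝓛.Def fun M _ κ => valid M (κ i)
  nbd_def : ∀ {β : Type} (i j : β) (a : Fin 3), 𝓛.Def fun M _ κ => (κ j).1 a ∈ nbd M (κ i)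
  sound : ∀ (K : MCGroup.{u}) (c : Code K.G), valid K.G c → ∃ x ∈ S K, Conv K.ρ (nbd K.G c) x
  complete : ∀ (K : MCGroup.{u}), ∀ x ∈ S K, ∃ c : Code K.G, ¬ c.1 0 = 1 ∧ valid K.G c ∧
    Conv K.ρ (nbd K.G c) x

/-- A definable subgroup. -/
structure SubSys (𝓛 : DefClass.{u}) (H : ∀ K : MCGroup.{u}, Subgroup (Equiv.Perm K.L)) where
  pred : ∀ (M : Type u) [Group M], M → Prop
  pred_def : 𝓛.Def₁ pred
  le : ∀ K, H K ≤ K.G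
  spec : ∀ (K : MCGroup.{u}) (g : K.G), pred K.G g ↔ (g : Equiv.Perm K.L) ∈ H K

/-- Endpoints are first order codable. -/
def epSys (𝓛 : DefClass.{u}) : PointSys 𝓛 fun K => Ep K.G where
  valid M _ c := EndCode (c.1 0) (c.1 1) (c.1 2)
  nbd M _ c := {d | EndMem (c.1 0) (c.1 1) (c.1 2) d}
  valid_def i := DefClass.endCode.app (DefClass.var i 0) (DefClass.var i 1) (DefClass.var i 2)
  nbd_def i j a := DefClass.endMem.app (DefClass.var i 0) (DefClass.var i 1) (DefClass.var i 2)
    (DefClass.var j a)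
  sound K c h := K.exists_mem_of_endCode h
  complete K x hx := by
    obtain ⟨g, e, c, h, h'⟩ := K.exists_endCode_of_mem hx
    -- The first component of a point code must differ from 1, since 1 there marks the codes of
    -- group elements. The orientation condition on `c`, `e`, `g` already says that `g` is not 1.
    exact ⟨(![g, e, c], ∅), h.1.2.2.1, h, h'⟩

/-- Membership in the sets of the codes is definable. -/
def DefClass.HasMem (𝓛 : DefClass.{u}) : Prop :=
  ∀ {β : Type} (i j : β) (a : Fin 3), 𝓛.Def fun M _ (κ : β → Code M) => (κ i).1 a ∈ (κ j).2

theorem DefClass.validSet {𝓛 : DefClass.{u}} (hm : 𝓛.HasMem) {β : Type} (i : β) :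
    𝓛.Def fun _ _ κ => ValidSet (κ i).2 := by
  refine and (ex_elt (hm _ _ _)) (and (not ?_) (and ?_ ?_))
  · exact congr (ex_elt (P := fun M _ κ a => a = 1 ∧ a ∈ (κ i).2)
      (and (eq_one (var _ _)) (hm _ _ _))) fun M _ κ => by simp
  · exact all_elt (all_elt (imp _ (hm _ _ _) (imp _ (hm _ _ _) (ex_elt (and (hm _ _ _)
      (and (algSub.app (var _ _) (var _ _)) (algSub.app (var _ _) (var _ _))))))))
  · exact all_elt (all_elt (imp _ (apart.app (var _ _) (var _ _)) (ex_elt (and (hm _ _ _)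
      (or (dj.app (var _ _) (var _ _)) (dj.app (var _ _) (var _ _)))))))

/-- The points of the completion are codable by sets of group elements. -/
def univSys (𝓛 : DefClass.{u}) (hm : 𝓛.HasMem) : PointSys.{u} 𝓛 fun _ => Set.univ where
  valid M _ c := ValidSet c.2
  nbd M _ c := c.2
  valid_def i := DefClass.validSet hm i
  nbd_def i j a := hm j i a
  sound K c h := by
    obtain ⟨x, hx⟩ := K.loc.exists_conv_of_validSet h
    exact ⟨x, trivial, hx⟩
  complete K x _ := by
    obtain ⟨g, hg, -⟩ := (K.loc.conv_pvar x).2 Set.univ isOpen_univ trivial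
    -- The point is carried by the set alone. The element slots are filled with a nonidentity
    -- element only to mark the code as that of a point.
    exact ⟨(fun _ => g, {g | x ∈ pvar (K.ρ g)}),
      K.loc.ne_one_of_mem_closure (subset_closure hg), K.loc.validSet_pvar x, K.loc.conv_pvar x⟩

/-! ### Preservation of orientation as a group-theoretic property -/

section Orientation
variable {X : Type*} [LinearOrder X] [TopologicalSpace X] [CircTop X] {G : Type*} [Group G]

/-- The group-theoretic counterpart of preservation of orientation. -/
def OriPres (g : G) : Prop :=
  ∃ c₁ c₂ c₃, EoA c₁ c₂ c₃ (g * c₁ * g⁻¹) (g * c₂ * g⁻¹) (g * c₃ * g⁻¹)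

theorem DefClass.oriPres {𝓛 : DefClass.{u}} : 𝓛.Def₁ fun _ _ => OriPres :=
  ex_elt (ex_elt (ex_elt (eoA.app (var _ _) (var _ _) (var _ _) ((var _ _).conj (var _ _))
    ((var _ _).conj (var _ _)) ((var _ _).conj (var _ _)))))

/-- By `Monocircular`, the behaviour on a single triple decides. For an orientation-preserving `g`,
the witnesses are supported so close to the points of a triple that they and their conjugates keep
the orientation of the triple and of its image. -/
theorem LocAct.oriPres_iff {ρ : G →* Equiv.Perm X} (hρ : LocAct ρ) {g : G} :
    OriPres g ↔ PreservesCr (ρ g) := by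
  constructor
  · rintro ⟨c₁, c₂, c₃, h⟩
    obtain ⟨n₁, n₂, n₃, -, -, -, H⟩ := hρ.eoA_iff.1 h
    obtain ⟨x₁, hx₁⟩ := hρ.pvar_nonempty n₁
    obtain ⟨x₂, hx₂⟩ := hρ.pvar_nonempty n₂
    obtain ⟨x₃, hx₃⟩ := hρ.pvar_nonempty n₃
    simp only [hρ.pvar_conj] at H
    have h' := H _ hx₁ _ hx₂ _ hx₃ _ ⟨_, hx₁, rfl⟩ _ ⟨_, hx₂, rfl⟩ _ ⟨_, hx₃, rfl⟩
    refine (hρ.mono g).resolve_right fun hr => ?_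
    rcases h' with ⟨a, b⟩ | ⟨a, b⟩
    · exact ((hr _ _ _).1 a).not_rev b
    · exact ((hr _ _ _).1 a).not_rev b
  · intro hp
    obtain ⟨x₁, x₂, x₃, hx⟩ := exists_cr X
    obtain ⟨U₁, U₂, U₃, V₁, V₂, V₃, ⟨o₁, o₂, o₃, o₄, o₅, o₆⟩, ⟨p₁, p₂, p₃, p₄, p₅, p₆⟩, hs⟩ :=
      hρ.exists_open_eo (Or.inl ⟨hx, (hp _ _ _).1 hx⟩)
    have pick : ∀ {x : X} {U V : Set X}, IsOpen U → IsOpen V → x ∈ U → ρ g x ∈ V →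
        ∃ c : G, ¬ c = 1 ∧ pvar (ρ c) ⊆ U ∧ pvar (ρ (g * c * g⁻¹)) ⊆ V := by
      intro x U V hU hV hxU hxV
      obtain ⟨c, -, hc, hcx, -⟩ := hρ.exists_mem (hU.inter (hV.preimage (hρ.mono g).continuous))
        ⟨hxU, hxV⟩
      refine ⟨c, hρ.ne_one_of_mem hcx, hc.trans Set.inter_subset_left, ?_⟩
      rw [hρ.pvar_conj, Set.image_subset_iff]
      exact hc.trans Set.inter_subset_right
    obtain ⟨c₁, n₁, i₁, j₁⟩ := pick o₁ o₄ p₁ p₄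
    obtain ⟨c₂, n₂, i₂, j₂⟩ := pick o₂ o₅ p₂ p₅
    obtain ⟨c₃, n₃, i₃, j₃⟩ := pick o₃ o₆ p₃ p₆
    have hn : ∀ {c : G}, ¬ c = 1 → ¬ g * c * g⁻¹ = 1 := fun h e => h (by simpa using e)
    exact ⟨c₁, c₂, c₃, hs _ _ _ _ _ _ n₁ n₂ n₃ (hn n₁) (hn n₂) (hn n₃) i₁ i₂ i₃ j₁ j₂ j₃⟩

end Orientation

theorem MCGroup.oriPres_iff (K : MCGroup.{u}) {g : K.G} :
    OriPres g ↔ (g : Equiv.Perm K.L) ∈ autCR K.L :=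
  K.loc.oriPres_iff.trans (mem_autCR_iff (K.mc.le_autEO g.2)).symm

def wholeSys (𝓛 : DefClass.{u}) : SubSys 𝓛 fun K => K.G where
  pred M _ _ := True
  pred_def := DefClass.tru
  le _ := le_rfl
  spec K g := by simp

def oppSys (𝓛 : DefClass.{u}) : SubSys 𝓛 fun K => opp K.G where
  pred M _ g := OriPres g
  pred_def := DefClass.oriPres
  le _ := inf_le_left
  spec K g := by rw [K.oriPres_iff]; simp [opp]

/-! ### The relations of the structure ACT in terms of codes -/

namespace PointSys
open DefClass
variable {𝓛 : DefClass.{u}} {S : ∀ K : MCGroup.{u}, Set (CBar K.L)} (𝓢 : PointSys 𝓛 S)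
  {H : ∀ K : MCGroup.{u}, Subgroup (Equiv.Perm K.L)} (𝓗 : SubSys 𝓛 H)

theorem codeEo_def {β : Type} (i₁ i₂ i₃ j₁ j₂ j₃ : β) : 𝓛.Def fun M _ κ =>
    CodeEo (𝓢.nbd M (κ i₁)) (𝓢.nbd M (κ i₂)) (𝓢.nbd M (κ i₃)) (𝓢.nbd M (κ j₁))
      (𝓢.nbd M (κ j₂)) (𝓢.nbd M (κ j₃)) := by
  refine ex_elt (ex_elt (ex_elt (ex_elt (ex_elt (ex_elt ?_)))))
  refine and (𝓢.nbd_def _ _ _) (and (𝓢.nbd_def _ _ _) (and (𝓢.nbd_def _ _ _)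
    (and (𝓢.nbd_def _ _ _) (and (𝓢.nbd_def _ _ _) (and (𝓢.nbd_def _ _ _)
      (and (eoA.app (var _ _) (var _ _) (var _ _) (var _ _) (var _ _) (var _ _)) ?_))))))
  exact and (apart.app (var _ _) (var _ _)) (and (apart.app (var _ _) (var _ _))
    (and (apart.app (var _ _) (var _ _)) (and (apart.app (var _ _) (var _ _))
      (and (apart.app (var _ _) (var _ _)) (apart.app (var _ _) (var _ _))))))

theorem codeAp_def {β : Type} {t : ETerm.{u} β} (ht : 𝓛.EDef t) (i j : β) : 𝓛.Def fun M _ κ =>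
    CodeAp (t M κ) (𝓢.nbd M (κ i)) (𝓢.nbd M (κ j)) := by
  refine not (ex_elt (ex_elt (and (𝓢.nbd_def _ _ _) (and (𝓢.nbd_def _ _ _) ?_))))
  exact apart.app (((ht.reindex some).reindex some).conj (var _ _)) (var _ _)

/-- The code is that of a point. -/
def IsPt (M : Type u) [Group M] (c : Code M) : Prop := ¬ c.1 0 = 1 ∧ 𝓢.valid M c

theorem isPt_def {β : Type} (i : β) : 𝓛.Def fun M _ κ => 𝓢.IsPt M (κ i) :=
  and (not (eq_one (var _ _))) (𝓢.valid_def i)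

/-- The codes of the elements of the structure. -/
def Univ (M : Type u) [Group M] (c : Code M) : Prop := 𝓢.IsPt M c ∨ c.1 0 = 1 ∧ 𝓗.pred M (c.1 1)

theorem univ_def {β : Type} (i : β) : 𝓛.Def fun M _ κ => 𝓢.Univ 𝓗 M (κ i) :=
  or (𝓢.isPt_def i) (and (eq_one (var _ _)) (𝓗.pred_def.app (var _ _)))

/-- The codes code the same object. -/
def CEq (M : Type u) [Group M] (c c' : Code M) : Prop :=
  𝓢.IsPt M c ∧ 𝓢.IsPt M c' ∧ CodeAp 1 (𝓢.nbd M c) (𝓢.nbd M c') ∨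
    c.1 0 = 1 ∧ c'.1 0 = 1 ∧ c.1 1 = c'.1 1

theorem cEq_def {β : Type} (i j : β) : 𝓛.Def fun M _ κ => 𝓢.CEq M (κ i) (κ j) :=
  or (and (𝓢.isPt_def i) (and (𝓢.isPt_def j) (𝓢.codeAp_def EDef.one i j)))
    (and (eq_one (var _ _)) (and (eq_one (var _ _)) (eq_elt (var _ _) (var _ _))))

/-- The relations of the structure in terms of codes. -/
def CRel (M : Type u) [Group M] : ∀ {m : ℕ}, McRel m → (Fin m → Code M) → Prop
  | _, McRel.eo, c => (∀ i, 𝓢.IsPt M (c i)) ∧ CodeEo (𝓢.nbd M (c 0)) (𝓢.nbd M (c 1))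
      (𝓢.nbd M (c 2)) (𝓢.nbd M (c 3)) (𝓢.nbd M (c 4)) (𝓢.nbd M (c 5))
  | _, McRel.comp, c => (∀ i, (c i).1 0 = 1) ∧ (c 0).1 1 * (c 1).1 1 = (c 2).1 1
  | _, McRel.ap, c => (c 0).1 0 = 1 ∧ 𝓢.IsPt M (c 1) ∧ 𝓢.IsPt M (c 2) ∧
      CodeAp ((c 0).1 1) (𝓢.nbd M (c 1)) (𝓢.nbd M (c 2))
  | _, McRel.pt, c => 𝓢.IsPt M (c 0)
  | _, McRel.grp, c => (c 0).1 0 = 1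

theorem cRel_def {β : Type} {m : ℕ} (R : McRel m) (f : Fin m → β) :
    𝓛.Def fun M _ κ => 𝓢.CRel M R fun i => κ (f i) := by
  cases R
  · exact and (all_fin fun i => 𝓢.isPt_def _) (𝓢.codeEo_def _ _ _ _ _ _)
  · exact and (all_fin fun i => eq_one (var _ _)) (𝓛.mul _ _ _ _ _ _)
  · exact and (eq_one (var _ _)) (and (𝓢.isPt_def _) (and (𝓢.isPt_def _)
      (𝓢.codeAp_def (var _ _) _ _)))
  · exact 𝓢.isPt_def _
  · exact eq_one (var _ _)

/-- The code `c` codes the element `a` of the structure. -/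
def Dec (K : MCGroup.{u}) (c : Code K.G) (a : Act (S K) (H K)) : Prop :=
  (𝓢.IsPt K.G c ∧ ∃ x : S K, a = Act.ofPt x ∧ Conv K.ρ (𝓢.nbd K.G c) x) ∨
    (c.1 0 = 1 ∧ ∃ h : H K, a = Act.ofGrp h ∧ ((c.1 1 : K.G) : Equiv.Perm K.L) = h)

variable {K : MCGroup.{u}}

include 𝓗 in
theorem univ_iff {c : Code K.G} : 𝓢.Univ 𝓗 K.G c ↔ ∃ a, 𝓢.Dec (H := H) K c a := by
  constructor
  · rintro (h | ⟨h, h'⟩)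
    · obtain ⟨x, hx, hc⟩ := 𝓢.sound K c h.2
      exact ⟨Act.ofPt ⟨x, hx⟩, Or.inl ⟨h, _, rfl, hc⟩⟩
    · exact ⟨Act.ofGrp ⟨_, (𝓗.spec K _).1 h'⟩, Or.inr ⟨h, _, rfl, rfl⟩⟩
  · rintro ⟨a, ⟨h, -⟩ | ⟨h, g, -, h'⟩⟩
    · exact Or.inl h
    · exact Or.inr ⟨h, (𝓗.spec K _).2 (h' ▸ g.2)⟩

include 𝓗 in
theorem exists_dec (a : Act (S K) (H K)) : ∃ c, 𝓢.Dec K c a := by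
  rcases a with x | h
  · obtain ⟨c, h, h', hc⟩ := 𝓢.complete K x x.2
    exact ⟨c, Or.inl ⟨⟨h, h'⟩, x, rfl, hc⟩⟩
  · exact ⟨(![1, ⟨h, 𝓗.le K h.2⟩, 1], ∅), Or.inr ⟨rfl, h, rfl, rfl⟩⟩

theorem dec_grp {c : Code K.G} {h : H K} (h₁ : c.1 0 = 1)
    (h₂ : ((c.1 1 : K.G) : Equiv.Perm K.L) = h) : 𝓢.Dec K c (Act.ofGrp h) :=
  Or.inr ⟨h₁, h, rfl, h₂⟩

theorem Dec.pt_iff {c : Code K.G} {a : Act (S K) (H K)} (h : 𝓢.Dec K c a) :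
    𝓢.IsPt K.G c ↔ ∃ x : S K, a = Act.ofPt x ∧ Conv K.ρ (𝓢.nbd K.G c) x := by
  rcases h with ⟨h, x, rfl, hx⟩ | ⟨h, g, rfl, hg⟩
  · exact iff_of_true h ⟨x, rfl, hx⟩
  · refine iff_of_false (fun h' => h'.1 h) ?_
    rintro ⟨x, hx, -⟩
    exact Sum.inr_ne_inl hx

theorem Dec.grp_iff {c : Code K.G} {a : Act (S K) (H K)} (h : 𝓢.Dec K c a) :
    c.1 0 = 1 ↔ ∃ g : H K, a = Act.ofGrp g ∧ ((c.1 1 : K.G) : Equiv.Perm K.L) = g := by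
  rcases h with ⟨h, x, rfl, hx⟩ | ⟨h, g, rfl, hg⟩
  · refine iff_of_false h.1 ?_
    rintro ⟨g, hg, -⟩
    exact Sum.inl_ne_inr hg
  · exact iff_of_true h ⟨g, rfl, hg⟩

theorem ofPt_injective : Function.Injective (Act.ofPt : S K → Act (S K) (H K)) :=
  Sum.inl_injective

theorem ofGrp_injective : Function.Injective (Act.ofGrp : H K → Act (S K) (H K)) :=
  Sum.inr_injective

theorem ofPt_ne_ofGrp {x : S K} {h : H K} : (Act.ofPt x : Act (S K) (H K)) ≠ Act.ofGrp h :=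
  Sum.inl_ne_inr

/-- Two point codes have the same limit exactly when the identity carries one limit to the other, so
equality is the case `1` of application. -/
theorem dec_eq {c c' : Code K.G} {a a' : Act (S K) (H K)} (h : 𝓢.Dec K c a)
    (h' : 𝓢.Dec K c' a') : 𝓢.CEq K.G c c' ↔ a = a' := by
  unfold CEq
  constructor
  · rintro (⟨h₁, h₂, h₃⟩ | ⟨h₁, h₂, h₃⟩)
    · obtain ⟨x, rfl, hx⟩ := (Dec.pt_iff 𝓢 h).1 h₁
      obtain ⟨y, rfl, hy⟩ := (Dec.pt_iff 𝓢 h').1 h₂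
      have := (K.loc.codeAp_iff hx hy).1 h₃
      rw [map_one, Equiv.Perm.one_apply] at this
      rw [Subtype.ext this]
    · obtain ⟨x, rfl, hx⟩ := (Dec.grp_iff 𝓢 h).1 h₁
      obtain ⟨y, rfl, hy⟩ := (Dec.grp_iff 𝓢 h').1 h₂
      rw [h₃] at hx
      rw [Subtype.ext (hx.symm.trans hy)]
  · rintro rfl
    by_cases hp : 𝓢.IsPt K.G c
    · obtain ⟨x, rfl, hx⟩ := (Dec.pt_iff 𝓢 h).1 hp
      obtain ⟨h', y, hxy, hy⟩ := h'.resolve_right fun ⟨_, g, hg, _⟩ => ofPt_ne_ofGrp hg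
      obtain rfl := ofPt_injective hxy
      refine Or.inl ⟨hp, h', (K.loc.codeAp_iff hx hy).2 ?_⟩
      rw [map_one, Equiv.Perm.one_apply]
    · obtain ⟨h₁, g, rfl, hg⟩ := h.resolve_left fun h => hp h.1
      obtain ⟨h₂, g', hgg', hg'⟩ := h'.resolve_left fun ⟨_, x, hx, _⟩ => ofPt_ne_ofGrp hx.symm
      obtain rfl := ofGrp_injective hgg'
      exact Or.inr ⟨h₁, h₂, Subtype.ext (hg.trans hg'.symm)⟩

/-- The relations involving points are `LocAct.codeEo_iff` and `LocAct.codeAp_iff`. The rest is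
bookkeeping with the tag that tells points from group elements. -/
theorem dec_rel {m : ℕ} (R : McRel m) {c : Fin m → Code K.G} {a : Fin m → Act (S K) (H K)}
    (h : ∀ i, 𝓢.Dec K (c i) (a i)) :
    𝓢.CRel K.G R c ↔ FirstOrder.Language.Structure.RelMap (L := LMCPG) R a := by
  cases R
  · show _ ↔ Act.IsEo _ _ _ _ _ _
    constructor
    · rintro ⟨hp, he⟩
      choose x hx hc using fun i => (Dec.pt_iff 𝓢 (h i)).1 (hp i)
      exact ⟨x 0, x 1, x 2, x 3, x 4, x 5, hx 0, hx 1, hx 2, hx 3, hx 4, hx 5,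
        (K.loc.codeEo_iff (hc 0) (hc 1) (hc 2) (hc 3) (hc 4) (hc 5)).1 he⟩
    · rintro ⟨x₀, x₁, x₂, x₃, x₄, x₅, e₀, e₁, e₂, e₃, e₄, e₅, he⟩
      have key : ∀ i (x : S K), a i = Act.ofPt x →
          𝓢.IsPt K.G (c i) ∧ Conv K.ρ (𝓢.nbd K.G (c i)) x := by
        intro i x hx
        obtain ⟨hp, y, hy, hc⟩ := (h i).resolve_right fun ⟨_, g, hg, _⟩ =>
          ofPt_ne_ofGrp (hx.symm.trans hg)
        obtain rfl := ofPt_injective (hx.symm.trans hy)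
        exact ⟨hp, hc⟩
      obtain ⟨p₀, k₀⟩ := key _ _ e₀
      obtain ⟨p₁, k₁⟩ := key _ _ e₁
      obtain ⟨p₂, k₂⟩ := key _ _ e₂
      obtain ⟨p₃, k₃⟩ := key _ _ e₃
      obtain ⟨p₄, k₄⟩ := key _ _ e₄
      obtain ⟨p₅, k₅⟩ := key _ _ e₅
      refine ⟨fun i => ?_, (K.loc.codeEo_iff k₀ k₁ k₂ k₃ k₄ k₅).2 he⟩
      fin_cases i <;> assumption
  · show _ ↔ Act.IsComp _ _ _
    constructor
    · rintro ⟨hp, he⟩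
      choose g hg hc using fun i => (Dec.grp_iff 𝓢 (h i)).1 (hp i)
      refine ⟨g 0, g 1, g 2, hg 0, hg 1, hg 2, Subtype.ext ?_⟩
      rw [Subgroup.coe_mul, ← hc 0, ← hc 1, ← hc 2, ← Subgroup.coe_mul, he]
    · rintro ⟨g₀, g₁, g₂, e₀, e₁, e₂, he⟩
      have key : ∀ i (g : H K), a i = Act.ofGrp g →
          (c i).1 0 = 1 ∧ (((c i).1 1 : K.G) : Equiv.Perm K.L) = g := by
        intro i g hg
        obtain ⟨hp, g', hg', hc⟩ := (h i).resolve_left fun ⟨_, x, hx, _⟩ =>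
          ofPt_ne_ofGrp (hx.symm.trans hg)
        obtain rfl := ofGrp_injective (hg.symm.trans hg')
        exact ⟨hp, hc⟩
      obtain ⟨p₀, k₀⟩ := key _ _ e₀
      obtain ⟨p₁, k₁⟩ := key _ _ e₁
      obtain ⟨p₂, k₂⟩ := key _ _ e₂
      refine ⟨fun i => ?_, Subtype.ext ?_⟩
      · fin_cases i <;> assumption
      · rw [Subgroup.coe_mul, k₀, k₁, k₂, ← he, Subgroup.coe_mul]
  · show _ ↔ Act.IsAp _ _ _
    constructor
    · rintro ⟨h₀, h₁, h₂, he⟩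
      obtain ⟨g, hg, hg'⟩ := (Dec.grp_iff 𝓢 (h 0)).1 h₀
      obtain ⟨x, hx, hx'⟩ := (Dec.pt_iff 𝓢 (h 1)).1 h₁
      obtain ⟨y, hy, hy'⟩ := (Dec.pt_iff 𝓢 (h 2)).1 h₂
      refine ⟨g, x, y, hg, hx, hy, ?_⟩
      rw [← hg']
      exact (K.loc.codeAp_iff hx' hy').1 he
    · rintro ⟨g, x, y, e₀, e₁, e₂, he⟩
      obtain ⟨h₀, g', hg', hc⟩ := (h 0).resolve_left fun ⟨_, x, hx, _⟩ =>
        ofPt_ne_ofGrp (hx.symm.trans e₀)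
      obtain rfl := ofGrp_injective (e₀.symm.trans hg')
      obtain ⟨h₁, x', hx', hc₁⟩ := (h 1).resolve_right fun ⟨_, g, hg, _⟩ =>
        ofPt_ne_ofGrp (e₁.symm.trans hg)
      obtain rfl := ofPt_injective (e₁.symm.trans hx')
      obtain ⟨h₂, y', hy', hc₂⟩ := (h 2).resolve_right fun ⟨_, g, hg, _⟩ =>
        ofPt_ne_ofGrp (e₂.symm.trans hg)
      obtain rfl := ofPt_injective (e₂.symm.trans hy')
      refine ⟨h₀, h₁, h₂, (K.loc.codeAp_iff hc₁ hc₂).2 ?_⟩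
      rw [K.ρ_apply, hc, he]
  · refine (Dec.pt_iff 𝓢 (h 0)).trans ?_
    show _ ↔ ∃ x, _
    constructor
    · rintro ⟨x, hx, -⟩
      exact ⟨x, hx⟩
    · rintro ⟨x, hx⟩
      obtain ⟨-, y, hy, hc⟩ := (h 0).resolve_right fun ⟨_, g, hg, _⟩ =>
        ofPt_ne_ofGrp (hx.symm.trans hg)
      exact ⟨y, hy, hc⟩
  · refine (Dec.grp_iff 𝓢 (h 0)).trans ?_
    show _ ↔ ∃ h, _
    constructor
    · rintro ⟨x, hx, -⟩
      exact ⟨x, hx⟩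
    · rintro ⟨x, hx⟩
      obtain ⟨-, y, hy, hc⟩ := (h 0).resolve_left fun ⟨_, g, hg, _⟩ =>
        ofPt_ne_ofGrp (hg.symm.trans hx)
      exact ⟨y, hy, hc⟩

end PointSys

/-! ### Translation of formulas about the action into the group -/

section Formulas
open DefClass FirstOrder FirstOrder.Language
variable {𝓛 : DefClass.{u}} {S : ∀ K : MCGroup.{u}, Set (CBar K.L)} (𝓢 : PointSys 𝓛 S)
  {H : ∀ K : MCGroup.{u}, Subgroup (Equiv.Perm K.L)} (𝓗 : SubSys 𝓛 H)

theorem exists_var_eq {α : Type} (t : LMCPG.Term α) : ∃ i, t = Term.var i := by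
  cases t with
  | var i => exact ⟨i, rfl⟩
  | func f ts => exact f.elim

include 𝓗 in
/-- First order formulas about the action translate into definable properties of codes. -/
theorem PointSys.exists_def_boundedFormula {α : Type} {n : ℕ} (φ : LMCPG.BoundedFormula α n) :
    ∃ P : CPred.{u} (α ⊕ Fin n), 𝓛.Def P ∧ ∀ (K : MCGroup.{u}) (c : α ⊕ Fin n → Code K.G)
      (v : α → Act (S K) (H K)) (w : Fin n → Act (S K) (H K)),
      (∀ i, 𝓢.Dec K (c i) (Sum.elim v w i)) → (P K.G c ↔ φ.Realize v w) := by
  induction φ with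
  | falsum => exact ⟨_, 𝓛.fls, fun K c v w _ => Iff.rfl⟩
  | equal s t =>
    obtain ⟨i, rfl⟩ := exists_var_eq s
    obtain ⟨j, rfl⟩ := exists_var_eq t
    exact ⟨_, 𝓢.cEq_def i j, fun K c v w h => 𝓢.dec_eq (h i) (h j)⟩
  | @rel n m R ts =>
    choose f hf using fun i => exists_var_eq (ts i)
    refine ⟨_, 𝓢.cRel_def R f, fun K c v w h => (𝓢.dec_rel R fun i => h (f i)).trans ?_⟩
    rw [BoundedFormula.Realize]
    refine iff_of_eq (congrArg _ (funext fun i => ?_))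
    rw [hf i]
    rfl
  | imp φ ψ ih₁ ih₂ =>
    obtain ⟨P, hP, h₁⟩ := ih₁
    obtain ⟨Q, hQ, h₂⟩ := ih₂
    exact ⟨_, 𝓛.imp hP hQ, fun K c v w h => by
      rw [BoundedFormula.realize_imp, h₁ K c v w h, h₂ K c v w h]⟩
  | @all n φ ih =>
    obtain ⟨P, hP, h₁⟩ := ih
    let f : α ⊕ Fin (n + 1) → Option (α ⊕ Fin n) := Sum.elim (fun a => some (Sum.inl a))
      (Fin.lastCases none fun i => some (Sum.inr i))
    -- The quantifier over the structure becomes a quantifier over codes, relativized to the codes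
    -- that denote something.
    refine ⟨_, all (P := fun M _ κ c => 𝓢.Univ 𝓗 M c → P M fun i => (f i).elim c κ)
      (𝓛.imp (𝓢.univ_def 𝓗 none) (congr (𝓛.reindex f hP) fun M _ κ => ?_)),
      fun K c v w h => ?_⟩
    · refine iff_of_eq (congrArg _ (funext fun i => ?_))
      cases f i <;> rfl
    · rw [BoundedFormula.realize_all]
      have key : ∀ (d : Code K.G) (a : Act (S K) (H K)), 𝓢.Dec K d a →
          (P K.G (fun i => (f i).elim d c) ↔
            φ.Realize v (Fin.snoc (α := fun _ : Fin (n + 1) => Act (S K) (H K)) w a)) := by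
        intro d a hd
        refine h₁ K _ _ _ fun i => ?_
        rcases i with i | i
        · exact h (Sum.inl i)
        · induction i using Fin.lastCases with
          | last =>
            simp only [f, Sum.elim_inr, Fin.lastCases_last, Option.elim, Fin.snoc_last]
            exact hd
          | cast i =>
            simp only [f, Sum.elim_inr, Fin.lastCases_castSucc, Option.elim, Fin.snoc_castSucc]
            exact h (Sum.inr i)
      constructor
      · intro H a
        obtain ⟨d, hd⟩ := 𝓢.exists_dec 𝓗 a
        exact (key d a hd).1 (H d ((𝓢.univ_iff 𝓗).2 ⟨a, hd⟩))
      · intro H d hd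
        obtain ⟨a, ha⟩ := (𝓢.univ_iff 𝓗).1 hd
        exact (key d a ha).2 (H a)

include 𝓢 𝓗 in
-- The given group elements sit in slot 0, whereas the code of a group element carries the tag 1
-- there and the element in slot 1. The quantified codes do the repackaging.
theorem PointSys.exists_def_formula {n : ℕ} (φ : LMCPG.Formula (Fin n)) :
    ∃ P : CPred.{u} (Fin n), 𝓛.Def P ∧ ∀ (K : MCGroup.{u}) (c : Fin n → Code K.G)
      (g : Fin n → H K), (∀ i, (((c i).1 0 : K.G) : Equiv.Perm K.L) = g i) →
      (P K.G c ↔ φ.Realize fun i => (Act.ofGrp (g i) : Act (S K) (H K))) := by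
  obtain ⟨P, hP, h⟩ := 𝓢.exists_def_boundedFormula 𝓗 φ
  refine ⟨_, ex_fin (P := fun M _ κ => (∀ i, (κ (Sum.inr i)).1 0 = 1 ∧
    (κ (Sum.inr i)).1 1 = (κ (Sum.inl i)).1 0) ∧ P M fun j => κ (Sum.elim Sum.inr Fin.elim0 j))
    (and (all_fin fun i => and (eq_one (var _ _)) (eq_elt (var _ _) (var _ _)))
      (𝓛.reindex _ hP)), fun K c g hc => ?_⟩
  have key : ∀ c' : Fin n → Code K.G, (∀ i, (c' i).1 0 = 1 ∧ (c' i).1 1 = (c i).1 0) →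
      (P K.G (fun j => Sum.elim c c' (Sum.elim Sum.inr Fin.elim0 j)) ↔
        φ.Realize fun i => (Act.ofGrp (g i) : Act (S K) (H K))) := by
    intro c' hc'
    refine h K _ _ _ fun j => ?_
    rcases j with j | j
    · exact 𝓢.dec_grp (hc' j).1 ((congrArg _ (hc' j).2).trans (hc j))
    · exact j.elim0
  constructor
  · rintro ⟨c', hc', hP'⟩
    exact (key c' hc').1 hP'
  · intro hr
    refine ⟨fun i => (![1, (c i).1 0, 1], ∅), fun i => ⟨rfl, rfl⟩, ?_⟩
    exact (key (fun i => (![1, (c i).1 0, 1], ∅)) fun i => ⟨rfl, rfl⟩).2 hr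

/-- A member of the class, from its constituents. -/
def MCGroup.mk' {L : Type u} [LinearOrder L] [CircleBase L] {G : Subgroup (Equiv.Perm L)}
    (h : IsMC 4 G) : MCGroup.{u} := ⟨L, G, h⟩

theorem foExpressible_of_def {n : ℕ} {P : CPred.{u} (Fin n)} (hP : foClass.Def P)
    {Q : ∀ (L : Type u) [LinearOrder L] [CircleBase L] (G : Subgroup (Equiv.Perm L)),
      (Fin n → G) → Prop}
    (h : ∀ (K : MCGroup.{u}) (c : Fin n → Code K.G), P K.G c ↔ Q K.L K.G fun i => (c i).1 0) :
    FOExpressible.{u} n Q := by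
  obtain ⟨φ, hφ⟩ := hP
  refine ⟨φ.relabel Prod.fst, fun L _ _ G hG g => ?_⟩
  rw [Formula.realize_relabel]
  exact (hφ G fun i => (fun _ => g i, ∅)).trans (h (MCGroup.mk' hG) fun i => (fun _ => g i, ∅))

theorem soExpressible_of_def {n : ℕ} {P : CPred.{u} (Fin n)} (hP : soClass.Def P)
    {Q : ∀ (L : Type u) [LinearOrder L] [CircleBase L] (G : Subgroup (Equiv.Perm L)),
      (Fin n → G) → Prop}
    (h : ∀ (K : MCGroup.{u}) (c : Fin n → Code K.G), P K.G c ↔ Q K.L K.G fun i => (c i).1 0) :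
    SOExpressible.{u} n Q := by
  obtain ⟨φ, hφ⟩ := hP (Fin n) Empty Empty.elim 0 [] (fun i _ => Sum.inl i) (fun _ => none)
  refine ⟨φ, fun L _ _ G hG g => ?_⟩
  exact (hφ G g _ _ _).trans (h (MCGroup.mk' hG) _)

theorem foExpressible_formula (n : ℕ) (φ : LMCPG.Formula (Fin n)) : FOExpressible.{u} n
    fun _ _ _ G g => φ.Realize (fun i => (Act.ofGrp (g i) : EPACT G)) := by
  obtain ⟨P, hP, h⟩ := (epSys foClass).exists_def_formula (wholeSys foClass) φ
  exact foExpressible_of_def hP fun K c => h K c _ fun i => rfl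

theorem soExpressible_formula (n : ℕ) (φ : LMCPG.Formula (Fin n)) : SOExpressible.{u} n
    fun _ _ _ G g => φ.Realize (fun i => (Act.ofGrp (g i) : DCACT G)) := by
  obtain ⟨P, hP, h⟩ := (univSys soClass soDef_mem).exists_def_formula (wholeSys soClass) φ
  exact soExpressible_of_def hP fun K c => h K c _ fun i => rfl

/-- A definable property of the empty family of codes is given by a sentence in the language of
groups. -/
theorem foClass_iff_of_elementarilyEquivalent {P : CPred.{u} (Fin 0)} (hP : foClass.Def P)
    {M N : Type u} [Group M] [Group N] (h : LGR.ElementarilyEquivalent M N) :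
    P M Fin.elim0 ↔ P N Fin.elim0 := by
  obtain ⟨φ, hφ⟩ := hP
  have key : ∀ (M : Type u) [Group M],
      M ⊨ (φ.relabel (fun p => p.1.elim0 : Fin 0 × Fin 3 → Empty)) ↔ P M Fin.elim0 := by
    intro M _
    rw [← hφ, Sentence.Realize, Formula.realize_relabel]
    refine iff_of_eq (congrArg _ (funext fun p => p.1.elim0))
  rw [← key M, ← key N]
  exact elementarilyEquivalent_iff.1 h _

theorem elementarilyEquivalent_of_foClass (𝓢 : PointSys foClass S) (𝓗 : SubSys foClass H)
    {K₁ K₂ : MCGroup.{u}} (h : LGR.ElementarilyEquivalent K₁.G K₂.G) :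
    LMCPG.ElementarilyEquivalent (Act (S K₁) (H K₁)) (Act (S K₂) (H K₂)) := by
  rw [elementarilyEquivalent_iff]
  intro φ
  obtain ⟨P, hP, hφ⟩ := 𝓢.exists_def_formula 𝓗 (φ.relabel (Empty.elim : Empty → Fin 0))
  have key : ∀ K : MCGroup.{u}, Act (S K) (H K) ⊨ φ ↔ P K.G Fin.elim0 := by
    intro K
    rw [hφ K Fin.elim0 Fin.elim0 fun i => i.elim0, Formula.realize_relabel, Sentence.Realize]
    exact iff_of_eq (congrArg _ (funext fun p => p.elim))
  rw [key, key]
  exact foClass_iff_of_elementarilyEquivalent hP h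

end Formulas

/-! ### First and second order strong interpretations -/

section Interpretations
open DefClass FirstOrder FirstOrder.Language

namespace PointSys
variable {𝓛 : DefClass.{u}} {S : ∀ K : MCGroup.{u}, Set (CBar K.L)} (𝓢 : PointSys 𝓛 S)
  {H : ∀ K : MCGroup.{u}, Subgroup (Equiv.Perm K.L)} (𝓗 : SubSys 𝓛 H) {K : MCGroup.{u}}

/-- The element of the structure with a given code. -/
noncomputable def decode {c : Code K.G} (h : 𝓢.Univ 𝓗 K.G c) : Act (S K) (H K) :=
  ((𝓢.univ_iff 𝓗).1 h).choose

theorem decode_spec {c : Code K.G} (h : 𝓢.Univ 𝓗 K.G c) : 𝓢.Dec K c (𝓢.decode 𝓗 h) :=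
  ((𝓢.univ_iff 𝓗).1 h).choose_spec

theorem decode_eq {c : Code K.G} {a : Act (S K) (H K)} (h : 𝓢.Univ 𝓗 K.G c) :
    𝓢.decode 𝓗 h = a ↔ 𝓢.Dec K c a :=
  ⟨fun e => e ▸ 𝓢.decode_spec 𝓗 h,
    fun h' => (𝓢.dec_eq (𝓢.decode_spec 𝓗 h) h').1 ((𝓢.dec_eq h' h').2 rfl)⟩

/-- Codes of a fixed group element are recognized by their tag and slot 1 alone. This supplies the
formula for the inclusion of the group in the interpreted structure. -/
theorem decode_grp {c : Code K.G} {x : H K} {y : K.G} (hxy : (y : Equiv.Perm K.L) = x) :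
    (c.1 0 = 1 ∧ c.1 1 = y) ↔ ∃ h : 𝓢.Univ 𝓗 K.G c, 𝓢.decode 𝓗 h = Act.ofGrp x := by
  constructor
  · rintro ⟨h₁, h₂⟩
    have h : 𝓢.Dec K c (Act.ofGrp x) := 𝓢.dec_grp h₁ ((congrArg _ h₂).trans hxy)
    have h' := (𝓢.univ_iff 𝓗).2 ⟨_, h⟩
    exact ⟨h', (𝓢.decode_eq 𝓗 h').2 h⟩
  · rintro ⟨h, e⟩
    obtain ⟨h₁, g, hg, h₂⟩ := ((𝓢.decode_eq 𝓗 h).1 e).resolve_left fun ⟨_, x, hx, _⟩ =>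
      ofPt_ne_ofGrp (K := K) (S := S) (H := H) hx.symm
    obtain rfl := ofGrp_injective hg
    exact ⟨h₁, Subtype.ext (h₂.trans hxy.symm)⟩

end PointSys

/-- First order interpretation of the action on endpoints. -/
theorem exists_foStrInterp : ∃ I : FOStrInterp LGR LMCPG, ∀ (L : Type u) [LinearOrder L]
    [CircleBase L] (G : Subgroup (Equiv.Perm L)), IsMC 4 G →
      I.Interprets (fun g : G => (Act.ofGrp g : EPACT G)) := by
  let 𝓢 := epSys.{u} foClass
  let 𝓗 := wholeSys.{u} foClass
  obtain ⟨φU, hU⟩ := 𝓢.univ_def 𝓗 (0 : Fin 1)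
  obtain ⟨φE, hE⟩ := 𝓢.cEq_def (0 : Fin 2) 1
  have hR : ∀ {m : ℕ} (R : LMCPG.Relations m), ∃ φ : LGR.Formula (Fin m × Fin 3),
      ∀ (M : Type u) [Group M] (κ : Fin m → Code M),
        φ.Realize (fun p => (κ p.1).1 p.2) ↔ 𝓢.CRel M R κ :=
    fun R => 𝓢.cRel_def R id
  choose φR hR using @hR
  obtain ⟨φI, hI⟩ := (and (eq_one (var _ _)) (eq_elt (var _ _) (var _ _)) :
    foClass.{u}.Def (β := Fin 2) fun M _ κ => (κ 0).1 0 = 1 ∧ (κ 0).1 1 = (κ 1).1 0)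
  refine ⟨⟨3, φU.relabel Prod.snd, φE, φR,
    φI.relabel fun p => if p.1 = 0 then Sum.inl p.2 else Sum.inr ()⟩, fun L _ _ G hG => ?_⟩
  let K := MCGroup.mk' hG
  have hU' : ∀ a : Fin 3 → G, (φU.relabel Prod.snd).Realize a ↔ 𝓢.Univ 𝓗 K.G (a, ∅) := by
    intro a
    rw [Formula.realize_relabel]
    exact hU G fun _ => (a, ∅)
  refine ⟨fun a => 𝓢.decode 𝓗 ((hU' a.1).1 a.2), ?_, ?_, ?_, ?_⟩
  · intro b
    obtain ⟨c, hc⟩ := 𝓢.exists_dec 𝓗 (K := K) b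
    -- The coding of endpoints never looks at the set of a code, so the set may be replaced by the
    -- empty one.
    have hc' : 𝓢.Dec (H := fun K => K.G) K (c.1, ∅) b := hc
    exact ⟨⟨c.1, (hU' _).2 ((𝓢.univ_iff 𝓗).2 ⟨b, hc'⟩)⟩, (𝓢.decode_eq 𝓗 _).2 hc'⟩
  · intro a b
    refine (𝓢.dec_eq (𝓢.decode_spec 𝓗 _) (𝓢.decode_spec 𝓗 _)).symm.trans
      ((hE G ![(a.1, ∅), (b.1, ∅)]).symm.trans (iff_of_eq (congrArg _ (funext ?_))))
    rintro ⟨i, j⟩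
    fin_cases i <;> rfl
  · intro m R a
    exact (𝓢.dec_rel R fun i => 𝓢.decode_spec 𝓗 _).symm.trans
      (hR R G fun i => ((a i).1, ∅)).symm
  · intro a x
    refine Iff.trans ?_ ((𝓢.decode_grp 𝓗 (K := K) (c := (a, ∅)) (x := x) rfl).trans ?_)
    · refine (Formula.realize_relabel).trans (Iff.trans (iff_of_eq (congrArg _ (funext ?_)))
        (hI G ![(a, ∅), (fun _ => x, ∅)]))
      rintro ⟨i, j⟩
      fin_cases i <;> rfl
    · exact exists_prop_congr (fun _ => Iff.rfl) (hU' a).symm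

/-- Second order interpretation of the action on the completion. -/
theorem exists_soStrInterp : ∃ I : SOStrInterp LGR LMCPG, ∀ (L : Type u) [LinearOrder L]
    [CircleBase L] (G : Subgroup (Equiv.Perm L)), IsMC 4 G →
      I.Interprets (fun g : G => (Act.ofGrp g : DCACT G)) := by
  let 𝓢 := univSys.{u} soClass soDef_mem
  let 𝓗 := wholeSys.{u} soClass
  obtain ⟨φU, hU⟩ := 𝓢.univ_def 𝓗 (0 : Fin 1) (Fin 3) (Fin 1) (fun _ => 1) 0 []
    (fun _ a => Sum.inl a) (fun _ => some (Sum.inl 0))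
  obtain ⟨φE, hE⟩ := 𝓢.cEq_def (0 : Fin 2) 1 (Fin 2 × Fin 3) (Fin 2 × Fin 1) (fun _ => 1) 0 []
    (fun i a => Sum.inl (i, a)) (fun i => some (Sum.inl (i, 0)))
  have hR := fun {m : ℕ} (R : LMCPG.Relations m) => 𝓢.cRel_def R (id : Fin m → Fin m)
    (Fin m × Fin 3) (Fin m × Fin 1) (fun _ => 1) 0 []
    (fun i a => Sum.inl (i, a)) (fun i => some (Sum.inl (i, 0)))
  choose φR hR using @hR
  obtain ⟨φI, hI⟩ := (and (eq_one (var _ _)) (eq_elt (var _ _) (var _ _)) :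
    soClass.{u}.Def (β := Fin 2) fun M _ κ => (κ 0).1 0 = 1 ∧ (κ 0).1 1 = (κ 1).1 0)
    (Fin 3 ⊕ Unit) (Fin 1) (fun _ => 1) 0 []
    (fun i a => Sum.inl (if i = 0 then Sum.inl a else Sum.inr ())) (fun _ => some (Sum.inl 0))
  refine ⟨⟨3, 1, fun _ => 1, φU, φE, φR, φI⟩, fun L _ _ G hG => ?_⟩
  let K := MCGroup.mk' hG
  -- A unary relation is a set of one-term sequences; the code needs the set of their terms.
  let code : (Fin 3 → G) → (Fin 1 → Set (Fin 1 → G)) → Code G := fun a A =>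
    (a, {x | (fun _ => x) ∈ A 0})
  have hU' : ∀ (a : Fin 3 → G) (A : Fin 1 → Set (Fin 1 → G)),
      SOFormula.Sat φU a A ↔ 𝓢.Univ 𝓗 K.G (code a A) := fun a A => hU G a A _ _
  refine ⟨fun r => 𝓢.decode 𝓗 ((hU' r.elt r.set).1 r.sat), ?_, ?_, ?_, ?_⟩
  · intro b
    obtain ⟨c, hc⟩ := 𝓢.exists_dec 𝓗 (K := K) b
    have hc' : 𝓢.Dec (H := fun K => K.G) K (code c.1 fun _ => {f | f 0 ∈ c.2}) b := hc
    have hs := (hU' c.1 fun _ => {f | f 0 ∈ c.2}).2 ((𝓢.univ_iff 𝓗).2 ⟨b, hc'⟩)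
    exact ⟨⟨c.1, fun _ => {f | f 0 ∈ c.2}, hs⟩, (𝓢.decode_eq 𝓗 ((hU' _ _).1 hs)).2 hc'⟩
  · intro a b
    exact (𝓢.dec_eq (𝓢.decode_spec 𝓗 _) (𝓢.decode_spec 𝓗 _)).symm.trans
      (hE G (fun p => (![a, b] p.1).elt p.2) (fun p => (![a, b] p.1).set p.2) Fin.elim0
        fun X => Fin.elim0 X).symm
  · intro m R a
    exact (𝓢.dec_rel R fun i => 𝓢.decode_spec 𝓗 _).symm.trans
      (hR R G (fun p => (a p.1).elt p.2) (fun p => (a p.1).set p.2) Fin.elim0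
        fun X => Fin.elim0 X).symm
  · intro a A x
    refine Iff.trans (hI G _ _ _ _) ((𝓢.decode_grp 𝓗 (K := K) (c := code a A) (x := x) rfl).trans
      (exists_prop_congr (fun _ => Iff.rfl) (hU' a A).symm))

end Interpretations

/-! ### Signs, orbits and completeness expressed in the group -/

section Expressibility
open DefClass

/-- The group-theoretic counterpart of equality of signs. -/
def AlgSameSign {G : Type*} [Group G] (g₁ g₂ : G) : Prop :=
  ∀ c₁ c₂, ¬ EoA (g₁ * g₁ * c₁ * (g₁ * g₁)⁻¹) (g₁ * c₁ * g₁⁻¹) c₁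
    (g₂ * c₂ * g₂⁻¹) (g₂ * g₂ * c₂ * (g₂ * g₂)⁻¹) c₂

theorem DefClass.algSameSign {𝓛 : DefClass.{u}} : 𝓛.Def₂ fun _ _ => AlgSameSign :=
  all_elt (all_elt (not (eoA.app (((var _ _).mul (var _ _)).conj (var _ _))
    ((var _ _).conj (var _ _)) (var _ _) ((var _ _).conj (var _ _))
    (((var _ _).mul (var _ _)).conj (var _ _)) (var _ _))))

/-- Disagreement in orientation is an open condition on the two points, so it can be witnessed by
elements with small supports. Conversely, a disagreement of elements already shows at points of the
dense set, which makes the test on the points of C sufficient. -/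
theorem LocAct.algSameSign_iff {X : Type*} [LinearOrder X] [TopologicalSpace X] [CircTop X]
    {G : Type*} [Group G] {ρ : G →* Equiv.Perm X} (hρ : LocAct ρ) {g₁ g₂ : G} {D : Set X}
    (hD : Dense D) : AlgSameSign g₁ g₂ ↔ ∀ x₁ ∈ D, ∀ x₂ ∈ D, ρ g₁ (ρ g₁ x₁) ≠ x₁ →
      ρ g₂ (ρ g₂ x₂) ≠ x₂ → Eo (ρ g₁ (ρ g₁ x₁)) (ρ g₁ x₁) x₁ (ρ g₂ (ρ g₂ x₂)) (ρ g₂ x₂) x₂ := by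
  have hcont : ∀ g, Continuous (ρ g) := fun g => (hρ.mono g).continuous
  have hsq : ∀ g c, pvar (ρ (g * g * c * (g * g)⁻¹)) = (fun x => ρ g (ρ g x)) '' pvar (ρ c) := by
    intro g c
    rw [hρ.pvar_conj, map_mul]
    rfl
  constructor
  · intro H x₁ _ x₂ _ h₁ h₂
    -- A point not fixed by the square is different from its image, so the triple is nondegenerate
    -- and has an orientation.
    have hne : ∀ {g x}, ρ g (ρ g x) ≠ x → ρ g (ρ g x) ≠ ρ g x ∧ ρ g x ≠ x ∧ ρ g (ρ g x) ≠ x := by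
      intro g x h
      exact ⟨fun e => h (by rw [e, (ρ g).injective e]), fun e => h (by rw [e, e]), h⟩
    refine (eo_or_eo (hne h₁) (hne h₂)).resolve_right fun hE => ?_
    obtain ⟨U₁, U₂, U₃, V₁, V₂, V₃, ⟨o₁, o₂, o₃, o₄, o₅, o₆⟩, ⟨p₁, p₂, p₃, p₄, p₅, p₆⟩, hs⟩ :=
      hρ.exists_open_eo hE
    obtain ⟨c₁, -, hc₁, hx₁, -⟩ := hρ.exists_mem (x := x₁) ((o₃.inter (o₂.preimage (hcont g₁))).inter
      (o₁.preimage ((hcont g₁).comp (hcont g₁)))) ⟨⟨p₃, p₂⟩, p₁⟩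
    obtain ⟨c₂, -, hc₂, hx₂, -⟩ := hρ.exists_mem (x := x₂) ((o₆.inter (o₄.preimage (hcont g₂))).inter
      (o₅.preimage ((hcont g₂).comp (hcont g₂)))) ⟨⟨p₆, p₄⟩, p₅⟩
    have hn : ∀ {g c : G}, ¬ c = 1 → ¬ g * c * g⁻¹ = 1 := fun h e => h (by simpa using e)
    have n₁ := hρ.ne_one_of_mem hx₁
    have n₂ := hρ.ne_one_of_mem hx₂
    refine H c₁ c₂ (hs _ _ _ _ _ _ (hn n₁) (hn n₁) n₁ (hn n₂) (hn n₂) n₂ ?_ ?_ ?_ ?_ ?_ ?_)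
    · rw [hsq, Set.image_subset_iff]
      exact fun z hz => (hc₁ hz).2
    · rw [hρ.pvar_conj, Set.image_subset_iff]
      exact fun z hz => (hc₁ hz).1.2
    · exact fun z hz => (hc₁ hz).1.1
    · rw [hρ.pvar_conj, Set.image_subset_iff]
      exact fun z hz => (hc₂ hz).1.2
    · rw [hsq, Set.image_subset_iff]
      exact fun z hz => (hc₂ hz).2
    · exact fun z hz => (hc₂ hz).1.1
  · intro H c₁ c₂ hE
    obtain ⟨-, -, n₁, -, -, n₂, hE⟩ := hρ.eoA_iff.1 hE
    obtain ⟨x₁, hx₁, hD₁⟩ := hD.inter_open_nonempty _ (isOpen_pvar _) (hρ.pvar_nonempty n₁)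
    obtain ⟨x₂, hx₂, hD₂⟩ := hD.inter_open_nonempty _ (isOpen_pvar _) (hρ.pvar_nonempty n₂)
    simp only [hsq, hρ.pvar_conj] at hE
    have h := hE _ ⟨x₁, hx₁, rfl⟩ _ ⟨x₁, hx₁, rfl⟩ _ hx₁ _ ⟨x₂, hx₂, rfl⟩ _ ⟨x₂, hx₂, rfl⟩ _ hx₂
    have h' := H x₁ hD₁ x₂ hD₂ h.ne.2.2 h.symm.ne.2.1
    clear * - h h'
    simp only [Eo] at *
    grind [Cr]

theorem eo_emb {L : Type u} [LinearOrder L] [CircleBase L] {x₁ x₂ x₃ y₁ y₂ y₃ : L} :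
    Eo (emb x₁) (emb x₂) (emb x₃) (emb y₁) (emb y₂) (emb y₃) ↔ Eo x₁ x₂ x₃ y₁ y₂ y₃ := by
  simp only [Eo, cr_emb]

theorem MCGroup.sameSign_iff (K : MCGroup.{u}) {g₁ g₂ : K.G} :
    AlgSameSign g₁ g₂ ↔ SameSign (g₁ : Equiv.Perm K.L) (g₂ : Equiv.Perm K.L) := by
  have hb : ∀ (g : K.G) (x : K.L), K.ρ g (emb x) = emb ((g : Equiv.Perm K.L) x) := fun g x =>
    bar_emb (K.mc.le_autEO g.2) x
  rw [K.loc.algSameSign_iff (D := Set.range emb) denseRange_emb]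
  simp only [Set.forall_mem_range, hb, eo_emb, ne_eq, emb_injective.eq_iff, SameSign]

theorem foExpressible_signed :
    FOExpressible.{u} 1 fun L _ _ _ g => SignedElt (g 0 : Equiv.Perm L) := by
  refine foExpressible_of_def (P := fun M _ c => ¬ (c 0).1 0 * (c 0).1 0 = 1 ∧
    AlgSameSign ((c 0).1 0) ((c 0).1 0)) (and (not (eq_one ((var _ _).mul (var _ _))))
      (algSameSign.app (var _ _) (var _ _))) fun K c => ?_
  rw [K.sameSign_iff, Subtype.ext_iff]
  exact Iff.rfl

theorem foExpressible_sameSign : FOExpressible.{u} 2 fun L _ _ _ g =>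
    SignedElt (g 0 : Equiv.Perm L) ∧ SignedElt (g 1 : Equiv.Perm L) ∧
      SameSign (g 0 : Equiv.Perm L) (g 1 : Equiv.Perm L) := by
  refine foExpressible_of_def (P := fun M _ c => (¬ (c 0).1 0 * (c 0).1 0 = 1 ∧
    AlgSameSign ((c 0).1 0) ((c 0).1 0)) ∧ (¬ (c 1).1 0 * (c 1).1 0 = 1 ∧
    AlgSameSign ((c 1).1 0) ((c 1).1 0)) ∧ AlgSameSign ((c 0).1 0) ((c 1).1 0))
    (and (and (not (eq_one ((var _ _).mul (var _ _)))) (algSameSign.app (var _ _) (var _ _)))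
      (and (and (not (eq_one ((var _ _).mul (var _ _)))) (algSameSign.app (var _ _) (var _ _)))
        (algSameSign.app (var _ _) (var _ _)))) fun K c => ?_
  rw [K.sameSign_iff, K.sameSign_iff, K.sameSign_iff, Subtype.ext_iff, Subtype.ext_iff]
  exact Iff.rfl

theorem foExpressible_bddElt : FOExpressible.{u} 1 fun L _ _ _ g =>
    BddElt (g 0 : Equiv.Perm L) :=
  foExpressible_of_def (P := fun _ _ c => AlgBdd ((c 0).1 0)) (algBdd.app (var _ _))
    fun K _ => K.loc.algBdd_iff.trans (bddElt_iff _).symm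

theorem foExpressible_autCR : FOExpressible.{u} 1 fun L _ _ _ g =>
    (g 0 : Equiv.Perm L) ∈ autCR L :=
  foExpressible_of_def (P := fun _ _ c => OriPres ((c 0).1 0)) (oriPres.app (var _ _))
    fun K _ => K.oriPres_iff

namespace PointSys
variable {𝓛 : DefClass.{u}} {S : ∀ K : MCGroup.{u}, Set (CBar K.L)} (𝓢 : PointSys 𝓛 S)

/-- Two codes code points of the same orbit. -/
def SameOrbit (M : Type u) [Group M] (c c' : Code M) : Prop :=
  ∃ g, CodeAp g (𝓢.nbd M c) (𝓢.nbd M c')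

theorem sameOrbit_def {β : Type} (i j : β) : 𝓛.Def fun M _ κ => 𝓢.SameOrbit M (κ i) (κ j) :=
  ex_elt (𝓢.codeAp_def (var _ _) _ _)

theorem sameOrbit_iff {K : MCGroup.{u}} {c c' : Code K.G} {x y : CBar K.L}
    (hx : Conv K.ρ (𝓢.nbd K.G c) x) (hy : Conv K.ρ (𝓢.nbd K.G c') y) :
    𝓢.SameOrbit K.G c c' ↔ ∃ g ∈ K.G, bar g x = y := by
  constructor
  · rintro ⟨g, hg⟩
    exact ⟨g, g.2, (K.loc.codeAp_iff hx hy).1 hg⟩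
  · rintro ⟨g, hg, h⟩
    exact ⟨⟨g, hg⟩, (K.loc.codeAp_iff hx hy).2 h⟩

theorem transitive_def : 𝓛.Def (β := Fin 0) fun M _ _ =>
    ∀ c c', 𝓢.IsPt M c → 𝓢.IsPt M c' → 𝓢.SameOrbit M c c' :=
  all (all (𝓛.imp (𝓢.isPt_def _) (𝓛.imp (𝓢.isPt_def _) (𝓢.sameOrbit_def _ _))))

theorem transitive_iff (K : MCGroup.{u}) :
    (∀ c c', 𝓢.IsPt K.G c → 𝓢.IsPt K.G c' → 𝓢.SameOrbit K.G c c') ↔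
      ∀ x ∈ S K, ∀ y ∈ S K, ∃ g ∈ K.G, bar g x = y := by
  constructor
  · intro h x hx y hy
    obtain ⟨c, h₁, h₂, hc⟩ := 𝓢.complete K x hx
    obtain ⟨c', h₁', h₂', hc'⟩ := 𝓢.complete K y hy
    exact (𝓢.sameOrbit_iff hc hc').1 (h c c' ⟨h₁, h₂⟩ ⟨h₁', h₂'⟩)
  · intro h c c' hc hc'
    obtain ⟨x, hx, hcx⟩ := 𝓢.sound K c hc.2
    obtain ⟨y, hy, hcy⟩ := 𝓢.sound K c' hc'.2
    exact (𝓢.sameOrbit_iff hcx hcy).2 (h x hx y hy)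

/-- The proposition does not depend on the group, so it is constantly true or false. It is used for
the condition `i ≠ j` on indices. -/
theorem _root_.DefClass.const {β : Type} (p : Prop) : 𝓛.Def (β := β) fun _ _ _ => p := by
  by_cases h : p
  · exact congr tru fun _ _ _ => by simp [h]
  · exact congr 𝓛.fls fun _ _ _ => by simp [h]

/-- There are at least `k` orbits. -/
def AtLeast (k : ℕ) (M : Type u) [Group M] : Prop :=
  ∃ c : Fin k → Code M, (∀ i, 𝓢.IsPt M (c i)) ∧ ∀ i j, i ≠ j → ¬ 𝓢.SameOrbit M (c i) (c j)

theorem atLeast_def (k : ℕ) : 𝓛.Def (β := Fin 0) fun M _ _ => 𝓢.AtLeast k M :=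
  ex_fin (P := fun M _ κ => (∀ i, 𝓢.IsPt M (κ (Sum.inr i))) ∧
    ∀ i j, i ≠ j → ¬ 𝓢.SameOrbit M (κ (Sum.inr i)) (κ (Sum.inr j)))
    (and (all_fin fun _ => 𝓢.isPt_def _) (all_fin fun _ => all_fin fun _ =>
      𝓛.imp (DefClass.const _) (not (𝓢.sameOrbit_def _ _))))

end PointSys

theorem orbitOf_eq_iff {L : Type u} [LinearOrder L] [CircleBase L] {G : Subgroup (Equiv.Perm L)}
    (hG : G ≤ autEO L) {x y : CBar L} : orbitOf G x = orbitOf G y ↔ ∃ g ∈ G, bar g x = y := by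
  constructor
  · intro h
    have : y ∈ orbitOf G y := ⟨1, G.one_mem, by rw [bar_one, Equiv.Perm.one_apply]⟩
    rwa [← h] at this
  · rintro ⟨g, hg, rfl⟩
    ext z
    constructor
    · rintro ⟨h, hh, rfl⟩
      refine ⟨h * g⁻¹, G.mul_mem hh (G.inv_mem hg), ?_⟩
      rw [bar_mul (hG hh) (hG (G.inv_mem hg)), bar_inv (hG hg)]
      simp
    · rintro ⟨h, hh, rfl⟩
      exact ⟨h * g, G.mul_mem hh hg, by rw [bar_mul (hG hh) (hG hg)]; rfl⟩

theorem natCast_le_encard_iff {α : Type*} {s : Set α} {k : ℕ} :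
    (k : ℕ∞) ≤ s.encard ↔ ∃ f : Fin k → α, Function.Injective f ∧ ∀ i, f i ∈ s := by
  constructor
  · intro h
    obtain ⟨t, hts, ht⟩ := Set.exists_subset_encard_eq h
    have hfin : t.Finite := Set.finite_of_encard_eq_coe ht
    have hcard : hfin.toFinset.card = k := by
      rw [hfin.encard_eq_coe_toFinset_card] at ht
      exact_mod_cast ht
    let e := (hfin.toFinset.equivFinOfCardEq hcard).symm
    refine ⟨fun i => e i, fun i j hij => e.injective (Subtype.ext hij), fun i => hts ?_⟩
    exact hfin.mem_toFinset.1 (e i).2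
  · rintro ⟨f, hf, hs⟩
    calc (k : ℕ∞) = (Set.range f).encard := by
          rw [← Set.image_univ, hf.encard_image]
          simp [Set.encard_univ]
      _ ≤ s.encard := Set.encard_le_encard (Set.range_subset_iff.2 hs)

theorem PointSys.atLeast_iff {𝓛 : DefClass.{u}} (𝓢 : PointSys 𝓛 fun K => Ep K.G) (k : ℕ)
    (K : MCGroup.{u}) : 𝓢.AtLeast k K.G ↔ (k : ℕ∞) ≤ (epOrbits K.G).encard := by
  rw [natCast_le_encard_iff]
  have hG := K.mc.le_autEO
  constructor
  · rintro ⟨c, hc, hne⟩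
    choose x hx hcx using fun i => 𝓢.sound K (c i) (hc i).2
    refine ⟨fun i => orbitOf K.G (x i), fun i j hij => ?_, fun i => ⟨x i, hx i, rfl⟩⟩
    by_contra h
    exact hne i j h ((𝓢.sameOrbit_iff (hcx i) (hcx j)).2 ((orbitOf_eq_iff hG).1 hij))
  · rintro ⟨f, hf, hs⟩
    choose x hx hfx using hs
    choose c h₁ h₂ hc using fun i => 𝓢.complete K (x i) (hx i)
    refine ⟨c, fun i => ⟨h₁ i, h₂ i⟩, fun i j hij h => hij (hf ?_)⟩
    rw [hfx, hfx, orbitOf_eq_iff hG]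
    exact (𝓢.sameOrbit_iff (hc i) (hc j)).1 h

theorem foExpressible_transitive : FOExpressible.{u} 0 fun _ _ _ G _ =>
    ∀ x ∈ Ep G, ∀ y ∈ Ep G, ∃ g ∈ G, bar g x = y :=
  foExpressible_of_def (epSys foClass).transitive_def fun K _ => (epSys foClass).transitive_iff K

/-- Exactly `k` means at least `k` but not at least `k + 1`, and a lower bound on the number of
orbits is witnessed by finitely many codes. -/
theorem foExpressible_orbits (k : ℕ) : FOExpressible.{u} 0 fun _ _ _ G _ =>
    (epOrbits G).encard = k := by
  refine foExpressible_of_def (and ((epSys foClass).atLeast_def k)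
    (not ((epSys foClass).atLeast_def (k + 1)))) fun K _ => ?_
  rw [PointSys.atLeast_iff, PointSys.atLeast_iff]
  generalize (epOrbits K.G).encard = e
  induction e using ENat.recTopCoe with
  | top => simp
  | coe n => norm_cast; omega

/-- The group preserves C inside the completion. When it is transitive on C, therefore, completeness
of C amounts to transitivity on the completion, which is a second order property of the group. -/
theorem exists_soFormula_complete : ∃ ψ : SOFormula LGR (Fin 0) Empty.elim,
    ∀ (L : Type u) [LinearOrder L] [CircleBase L] (G : Subgroup (Equiv.Perm L)), IsMC 4 G →
      (∀ x y : L, ∃ g ∈ G, g x = y) →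
        (ψ.Sat (M := G) Fin.elim0 (fun X => X.elim) ↔
          Function.Surjective (emb : L → CBar L)) := by
  obtain ⟨ψ, hψ⟩ := soExpressible_of_def (univSys soClass soDef_mem).transitive_def
    (Q := fun L _ _ G _ => ∀ x ∈ (Set.univ : Set (CBar L)), ∀ y ∈ Set.univ,
      ∃ g ∈ G, bar g x = y) fun K _ => (univSys soClass soDef_mem).transitive_iff K
  refine ⟨ψ, fun L _ _ G hG ht => (hψ L G hG Fin.elim0).trans ?_⟩
  constructor
  · intro h y
    obtain ⟨a, -⟩ := (CircleBase.nontrivial (L := L)).exists_pair_ne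
    obtain ⟨g, hg, e⟩ := h (emb a) trivial y trivial
    exact ⟨g a, by rw [← e, bar_emb (hG.le_autEO hg)]⟩
  · intro h x _ y _
    obtain ⟨a, rfl⟩ := h x
    obtain ⟨b, rfl⟩ := h y
    obtain ⟨g, hg, e⟩ := ht a b
    exact ⟨g, hg, by rw [bar_emb (hG.le_autEO hg), e]⟩

end Expressibility

/-! ### Invariance of the predicates under isomorphisms -/

section Invariance

/-- The image of a code under an isomorphism. -/
def Code.map {M N : Type u} [Group M] [Group N] (e : M ≃* N) (c : Code M) : Code N :=
  (fun a => e (c.1 a), e '' c.2)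

theorem Code.map_surjective {M N : Type u} [Group M] [Group N] (e : M ≃* N) :
    Function.Surjective (Code.map e) := fun c =>
  ⟨c.map e.symm, Prod.ext (funext fun a => e.apply_symm_apply _) (by simp [Code.map, Set.image_image])⟩

/-- Invariance under isomorphisms. -/
def isoClass : DefClass.{u} where
  Def {β} P := ∀ (M N : Type u) [Group M] [Group N] (e : M ≃* N) (κ : β → Code M),
    P M κ ↔ P N fun i => (κ i).map e
  eq i j a b M N _ _ e κ := e.injective.eq_iff.symm
  mul i j k a b c M N _ _ e κ := by
    show _ ↔ e _ * e _ = e _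
    rw [← map_mul, e.injective.eq_iff]
  fls M N _ _ e κ := Iff.rfl
  imp hP hQ M N _ _ e κ := imp_congr (hP M N e κ) (hQ M N e κ)
  all_option {β P} hP M N _ _ e κ := by
    refine Iff.trans ?_ (Code.map_surjective e).forall.symm
    refine forall_congr' fun c => (hP M N e _).trans (iff_of_eq (congrArg _ (funext ?_)))
    rintro (_ | i) <;> rfl
  reindex f hP M N _ _ e κ := hP M N e fun i => κ (f i)

theorem isoClass_hasMem : isoClass.{u}.HasMem := fun _ _ _ _ _ _ _ e _ =>
  e.injective.mem_set_image.symm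

variable {M N : Type u} [Group M] [Group N] (e : M ≃* N)

/-- Invariance is definability in `isoClass`, so this and the following statements are instances of
the definability proofs. -/
theorem algBdd_map {g : M} : AlgBdd (e g) ↔ AlgBdd g :=
  ((DefClass.algBdd (𝓛 := isoClass)).app (DefClass.var () 0) M N e fun _ => (fun _ => g, ∅)).symm

theorem oriPres_map {g : M} : OriPres (e g) ↔ OriPres g :=
  ((DefClass.oriPres (𝓛 := isoClass)).app (DefClass.var () 0) M N e fun _ => (fun _ => g, ∅)).symm

theorem validSet_map {S : Set M} : ValidSet (e '' S) ↔ ValidSet S :=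
  (DefClass.validSet isoClass_hasMem () M N e fun _ => (fun _ => 1, S)).symm

theorem codeAp_map {g : M} {R S : Set M} : CodeAp (e g) (e '' R) (e '' S) ↔ CodeAp g R S :=
  ((univSys isoClass isoClass_hasMem).codeAp_def (DefClass.var (0 : Fin 3) 0) 1 2 M N e
    ![(fun _ => g, ∅), (fun _ => 1, R), (fun _ => 1, S)]).symm

theorem codeEo_map {R S : Fin 3 → Set M} :
    CodeEo (e '' R 0) (e '' R 1) (e '' R 2) (e '' S 0) (e '' S 1) (e '' S 2) ↔
      CodeEo (R 0) (R 1) (R 2) (S 0) (S 1) (S 2) :=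
  ((univSys isoClass isoClass_hasMem).codeEo_def (Sum.inl (0 : Fin 3)) (Sum.inl 1) (Sum.inl 2)
    (Sum.inr (0 : Fin 3)) (Sum.inr 1) (Sum.inr 2) M N e
    (Sum.elim (fun i => (fun _ => 1, R i)) fun i => (fun _ => 1, S i))).symm

end Invariance

/-! ### The point map induced by an isomorphism of groups -/

section Reconstruction
variable {X Y : Type*} [LinearOrder X] [LinearOrder Y] [TopologicalSpace X] [TopologicalSpace Y]
  [CircTop X] [CircTop Y]

section
variable {G : Type*} [Group G] {ρ : G →* Equiv.Perm X}

/-- Only the identity commutes with the group. -/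
theorem LocAct.eq_one_of_commute (hρ : LocAct ρ) {σ : Equiv.Perm X}
    (h : ∀ g, σ * ρ g * σ⁻¹ = ρ g) : σ = 1 := by
  ext x
  by_contra hne
  obtain ⟨U, V, hU, hV, hxU, hxV, hd⟩ := t2_separation hne
  obtain ⟨a, b, hab, hs⟩ := exists_arc_subset hV hxV
  obtain ⟨c, d, hcd, hs'⟩ := exists_arc_subset hU hxU
  obtain ⟨g, hg, hgx⟩ := hρ.loc hab
  have : σ x ∈ psupp (ρ g) := by
    rw [← h g, psupp_conj]
    exact ⟨x, hgx, rfl⟩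
  exact hd.le_bot ⟨hxU, hs (hg this)⟩

end

variable {G₁ G₂ : Type u} [Group G₁] [Group G₂] {ρ₁ : G₁ →* Equiv.Perm X}
  {ρ₂ : G₂ →* Equiv.Perm Y}

/-- The correspondence of points that is given by an isomorphism of the groups. -/
theorem LocAct.exists_conv_image (h₁ : LocAct ρ₁) (h₂ : LocAct ρ₂) (α : G₁ ≃* G₂) (x : X) :
    ∃ y, Conv ρ₂ (α '' {g | x ∈ pvar (ρ₁ g)}) y :=
  h₂.exists_conv_of_validSet ((validSet_map α).2 (h₁.validSet_pvar x))

theorem LocAct.apply_iff_of_conv (h₁ : LocAct ρ₁) (h₂ : LocAct ρ₂) (α : G₁ ≃* G₂) {R S : Set G₁}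
    {x x' : X} {y y' : Y} (hx : Conv ρ₁ R x) (hy : Conv ρ₂ (α '' R) y) (hx' : Conv ρ₁ S x')
    (hy' : Conv ρ₂ (α '' S) y') (g : G₁) : ρ₁ g x = x' ↔ ρ₂ (α g) y = y' := by
  rw [← h₁.codeAp_iff hx hx', ← h₂.codeAp_iff hy hy', codeAp_map]

/-- A point `x` is sent to the limit of the image of its canonical code. Invariance of `CodeAp`
gives equivariance and, for the identity element, shows that the limit does not depend on the code;
bijectivity follows by using the inverse isomorphism. Invariance of `CodeEo` gives monocircularity.
-/
theorem LocAct.exists_inducing (h₁ : LocAct ρ₁) (h₂ : LocAct ρ₂) (α : G₁ ≃* G₂) :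
    ∃ τ : X ≃ Y, Monocircular τ ∧ ∀ g x, τ (ρ₁ g x) = ρ₂ (α g) (τ x) := by
  choose F hF using h₁.exists_conv_image h₂ α
  have hinj : Function.Injective F := by
    intro x x' hxx
    have := (h₁.apply_iff_of_conv h₂ α (h₁.conv_pvar x) (hF x) (h₁.conv_pvar x') (hF x') 1).2
      (by simpa using hxx)
    simpa using this
  have hsurj : Function.Surjective F := by
    intro y
    obtain ⟨x, hx⟩ := h₂.exists_conv_image h₁ α.symm y
    refine ⟨x, ?_⟩
    have hR : Conv ρ₂ (α '' (α.symm '' {g | y ∈ pvar (ρ₂ g)})) y := by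
      rw [Set.image_image]
      simpa using h₂.conv_pvar y
    have := (h₁.apply_iff_of_conv h₂ α (h₁.conv_pvar x) (hF x) hx hR 1).1 (by simp)
    simpa using this
  refine ⟨Equiv.ofBijective F ⟨hinj, hsurj⟩, preservesEo_iff.1 ?_, fun g x => ?_⟩
  · intro x₁ x₂ x₃ y₁ y₂ y₃
    have c := fun x => h₁.conv_pvar x
    rw [← h₁.codeEo_iff (c x₁) (c x₂) (c x₃) (c y₁) (c y₂) (c y₃)]
    refine Iff.trans ?_ (h₂.codeEo_iff (hF x₁) (hF x₂) (hF x₃) (hF y₁) (hF y₂) (hF y₃))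
    exact (codeEo_map α (R := ![_, _, _]) (S := ![_, _, _])).symm
  · exact ((h₁.apply_iff_of_conv h₂ α (h₁.conv_pvar x) (hF x) (h₁.conv_pvar _) (hF _) g).1
      rfl).symm

/-- One of two inducing maps followed by the inverse of the other centralizes the group, and so is
the identity. -/
theorem LocAct.inducing_unique (h₁ : LocAct ρ₁) {α : G₁ ≃* G₂} {τ τ' : X ≃ Y}
    (h : ∀ g x, τ (ρ₁ g x) = ρ₂ (α g) (τ x)) (h' : ∀ g x, τ' (ρ₁ g x) = ρ₂ (α g) (τ' x)) :
    τ = τ' := by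
  have := h₁.eq_one_of_commute (σ := τ.trans τ'.symm) fun g => by
    refine mul_inv_eq_of_eq_mul (Equiv.ext fun x => ?_)
    show τ'.symm (τ (ρ₁ g x)) = ρ₁ g (τ'.symm (τ x))
    rw [Equiv.symm_apply_eq, h', h, τ'.apply_symm_apply]
  ext x
  exact (Equiv.symm_apply_eq _).1 (congrArg (fun e : Equiv.Perm X => e x) this)

end Reconstruction

/-! ### Consequences for two groups -/

section TwoGroups
variable {L₁ L₂ : Type u} [LinearOrder L₁] [LinearOrder L₂] [CircleBase L₁] [CircleBase L₂]
  {G₁ : Subgroup (Equiv.Perm L₁)} {G₂ : Subgroup (Equiv.Perm L₂)}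

theorem induces_iff {τ : CBar L₁ ≃ CBar L₂} {α : G₁ ≃* G₂} : Induces τ α ↔
    ∀ (g : G₁) x, τ (bar (g : Equiv.Perm L₁) x) = bar (α g : Equiv.Perm L₂) (τ x) := by
  constructor
  · intro h g x
    rw [h g]
    simp
  · intro h g
    ext y
    simpa using (h g (τ.symm y)).symm

theorem IsMC.existsUnique_inducing (h₁ : IsMC 4 G₁) (h₂ : IsMC 4 G₂) (α : G₁ ≃* G₂) :
    ∃! τ : CBar L₁ ≃ CBar L₂, Monocircular τ ∧ Induces τ α := by
  obtain ⟨τ, hτ, h⟩ := h₁.locAct.exists_inducing h₂.locAct α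
  exact ⟨τ, ⟨hτ, induces_iff.2 h⟩, fun τ' h' =>
    h₁.locAct.inducing_unique (ρ₂ := barHom h₂.le_autEO) (induces_iff.1 h'.2) h⟩

theorem Induces.symm {τ : CBar L₁ ≃ CBar L₂} {α : G₁ ≃* G₂} (h : Induces τ α) :
    Induces τ.symm α.symm := by
  rw [induces_iff] at *
  intro g x
  rw [τ.symm_apply_eq, h, α.apply_symm_apply, τ.apply_symm_apply]

theorem relMap_sumMap {S₁ : Set (CBar L₁)} {S₂ : Set (CBar L₂)} {τ : CBar L₁ ≃ CBar L₂}
    {α : G₁ ≃* G₂} (hτ : PreservesEo τ) (hα : Induces τ α) (hS : ∀ x, x ∈ S₁ ↔ τ x ∈ S₂) {n : ℕ}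
    (r : LMCPG.Relations n) (v : Fin n → Act S₁ G₁)
    (h : FirstOrder.Language.Structure.RelMap r v) :
    FirstOrder.Language.Structure.RelMap (M := Act S₂ G₂) r
      fun i => Equiv.sumCongr (τ.subtypeEquiv hS) α.toEquiv (v i) := by
  cases r
  · obtain ⟨x₁, x₂, x₃, y₁, y₂, y₃, e₁, e₂, e₃, e₄, e₅, e₆, h⟩ := h
    refine ⟨_, _, _, _, _, _, congrArg _ e₁, congrArg _ e₂, congrArg _ e₃, congrArg _ e₄,
      congrArg _ e₅, congrArg _ e₆, (hτ _ _ _ _ _ _).1 h⟩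
  · obtain ⟨g, h, k, e₁, e₂, e₃, h'⟩ := h
    exact ⟨_, _, _, congrArg _ e₁, congrArg _ e₂, congrArg _ e₃,
      (map_mul α g h).symm.trans (congrArg α h')⟩
  · obtain ⟨g, x, y, e₁, e₂, e₃, h'⟩ := h
    exact ⟨_, _, _, congrArg _ e₁, congrArg _ e₂, congrArg _ e₃,
      (induces_iff.1 hα g x).symm.trans (congrArg τ h')⟩
  · obtain ⟨x, e⟩ := h
    exact ⟨_, congrArg _ e⟩
  · obtain ⟨x, e⟩ := h
    exact ⟨_, congrArg _ e⟩

theorem unionIsIso {S₁ : Set (CBar L₁)} {S₂ : Set (CBar L₂)} {τ : CBar L₁ ≃ CBar L₂}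
    {α : G₁ ≃* G₂} (hτ : PreservesEo τ) (hα : Induces τ α) (hS : ∀ x, x ∈ S₁ ↔ τ x ∈ S₂) :
    UnionIsIso S₁ S₂ τ α := by
  refine ⟨⟨Equiv.sumCongr (τ.subtypeEquiv hS) α.toEquiv, fun f => Empty.elim f, fun r v => ?_⟩,
    fun x => ⟨_, rfl, rfl⟩, fun g => rfl⟩
  refine ⟨fun h => ?_, relMap_sumMap hτ hα hS r v⟩
  have := relMap_sumMap (preservesEo_iff.2 (preservesEo_iff.1 hτ).symm) hα.symm
    (fun x => by rw [hS, τ.apply_symm_apply]) r _ h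
  exact (congrArg (FirstOrder.Language.Structure.RelMap (M := Act S₁ G₁) r) (funext fun i =>
    (Equiv.sumCongr (τ.subtypeEquiv hS) α.toEquiv).symm_apply_apply (v i))).mp this

theorem UnionIsIso.induces {τ : CBar L₁ ≃ CBar L₂} {α : G₁ ≃* G₂}
    (h : UnionIsIso Set.univ Set.univ τ α) : Induces τ α := by
  obtain ⟨e, h₁, h₂⟩ := h
  refine induces_iff.2 fun g x => ?_
  have key := (e.map_rel McRel.ap ![Act.ofGrp g, Act.ofPt ⟨x, trivial⟩,
    Act.ofPt ⟨bar (g : Equiv.Perm L₁) x, trivial⟩]).2 ⟨g, _, _, rfl, rfl, rfl, rfl⟩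
  obtain ⟨k, y, z, e₁, e₂, e₃, h'⟩ := key
  obtain ⟨y', hy, hy'⟩ := h₁ ⟨x, trivial⟩
  obtain ⟨z', hz, hz'⟩ := h₁ ⟨bar (g : Equiv.Perm L₁) x, trivial⟩
  obtain rfl := Sum.inl_injective (hy.symm.trans e₂)
  obtain rfl := Sum.inl_injective (hz.symm.trans e₃)
  obtain rfl := Sum.inr_injective ((h₂ g).symm.trans e₁)
  rw [← hy', ← hz', h']

section Correspondence
variable {τ : CBar L₁ ≃ CBar L₂} {α : G₁ ≃* G₂} (hτ : Monocircular τ) (hα : Induces τ α)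
include hτ hα

theorem Induces.gVar_image (g : G₁) : τ '' gVar (g : Equiv.Perm L₁) = gVar (α g : Equiv.Perm L₂) := by
  unfold gVar
  rw [hτ.pvar_image]
  congr 2
  ext y
  rw [τ.image_eq_preimage_symm]
  simp only [Set.mem_preimage, cSupp, Set.mem_ofPred_eq, ne_eq]
  rw [← τ.injective.eq_iff, induces_iff.1 hα, τ.apply_symm_apply]

/-- The map is a homeomorphism taking var(g) to var(α g), and endpoints are defined topologically
from these sets. -/
theorem Induces.image_ep_subset : τ '' Ep G₁ ⊆ Ep G₂ := by
  rintro _ ⟨p, ⟨g, hg, x, hx, hp⟩, rfl⟩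
  let f : CBar L₁ ≃ₜ CBar L₂ := hτ.homeo
  have hU : f '' interior (gVar g)ᶜ = interior (gVar (α ⟨g, hg⟩ : Equiv.Perm L₂))ᶜ := by
    rw [f.image_interior, f.image_compl, ← hα.gVar_image hτ]
    rfl
  refine ⟨α ⟨g, hg⟩, (α ⟨g, hg⟩).2, τ x, ?_, ?_⟩
  · rw [← hU]
    exact ⟨x, hx, rfl⟩
  · have : f p ∈ f '' frontier (connectedComponentIn (interior (gVar g)ᶜ) x) := ⟨p, hp, rfl⟩
    rw [f.image_frontier, f.image_connectedComponentIn hx, hU] at this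
    exact this

theorem Induces.mem_ep_iff (x : CBar L₁) : x ∈ Ep G₁ ↔ τ x ∈ Ep G₂ := by
  refine ⟨fun h => hα.image_ep_subset hτ ⟨x, h, rfl⟩, fun h => ?_⟩
  have := hα.symm.image_ep_subset hτ.symm ⟨_, h, rfl⟩
  rwa [τ.symm_apply_apply] at this

omit hτ in
theorem Induces.image_orbitOf (x : CBar L₁) : τ '' orbitOf G₁ x = orbitOf G₂ (τ x) := by
  ext y
  constructor
  · rintro ⟨_, ⟨g, hg, rfl⟩, rfl⟩
    exact ⟨α ⟨g, hg⟩, (α ⟨g, hg⟩).2, (induces_iff.1 hα ⟨g, hg⟩ x).symm⟩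
  · rintro ⟨g, hg, rfl⟩
    refine ⟨_, ⟨α.symm ⟨g, hg⟩, (α.symm ⟨g, hg⟩).2, rfl⟩, ?_⟩
    rw [induces_iff.1 hα, α.apply_symm_apply]

theorem Induces.orbitCorrespondence : OrbitCorrespondence τ α := by
  have he : ∀ M, Equivariant (τ.image M) α := by
    rintro M g ⟨x, hx⟩ ⟨y, hy⟩
    show bar (g : Equiv.Perm L₁) x = y ↔ bar (α g : Equiv.Perm L₂) (τ x) = τ y
    rw [← induces_iff.1 hα, τ.injective.eq_iff]
  refine ⟨⟨?_, τ.injective.image_injective.injOn, ?_⟩, ?_⟩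
  · rintro _ ⟨x, rfl⟩
    exact ⟨τ x, hα.image_orbitOf x⟩
  · rintro _ ⟨x, rfl⟩
    refine ⟨_, ⟨τ.symm x, rfl⟩, ?_⟩
    rw [← τ.apply_symm_apply x]
    simpa using hα.image_orbitOf (τ.symm x)
  · exact hτ.imp (fun h => ⟨h, fun M _ => ⟨fun x y z => h x y z, he M⟩⟩)
      fun h => ⟨h, fun M _ => ⟨fun x y z => h x y z, he M⟩⟩

end Correspondence

end TwoGroups

/-! ### Automorphism groups as groups of conjugations -/

section Conjugation
variable {H P : Type*} [Group H] [Group P] {ι : H →* P}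

theorem mem_normalizer_range_of_conj {α : H ≃* H} {τ : P} (h : ∀ g, ι (α g) = τ * ι g * τ⁻¹) :
    τ ∈ Subgroup.normalizer (Set.range ι) := by
  intro p
  constructor
  · rintro ⟨g, rfl⟩
    exact ⟨α g, h g⟩
  · rintro ⟨g, hg⟩
    refine ⟨α.symm g, ?_⟩
    have := h (α.symm g)
    rw [α.apply_symm_apply, hg] at this
    simpa using this.symm

/-- If every automorphism is conjugation by exactly one element of a group of normalizing elements,
then conjugation is an isomorphism of this group with the automorphism group. -/
theorem exists_conjEquiv (hι : Function.Injective ι) {K : Subgroup P}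
    (hK : K ≤ Subgroup.normalizer (Set.range ι))
    (h : ∀ α : H ≃* H, ∃! τ, τ ∈ K ∧ ∀ g, ι (α g) = τ * ι g * τ⁻¹) :
    ∃ Φ : K ≃* MulAut H, ∀ (τ : K) (g : H), ι (Φ τ g) = (τ : P) * ι g * (τ : P)⁻¹ := by
  -- The map from automorphisms to conjugating elements is constructed, and the required isomorphism
  -- is its inverse. Uniqueness of the conjugating element makes it multiplicative.
  choose f hf hu using h
  let F : MulAut H →* K :=
    { toFun := fun α => ⟨f α, (hf α).1⟩
      map_one' := Subtype.ext (hu 1 1 ⟨one_mem _, fun g => by simp⟩).symm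
      map_mul' := fun α β => Subtype.ext (hu (α * β) (f α * f β)
        ⟨mul_mem (hf α).1 (hf β).1, fun g => by
          rw [MulAut.mul_apply, (hf α).2, (hf β).2, mul_inv_rev]
          simp only [mul_assoc]⟩).symm }
  have hF : Function.Bijective F := by
    constructor
    · intro α β hαβ
      have hαβ : f α = f β := congrArg Subtype.val hαβ
      ext g
      exact hι (by rw [(hf α).2, (hf β).2, hαβ])
    · rintro ⟨τ, hτ⟩
      choose a ha using fun g => ((hK hτ) (ι g)).1 ⟨g, rfl⟩
      choose b hb using fun g => ((inv_mem (hK hτ)) (ι g)).1 ⟨g, rfl⟩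
      let α : H ≃* H :=
        { toFun := a
          invFun := b
          left_inv := fun g => hι (by rw [hb, ha]; group)
          right_inv := fun g => hι (by rw [ha, hb]; group)
          map_mul' := fun g k => hι (by rw [ha, map_mul, map_mul, ha, ha]; group) }
      exact ⟨α, Subtype.ext (hu α τ ⟨hτ, ha⟩).symm⟩
  refine ⟨(MulEquiv.ofBijective F hF).symm, fun τ g => ?_⟩
  have := (hf ((MulEquiv.ofBijective F hF).symm τ)).2 g
  have e : f ((MulEquiv.ofBijective F hF).symm τ) = τ :=
    congrArg Subtype.val ((MulEquiv.ofBijective F hF).apply_symm_apply τ)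
  rwa [e] at this

end Conjugation

/-! ### Consequences for one group -/

section OneGroup
variable {L : Type u} [LinearOrder L] [CircleBase L] {G H : Subgroup (Equiv.Perm L)}

theorem induces_iff_conj {τ : Equiv.Perm (CBar L)} {α : G ≃* G} : Induces τ α ↔
    ∀ g : G, bar (α g : Equiv.Perm L) = τ * bar (g : Equiv.Perm L) * τ⁻¹ := Iff.rfl

theorem range_barHom (hG : G ≤ autEO L) :
    Set.range (barHom hG) = bar '' (G : Set (Equiv.Perm L)) := by
  ext p
  constructor
  · rintro ⟨g, rfl⟩
    exact ⟨g, g.2, rfl⟩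
  · rintro ⟨g, hg, rfl⟩
    exact ⟨⟨g, hg⟩, rfl⟩

theorem normAut_eq_normHomeo (G : Subgroup (Equiv.Perm L)) : normAut G = normHomeo G := by
  have : autEO (CBar L) = homeoGroup L := Subgroup.ext fun _ => preservesEo_iff_homeo
  rw [normAut, normHomeo, this]

theorem IsMC.existsUnique_conj (h : IsMC 4 G) (α : G ≃* G) :
    ∃! τ : Equiv.Perm (CBar L), τ ∈ autEO (CBar L) ∧ Induces τ α := by
  simpa only [mem_autEO_cBar_iff] using h.existsUnique_inducing h α

theorem IsMC.autEq_normAut (h : IsMC 4 G) : AutEq G (normAut G) := by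
  refine exists_conjEquiv (ι := barHom h.le_autEO) (barHom_injective _) ?_ fun α => ?_
  · rw [range_barHom]
    exact inf_le_right
  · obtain ⟨τ, ⟨h₁, h₂⟩, hu⟩ := h.existsUnique_conj α
    refine ⟨τ, ⟨⟨h₁, ?_⟩, h₂⟩, fun τ' h' => hu τ' ⟨h'.1.1, h'.2⟩⟩
    rw [← range_barHom h.le_autEO]
    exact mem_normalizer_range_of_conj (ι := barHom h.le_autEO) h₂

/-! ### Subgroups with small supports -/

theorem IsMC.exists_moving (h : IsMC 4 G) {a b p : CBar L} (hp : Cr a p b) :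
    ∃ g ∈ G, psupp (bar g) ⊆ arc a b ∧ bar g p ≠ p := by
  obtain ⟨g, h₁, h₂⟩ := h.locAct.loc hp
  exact ⟨g, g.2, h₁, h₂⟩

theorem isMC_of_exists_moving (hG : G ≤ autEO L)
    (h : ∀ {a b p : CBar L}, Cr a p b → ∃ g ∈ G, psupp (bar g) ⊆ arc a b ∧ bar g p ≠ p) :
    IsMC 4 G :=
  LocAct.isMC (hG := hG) ⟨barHom_injective _, fun g => bar_monocircular (hG g.2), fun hp => by
    obtain ⟨g, hg, h₁, h₂⟩ := h hp
    exact ⟨⟨g, hg⟩, h₁, h₂⟩⟩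

theorem bdd_le (G : Subgroup (Equiv.Perm L)) : bdd G ≤ G :=
  (Subgroup.closure_le _).2 fun _ h => h.1

theorem bddDer_le (G : Subgroup (Equiv.Perm L)) : bddDer G ≤ bdd G :=
  Subgroup.commutator_le.2 fun _ h _ h' => by
    rw [commutatorElement_def]
    exact mul_mem (mul_mem (mul_mem h h') (inv_mem h)) (inv_mem h')

theorem IsMC.opp (h : IsMC 4 G) : IsMC 4 (opp G) :=
  isMC_of_exists_moving (inf_le_left.trans h.le_autEO) fun hp => by
    obtain ⟨g, hg, h₁, h₂⟩ := h.exists_moving hp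
    have hg' := h.le_autEO hg
    exact ⟨g, ⟨hg, (mem_autCR_iff hg').2
      (preservesCr_of_psupp_subset (bar_monocircular hg') hp.ne₁₃ h₁)⟩, h₁, h₂⟩

theorem IsMC.bdd (h : IsMC 4 G) : IsMC 4 (bdd G) :=
  isMC_of_exists_moving ((bdd_le G).trans h.le_autEO) fun {a b p} hp => by
    obtain ⟨g, hg, h₁, h₂⟩ := h.exists_moving hp
    exact ⟨g, Subgroup.subset_closure ⟨hg, (bddElt_iff g).2 ⟨a, b, hp.ne₁₃, h₁⟩⟩, h₁, h₂⟩

/-- Let `r` be supported in the given arc and move `p`, and let `s` be supported in a neighbourhood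
of `p` that `r` displaces, and also move `p`. Their commutator is supported in the arc and acts on
`p` as `s`. -/
theorem IsMC.bddDer (h : IsMC 4 G) : IsMC 4 (bddDer G) :=
  isMC_of_exists_moving (((bddDer_le G).trans (bdd_le G)).trans h.le_autEO) fun {a b p} hp => by
    have hB := h.bdd
    obtain ⟨r, hr, h₁, h₂⟩ := hB.exists_moving hp
    obtain ⟨V, hV, hpV, hVa, hd⟩ := hB.locAct.exists_disjoint_image (f := ⟨r, hr⟩) (U := arc a b) h₂
      (isOpen_arc a b) hp
    obtain ⟨c, d, hcd, hs⟩ := exists_arc_subset hV hpV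
    obtain ⟨s, hs', h₃, h₄⟩ := hB.exists_moving hcd
    have mr := hB.le_autEO hr
    have ms := hB.le_autEO hs'
    -- The second factor is a conjugate of the inverse of `s`, supported in the displaced
    -- neighbourhood, and thus fixes `p`.
    have e : bar (s * r * s⁻¹ * r⁻¹) = bar s * (bar r * (bar s)⁻¹ * (bar r)⁻¹) := by
      rw [bar_mul (mul_mem (mul_mem ms mr) (inv_mem ms)) (inv_mem mr),
        bar_mul (mul_mem ms mr) (inv_mem ms), bar_mul ms mr, bar_inv ms, bar_inv mr]
      simp only [mul_assoc]
    have hsV : psupp (bar s) ⊆ V := h₃.trans hs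
    have hc : psupp (bar r * (bar s)⁻¹ * (bar r)⁻¹) ⊆ bar r '' V := by
      rw [psupp_conj, psupp_inv]
      exact Set.image_mono hsV
    refine ⟨s * r * s⁻¹ * r⁻¹, Subgroup.commutator_mem_commutator hs' hr, ?_, ?_⟩
    · rw [e]
      refine (psupp_mul_subset _ _).trans (Set.union_subset (hsV.trans hVa) (hc.trans ?_))
      rintro _ ⟨x, hx, rfl⟩
      exact apply_mem_arc (bar_monocircular mr) h₁ (hVa hx)
    · rw [e, Equiv.Perm.mul_apply,
        fixed_of_psupp_subset hc fun h' => hd.le_bot ⟨hpV, h'⟩]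
      exact h₄

/-! ### Characteristic subgroups -/

theorem IsMC.bddElt_map (h : IsMC 4 G) (α : G ≃* G) {g : G} :
    BddElt (α g : Equiv.Perm L) ↔ BddElt (g : Equiv.Perm L) := by
  rw [bddElt_iff, bddElt_iff]
  exact (h.locAct.algBdd_iff (b := α g)).symm.trans ((algBdd_map α).trans h.locAct.algBdd_iff)

theorem bdd_subgroupOf : (bdd G).subgroupOf G =
    Subgroup.closure {g : G | BddElt (g : Equiv.Perm L)} := by
  rw [← Subgroup.comap_map_eq_self_of_injective G.subtype_injective (Subgroup.closure _),
    MonoidHom.map_closure]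
  unfold Subgroup.subgroupOf _root_.bdd
  congr 2
  ext g
  exact ⟨fun h => ⟨⟨g, h.1⟩, h.2, rfl⟩, by rintro ⟨g, hg, rfl⟩; exact ⟨g.2, hg⟩⟩

/-- Automorphisms permute the generators, because boundedness is a group-theoretic property. -/
theorem IsMC.characteristic_bdd (h : IsMC 4 G) : ((_root_.bdd G).subgroupOf G).Characteristic := by
  rw [bdd_subgroupOf, Subgroup.characteristic_iff_map_le]
  intro α
  rw [MonoidHom.map_closure]
  refine Subgroup.closure_mono ?_
  rintro _ ⟨g, hg, rfl⟩
  exact (h.bddElt_map α).2 hg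

theorem IsMC.characteristic_bddDer (h : IsMC 4 G) :
    ((_root_.bddDer G).subgroupOf G).Characteristic := by
  have : (_root_.bddDer G).subgroupOf G =
      ⁅(_root_.bdd G).subgroupOf G, (_root_.bdd G).subgroupOf G⁆ := by
    refine Subgroup.map_injective G.subtype_injective ?_
    rw [Subgroup.map_commutator, Subgroup.subgroupOf_map_subtype, Subgroup.subgroupOf_map_subtype,
      inf_eq_left.2 (bdd_le G), inf_eq_left.2 ((bddDer_le G).trans (bdd_le G))]
    rfl
  have := h.characteristic_bdd
  simp only [*]
  infer_instance

theorem IsMC.characteristic_opp (h : IsMC 4 G) : ((_root_.opp G).subgroupOf G).Characteristic := by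
  have key : ∀ g : G, g ∈ (_root_.opp G).subgroupOf G ↔ OriPres g := fun g =>
    ((MCGroup.mk' h).oriPres_iff.trans (by simp [_root_.opp, Subgroup.mem_subgroupOf]; rfl)).symm
  rw [Subgroup.characteristic_iff_map_le]
  rintro α _ ⟨g, hg, rfl⟩
  exact (key _).2 ((oriPres_map α).2 ((key g).1 hg))

/-! ### Normalizers -/

/-- The extensions of the elements of a group to the completion. -/
noncomputable def barGroup (H : Subgroup (Equiv.Perm L)) : Subgroup (Equiv.Perm (CBar L)) :=
  (H.subgroupOf (autEO L)).map (barHom le_rfl)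

theorem mem_barGroup (hH : H ≤ autEO L) {p : Equiv.Perm (CBar L)} :
    p ∈ barGroup H ↔ ∃ h ∈ H, bar h = p := by
  constructor
  · rintro ⟨h, hh, rfl⟩
    exact ⟨h, hh, rfl⟩
  · rintro ⟨h, hh, rfl⟩
    exact ⟨⟨h, hH hh⟩, hh, rfl⟩

theorem mem_normAut_iff (hH : H ≤ autEO L) {τ : Equiv.Perm (CBar L)} :
    τ ∈ normAut H ↔ τ ∈ autEO (CBar L) ∧ (barGroup H).map (MulAut.conj τ).toMonoidHom = barGroup H := by
  have : bar '' (H : Set (Equiv.Perm L)) = barGroup H := by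
    ext p
    exact (mem_barGroup hH).symm
  rw [normAut, this, Subgroup.mem_inf]
  exact and_congr_right fun _ => Subgroup.mem_normalizer_iff_map_conj_eq

theorem PBdd.conj {X : Type*} [LinearOrder X] [TopologicalSpace X] [CircTop X] {f τ : Equiv.Perm X}
    (hf : PBdd f) (hτ : Monocircular τ) : PBdd (τ * f * τ⁻¹) := by
  obtain ⟨a, b, hab, h⟩ := hf
  obtain ⟨c, d, hcd, e⟩ := hτ.image_arc a b
  exact ⟨c, d, hcd hab, by rw [psupp_conj, ← e]; exact Set.image_mono h⟩

theorem barGroup_bdd (hG : G ≤ autEO L) :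
    barGroup (bdd G) = Subgroup.closure {p | p ∈ barGroup G ∧ PBdd p} := by
  have : (bdd G).subgroupOf (autEO L) =
      Subgroup.closure {g : autEO L | (g : Equiv.Perm L) ∈ G ∧ BddElt (g : Equiv.Perm L)} := by
    rw [← Subgroup.comap_map_eq_self_of_injective (autEO L).subtype_injective (Subgroup.closure _),
      MonoidHom.map_closure]
    unfold Subgroup.subgroupOf _root_.bdd
    congr 2
    ext g
    exact ⟨fun h => ⟨⟨g, hG h.1⟩, h, rfl⟩, by rintro ⟨g, hg, rfl⟩; exact hg⟩
  rw [barGroup, this, MonoidHom.map_closure]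
  congr 1
  ext p
  constructor
  · rintro ⟨g, hg, rfl⟩
    exact ⟨⟨g, hg.1, rfl⟩, (bddElt_iff _).1 hg.2⟩
  · rintro ⟨⟨g, hg, rfl⟩, hp⟩
    exact ⟨g, ⟨hg, (bddElt_iff _).2 hp⟩, rfl⟩

theorem barGroup_bddDer (hG : G ≤ autEO L) :
    barGroup (bddDer G) = ⁅barGroup (bdd G), barGroup (bdd G)⁆ := by
  have h := (bdd_le G).trans hG
  rw [barGroup, barGroup, ← Subgroup.map_commutator]
  congr 1
  refine Subgroup.map_injective (autEO L).subtype_injective ?_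
  rw [Subgroup.map_commutator, Subgroup.subgroupOf_map_subtype, Subgroup.subgroupOf_map_subtype,
    inf_eq_left.2 h, inf_eq_left.2 ((bddDer_le G).trans h)]
  rfl

/-- Conjugation by a monocircular map carries arcs to arcs, so it preserves boundedness and permutes
the generators of Bdd(G). -/
theorem normAut_le_normAut_bdd (hG : G ≤ autEO L) : normAut G ≤ normAut (bdd G) := by
  intro τ hτ
  obtain ⟨h₁, h₂⟩ := (mem_normAut_iff hG).1 hτ
  have hm := mem_autEO_cBar_iff.1 h₁
  refine (mem_normAut_iff ((bdd_le G).trans hG)).2 ⟨h₁, ?_⟩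
  rw [barGroup_bdd hG, MonoidHom.map_closure]
  congr 1
  ext p
  constructor
  · rintro ⟨q, ⟨hq, hq'⟩, rfl⟩
    exact ⟨h₂.le ⟨q, hq, rfl⟩, hq'.conj hm⟩
  · rintro ⟨hp, hp'⟩
    obtain ⟨q, hq, rfl⟩ := h₂.ge hp
    refine ⟨q, ⟨hq, ?_⟩, rfl⟩
    have := hp'.conj (τ := τ⁻¹) hm.symm
    simpa [mul_assoc] using this

theorem normAut_bdd_le_normAut_bddDer (hG : G ≤ autEO L) :
    normAut (bdd G) ≤ normAut (bddDer G) := by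
  intro τ hτ
  obtain ⟨h₁, h₂⟩ := (mem_normAut_iff ((bdd_le G).trans hG)).1 hτ
  refine (mem_normAut_iff (((bddDer_le G).trans (bdd_le G)).trans hG)).2 ⟨h₁, ?_⟩
  rw [barGroup_bddDer hG, Subgroup.map_commutator, h₂]

/-- Both automorphisms are conjugations by maps of the completed circle. The quotient of these maps
centralizes Bdd'(G), which is itself locally moving, so the quotient is the identity. -/
theorem IsMC.eq_of_eq_on_bddDer (h : IsMC 4 G) {α β : G ≃* G}
    (hαβ : ∀ g : G, (g : Equiv.Perm L) ∈ _root_.bddDer G → α g = β g) : α = β := by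
  obtain ⟨τ, ⟨-, hα⟩, -⟩ := h.existsUnique_conj α
  obtain ⟨τ', ⟨-, hβ⟩, -⟩ := h.existsUnique_conj β
  rw [induces_iff_conj] at hα hβ
  have := h.bddDer.locAct.eq_one_of_commute (σ := τ'⁻¹ * τ) fun g => by
    let k : G := ⟨g, bdd_le G (bddDer_le G g.2)⟩
    have e : τ * bar k * τ⁻¹ = τ' * bar k * τ'⁻¹ := by rw [← hα, ← hβ, hαβ k g.2]
    show τ'⁻¹ * τ * bar k * (τ'⁻¹ * τ)⁻¹ = bar k
    calc _ = τ'⁻¹ * (τ * bar k * τ⁻¹) * τ' := by group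
      _ = bar k := by rw [e]; group
  have e : τ = τ' := by rwa [inv_mul_eq_one, eq_comm] at this
  ext g : 1
  refine Subtype.ext (bar_injOn (h.le_autEO (α g).2) (h.le_autEO (β g).2) ?_)
  rw [hα, hβ, e]

/-- Opp(G) lies in the class and satisfies the first order sentence that all elements preserve
orientation. Elementary equivalence transfers this sentence to G. -/
theorem IsMC.eq_opp (h : IsMC 4 G) (he : LGR.ElementarilyEquivalent G (_root_.opp G)) :
    G = _root_.opp G := by
  have hP : foClass.Def (β := Fin 0) fun M _ _ => ∀ a : M, OriPres a :=
    DefClass.all_elt (DefClass.oriPres.app (DefClass.var _ _))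
  have := (foClass_iff_of_elementarilyEquivalent hP he).2 fun g =>
    (MCGroup.mk' h.opp).oriPres_iff.2 g.2.2
  exact le_antisymm (fun g hg => ⟨hg, (MCGroup.mk' h).oriPres_iff.1 (this ⟨g, hg⟩)⟩) inf_le_left

/-! ### The base and the completion -/

theorem IsMC.dense_orbitOf (h : IsMC 4 G) (x : CBar L) : Dense (orbitOf G x) := by
  rw [dense_iff_inter_open]
  rintro U hU ⟨v, hv⟩
  by_cases hxv : x = v
  · exact ⟨v, hv, 1, one_mem _, by rw [bar_one, hxv]; rfl⟩
  · obtain ⟨a, h₁⟩ := dense (X := CBar L) hxv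
    obtain ⟨g, -, -, hg⟩ := h.locAct.exists_move_fixing h₁.ne₁₂ h₁.ne₂₃.symm hU hv
    exact ⟨_, hg, g, g.2, rfl⟩

theorem orbitOf_emb (hG : G ≤ autEO L) (ht : ∀ x y : L, ∃ g ∈ G, g x = y) (x : L) :
    orbitOf G (emb x) = Set.range (emb : L → CBar L) := by
  ext y
  constructor
  · rintro ⟨g, hg, rfl⟩
    exact ⟨_, (bar_emb (hG hg) x).symm⟩
  · rintro ⟨z, rfl⟩
    obtain ⟨g, hg, rfl⟩ := ht x z
    exact ⟨g, hg, bar_emb (hG hg) x⟩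

theorem induces_bar_iff (hG : G ≤ autEO L) {τ : Equiv.Perm L} (hτ : τ ∈ autEO L) {α : G ≃* G} :
    Induces (bar τ) α ↔ ∀ g : G, (α g : Equiv.Perm L) = τ * g * τ⁻¹ := by
  rw [induces_iff_conj]
  refine forall_congr' fun g => ?_
  have hg := hG g.2
  rw [← bar_inv hτ, ← bar_mul hτ hg, ← bar_mul (mul_mem hτ hg) (inv_mem hτ)]
  exact ⟨bar_injOn (hG (α g).2) (mul_mem (mul_mem hτ hg) (inv_mem hτ)), congrArg bar⟩

/-- C and the orbit M are both dense in the completion, so an isomorphism or anti-isomorphism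
between them extends to the completed circle. The extension still induces `β`, because two
continuous maps that agree on C are equal. -/
theorem IsMC.exists_inducing_of_orbit (h : IsMC 4 G) {M : Set (CBar L)} (hM : M ∈ orbits G)
    {σ : Set.range (emb : L → CBar L) ≃ M} {β : G ≃* G} (hσ : IsPermIso σ β ∨ IsPermAntiIso σ β) :
    ∃ τ : Equiv.Perm (CBar L), Monocircular τ ∧ Induces τ β ∧
      τ '' Set.range (emb : L → CBar L) = M := by
  obtain ⟨z, rfl⟩ := hM
  let i : L → Set.range (emb : L → CBar L) := fun x => ⟨emb x, x, rfl⟩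
  have hi : Function.Surjective i := by
    rintro ⟨_, x, rfl⟩
    exact ⟨x, rfl⟩
  let j : L → CBar L := fun x => σ (i x)
  have hj : Set.range j = orbitOf G z := by
    rw [show j = Subtype.val ∘ (σ ∘ i) from rfl, Set.range_comp,
      (σ.surjective.comp hi).range_eq, Set.image_univ, Subtype.range_coe]
  have hd : DenseRange j := by
    rw [DenseRange, hj]
    exact h.dense_orbitOf z
  have he : Equivariant σ β := hσ.elim And.right And.right
  obtain ⟨τ, hτ, hs⟩ : ∃ τ : Equiv.Perm (CBar L), Monocircular τ ∧ ∀ x, τ (emb x) = j x := by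
    rcases hσ with hσ | hσ
    · obtain ⟨τ, h₁, h₂⟩ := exists_extension denseRange_emb hd
        fun a b c => hσ.1 (i a) (i b) (i c)
      exact ⟨τ, Or.inl h₁, h₂⟩
    · obtain ⟨τ, h₁, h₂⟩ := exists_extension_rev denseRange_emb hd
        fun a b c => hσ.1 (i a) (i b) (i c)
      exact ⟨τ, Or.inr h₁, h₂⟩
  refine ⟨τ, hτ, induces_iff.2 fun g => ?_, ?_⟩
  · have hg := h.le_autEO g.2
    have := Monocircular.eq_of_dense denseRange_emb (f := (bar (g : Equiv.Perm L)).trans τ)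
      (g := τ.trans (bar (β g : Equiv.Perm L))) (hτ.comp (bar_monocircular hg))
      ((bar_monocircular (h.le_autEO (β g).2)).comp hτ) fun x => by
        show τ (bar g (emb x)) = bar (β g) (τ (emb x))
        rw [bar_emb hg, hs, hs]
        exact ((he g (i x) (i _)).1 (bar_emb hg x)).symm
    exact fun x => congrFun (congrArg (fun e : CBar L ≃ CBar L => (e : CBar L → CBar L)) this) x
  · rw [← Set.range_comp, ← hj]
    exact congrArg Set.range (funext hs)

theorem exists_bar_eq {τ : Equiv.Perm (CBar L)} (hτ : Monocircular τ)
    (h : τ '' Set.range (emb : L → CBar L) = Set.range (emb : L → CBar L)) :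
    ∃ τ₀ ∈ autEO L, bar τ₀ = τ := by
  have hF : ∀ x : L, ∃ y : L, emb y = τ (emb x) := fun x => h.le ⟨_, ⟨x, rfl⟩, rfl⟩
  choose F hF using hF
  have hb : Function.Bijective F := by
    constructor
    · intro x y hxy
      exact emb_injective (τ.injective (by rw [← hF, ← hF, hxy]))
    · intro y
      obtain ⟨_, ⟨x, rfl⟩, hx⟩ := h.ge ⟨y, rfl⟩
      exact ⟨x, emb_injective ((hF x).trans hx)⟩
  have hs : ∀ x, τ (emb x) = emb (Equiv.ofBijective F hb x) := fun x => (hF x).symm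
  exact ⟨_, mem_autEO_of_extension hτ hs, bar_eq hτ hs⟩

/-- Every automorphism is conjugation by a unique map of the completed circle, and this map comes
from the base exactly when it maps C onto itself. In any case it maps the orbit C to an isomorphic
or anti-isomorphic orbit; conversely, such an orbit different from C yields an automorphism whose
map does not preserve C. -/
theorem IsMC.autEqBase_iff (h : IsMC 4 G) (ht : ∀ x y : L, ∃ g ∈ G, g x = y) :
    AutEqBase G (normBase G) ↔
      ¬ ∃ M ∈ orbits G, M ≠ Set.range (emb : L → CBar L) ∧
        ∃ (σ : Set.range (emb : L → CBar L) ≃ M) (β : G ≃* G),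
          IsPermIso σ β ∨ IsPermAntiIso σ β := by
  constructor
  · rintro ⟨Φ, hΦ⟩ ⟨M, hM, hne, σ, β, hσ⟩
    obtain ⟨τ, hτ, hβ, rfl⟩ := h.exists_inducing_of_orbit hM hσ
    have h₀ := (Φ.symm β).2.1
    have e : bar (Φ.symm β : Equiv.Perm L) = τ := (h.existsUnique_inducing h β).unique
      ⟨bar_monocircular h₀, (induces_bar_iff h.le_autEO h₀).2 fun g => by
        rw [← hΦ, Φ.apply_symm_apply]⟩ ⟨hτ, hβ⟩
    refine hne ?_
    rw [← Set.range_comp, ← e,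
      show bar (Φ.symm β : Equiv.Perm L) ∘ emb = emb ∘ (Φ.symm β : Equiv.Perm L) from
        funext (bar_emb h₀), Set.range_comp, Equiv.range_eq_univ, Set.image_univ]
  · intro hM
    refine exists_conjEquiv (ι := G.subtype) G.subtype_injective ?_ fun α => ?_
    · rw [Subgroup.coe_subtype, Subtype.range_coe]
      exact inf_le_right
    · obtain ⟨τ, ⟨hτ, hα⟩, hu⟩ := h.existsUnique_inducing h α
      obtain ⟨hbij, hiso⟩ := hα.orbitCorrespondence hτ
      obtain ⟨x₀⟩ : Nonempty L := (CircleBase.nontrivial (L := L)).to_nonempty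
      have ho : Set.range (emb : L → CBar L) ∈ orbits G := ⟨_, (orbitOf_emb h.le_autEO ht x₀).symm⟩
      have hr : τ '' Set.range (emb : L → CBar L) = Set.range (emb : L → CBar L) := by
        by_contra hne
        refine hM ⟨_, hbij.mapsTo ho, hne, τ.image _, α, ?_⟩
        exact hiso.imp (fun h => h.2 _ ho) fun h => h.2 _ ho
      obtain ⟨τ₀, h₀, rfl⟩ := exists_bar_eq hτ hr
      have hc := (induces_bar_iff h.le_autEO h₀).1 hα
      refine ⟨τ₀, ⟨⟨h₀, ?_⟩, hc⟩, fun τ₁ ⟨h₁, h₂⟩ => bar_injOn h₁.1 h₀ (hu _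
        ⟨bar_monocircular h₁.1, (induces_bar_iff h.le_autEO h₁.1).2 h₂⟩)⟩
      have := mem_normalizer_range_of_conj (ι := G.subtype) hc
      rwa [Subgroup.coe_subtype, Subtype.range_coe] at this

end OneGroup

theorem mainTheorem4 :
    -- two groups
    (∀ (L₁ L₂ : Type u) [LinearOrder L₁] [LinearOrder L₂] [CircleBase L₁] [CircleBase L₂]
      (G₁ : Subgroup (Equiv.Perm L₁)) (G₂ : Subgroup (Equiv.Perm L₂)),
      IsMC 4 G₁ → IsMC 4 G₂ →
      -- elementary equivalence
      (LGR.ElementarilyEquivalent G₁ G₂ →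
        LMCPG.ElementarilyEquivalent (EPACT G₁) (EPACT G₂) ∧
        LMCPG.ElementarilyEquivalent (Act (Ep G₁) (opp G₁)) (Act (Ep G₂) (opp G₂))) ∧
      -- reconstruction
      (∀ α : G₁ ≃* G₂,
        (∃! τ : CBar L₁ ≃ CBar L₂, Monocircular τ ∧ Induces τ α) ∧
        (∃! τ : CBar L₁ ≃ CBar L₂, PreservesEo τ ∧ UnionIsIso Set.univ Set.univ τ α) ∧
        (∀ τ : CBar L₁ ≃ CBar L₂, Monocircular τ → Induces τ α →
          PreservesEo τ ∧ UnionIsIso Set.univ Set.univ τ α ∧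
          UnionIsIso (Ep G₁) (Ep G₂) τ α ∧ OrbitCorrespondence τ α)) ∧
      -- isomorphisms of the completed equal orientation structures are the homeomorphisms
      (∀ τ : CBar L₁ ≃ CBar L₂, PreservesEo τ ↔ Continuous τ ∧ Continuous τ.symm)) ∧
    -- one group
    (∀ (L : Type u) [LinearOrder L] [CircleBase L] (G : Subgroup (Equiv.Perm L)), IsMC 4 G →
      -- automorphisms
      (∀ α : G ≃* G, ∃! τ : Equiv.Perm (CBar L), τ ∈ autEO (CBar L) ∧ Induces τ α) ∧
      AutEq G (normAut G) ∧ AutEq G (normHomeo G) ∧ normAut G = normHomeo G ∧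
      (∀ (α : G ≃* G) (τ : Equiv.Perm (CBar L)), τ ∈ autEO (CBar L) → Induces τ α →
        UnionIsIso (Ep G) (Ep G) τ α ∧ OrbitCorrespondence τ α) ∧
      -- characteristic subgroups and their automorphism groups
      ((bdd G).subgroupOf G).Characteristic ∧ ((bddDer G).subgroupOf G).Characteristic ∧
      ((opp G).subgroupOf G).Characteristic ∧
      AutEq (bdd G) (normAut (bdd G)) ∧ AutEq (bddDer G) (normAut (bddDer G)) ∧
      normAut G ≤ normAut (bdd G) ∧ normAut (bdd G) ≤ normAut (bddDer G) ∧
      (∀ α β : G ≃* G, (∀ g : G, (g : Equiv.Perm L) ∈ bddDer G → α g = β g) → α = β) ∧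
      -- when completion is unnecessary
      ((∀ x y : L, ∃ g ∈ G, g x = y) →
        (AutEqBase G (normBase G) ↔
          ¬ ∃ M ∈ orbits G, M ≠ Set.range (emb : L → CBar L) ∧
            ∃ (σ : Set.range (emb : L → CBar L) ≃ M) (β : G ≃* G),
              IsPermIso σ β ∨ IsPermAntiIso σ β)) ∧
      -- elementary equivalence with the orientation-preserving subgroup
      (LGR.ElementarilyEquivalent G (opp G) → G = opp G)) ∧
    -- interpretations, uniform over the class
    (∃ I : FOStrInterp LGR LMCPG, ∀ (L : Type u) [LinearOrder L] [CircleBase L]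
      (G : Subgroup (Equiv.Perm L)), IsMC 4 G →
        I.Interprets (fun g : G => (Act.ofGrp g : EPACT G))) ∧
    (∃ I : SOStrInterp LGR LMCPG, ∀ (L : Type u) [LinearOrder L] [CircleBase L]
      (G : Subgroup (Equiv.Perm L)), IsMC 4 G →
        I.Interprets (fun g : G => (Act.ofGrp g : DCACT G))) ∧
    -- first order expressibility in the language of groups
    (∀ (n : ℕ) (φ : LMCPG.Formula (Fin n)), FOExpressible.{u} n
      fun _ _ _ G g => φ.Realize (fun i => (Act.ofGrp (g i) : EPACT G))) ∧
    (FOExpressible.{u} 1 fun L _ _ _ g => SignedElt (g 0 : Equiv.Perm L)) ∧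
    (FOExpressible.{u} 2 fun L _ _ _ g => SignedElt (g 0 : Equiv.Perm L) ∧
      SignedElt (g 1 : Equiv.Perm L) ∧ SameSign (g 0 : Equiv.Perm L) (g 1 : Equiv.Perm L)) ∧
    (FOExpressible.{u} 1 fun L _ _ _ g => BddElt (g 0 : Equiv.Perm L)) ∧
    (FOExpressible.{u} 1 fun L _ _ _ g => (g 0 : Equiv.Perm L) ∈ autCR L) ∧
    (FOExpressible.{u} 0 fun _ _ _ G _ => ∀ x ∈ Ep G, ∀ y ∈ Ep G, ∃ g ∈ G, bar g x = y) ∧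
    (∀ k : ℕ, FOExpressible.{u} 0 fun _ _ _ G _ => (epOrbits G).encard = k) ∧
    -- second order expressibility in the language of groups
    (∀ (n : ℕ) (φ : LMCPG.Formula (Fin n)), SOExpressible.{u} n
      fun _ _ _ G g => φ.Realize (fun i => (Act.ofGrp (g i) : DCACT G))) ∧
    (∃ ψ : SOFormula LGR (Fin 0) Empty.elim, ∀ (L : Type u) [LinearOrder L] [CircleBase L]
      (G : Subgroup (Equiv.Perm L)), IsMC 4 G → (∀ x y : L, ∃ g ∈ G, g x = y) →
        (ψ.Sat (M := G) Fin.elim0 (fun X => X.elim) ↔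
          Function.Surjective (emb : L → CBar L))) := by
  refine ⟨?_, ?_, exists_foStrInterp, exists_soStrInterp, foExpressible_formula,
    foExpressible_signed, foExpressible_sameSign, foExpressible_bddElt, foExpressible_autCR,
    foExpressible_transitive, foExpressible_orbits, soExpressible_formula,
    exists_soFormula_complete⟩
  · intro L₁ L₂ _ _ _ _ G₁ G₂ h₁ h₂
    refine ⟨fun h => ?_, fun α => ?_, fun τ => preservesEo_iff_homeo⟩
    · exact ⟨elementarilyEquivalent_of_foClass (epSys foClass) (wholeSys foClass)
          (K₁ := MCGroup.mk' h₁) (K₂ := MCGroup.mk' h₂) h,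
        elementarilyEquivalent_of_foClass (epSys foClass) (oppSys foClass)
          (K₁ := MCGroup.mk' h₁) (K₂ := MCGroup.mk' h₂) h⟩
    · have hu := h₁.existsUnique_inducing h₂ α
      refine ⟨hu, ?_, fun τ hτ hα => ?_⟩
      · obtain ⟨τ, ⟨hτ, hα⟩, hτu⟩ := hu
        exact ⟨τ, ⟨hτ.preservesEo, unionIsIso hτ.preservesEo hα fun _ => Iff.rfl⟩,
          fun τ' h' => hτu τ' ⟨preservesEo_iff.1 h'.1, h'.2.induces⟩⟩
      · have he := hτ.preservesEo
        exact ⟨he, unionIsIso he hα fun _ => Iff.rfl, unionIsIso he hα (hα.mem_ep_iff hτ),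
          hα.orbitCorrespondence hτ⟩
  · intro L _ _ G h
    refine ⟨h.existsUnique_conj, h.autEq_normAut, normAut_eq_normHomeo G ▸ h.autEq_normAut,
      normAut_eq_normHomeo G, fun α τ hτ hα => ?_, h.characteristic_bdd, h.characteristic_bddDer,
      h.characteristic_opp, h.bdd.autEq_normAut, h.bddDer.autEq_normAut,
      normAut_le_normAut_bdd h.le_autEO, normAut_bdd_le_normAut_bddDer h.le_autEO,
      fun α β => h.eq_of_eq_on_bddDer, h.autEqBase_iff, h.eq_opp⟩
    have hm := mem_autEO_cBar_iff.1 hτ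
    exact ⟨unionIsIso hτ hα (hα.mem_ep_iff hm), hα.orbitCorrespondence hm⟩
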